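/- Let $n\ge 1$ be an integer and let $0<\beta<2$ and $\beta\le\alpha<n$. Put $$C_\alpha=\pi^{\alpha}\left[\frac{\Gamma\left(\frac{n-\alpha}{4}\right)}{\Gamma\left(\frac{n+\alpha}{4}\right)}\right]^2,\qquad d_\alpha=\pi^{-(n-\alpha)}\left[\frac{\Gamma\left(\frac{2n-\alpha}{4}\right)}{\Gamma\left(\frac{\alpha}{4}\right)}\right]^2,\qquad D_\beta=\frac{4}{\beta}\,\pi^{\frac n2+\beta}\,\frac{\Gamma\left(1-\frac{\beta}{2}\right)}{\Gamma\left(\frac{n+\beta}{2}\right)},$$ and let $d_\beta$ be defined as $d_\alpha$, with $\beta$ in place of $\alpha$. For every complex-valued $f\in L^2(\mathbb R^n)$ the convolutions $|x|^{-n+\alpha/2}*f$ and $|x|^{-n+\beta/2}*f$ converge absolutely almost everywhere, and $$\int_{\mathbb R^n}|f|^2\,dx\ \ge\ \frac{d_\alpha}{C_\alpha}\int_{\mathbb R^n}|x|^{-\alpha}\Big|\,|x|^{-n+\frac{\alpha}{2}}*f\Big|^2dx+\frac{d_\beta}{D_\beta}\int_{\mathbb R^n\times\mathbb R^n}\frac{|h(x)-h(y)|^2}{|x-y|^{n+\beta}}\,|x|^{-\frac{n-\beta}{2}}|y|^{-\frac{n-\beta}{2}}\,dx\,dy,$$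 where $$h(x)=|x|^{\frac{n-\beta}{2}}\left(|x|^{-n+\frac{\beta}{2}}*f\right)(x).$$ Moreover the sharp constant of the Stein–Weiss inequality is not attained: $C_\alpha/d_\alpha$ is the smallest constant $K$ such that $\int_{\mathbb R^n}|x|^{-\alpha}\big|\,|x|^{-n+\alpha/2}*f\big|^2dx\le K\int_{\mathbb R^n}|f|^2dx$ for all $f\in L^2(\mathbb R^n)$, and for $K=C_\alpha/d_\alpha$ this inequality is strict for every $f\in L^2(\mathbb R^n)$ that is not almost everywhere zero. -/

import Mathlib

open MeasureTheory Real
open scoped ENNReal Convolution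

noncomputable section

/-- The constant `C_α = π^α [Γ((n-α)/4) / Γ((n+α)/4)]²` of the sharp Pitt inequality. -/
def pittC (n : ℕ) (α : ℝ) : ℝ :=
  π ^ α * (Gamma ((n - α) / 4) / Gamma ((n + α) / 4)) ^ 2

/-- The constant `D_β = (4/β) π^{n/2+β} Γ(1-β/2) / Γ((n+β)/2)`. -/
def besovD (n : ℕ) (β : ℝ) : ℝ :=
  4 / β * π ^ ((n : ℝ) / 2 + β) * (Gamma (1 - β / 2) / Gamma ((n + β) / 2))

/-- The constant `d_α = π^{-(n-α)} [Γ((2n-α)/4) / Γ(α/4)]²`. -/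
def rieszD (n : ℕ) (α : ℝ) : ℝ :=
  π ^ (-((n : ℝ) - α)) * (Gamma ((2 * n - α) / 4) / Gamma (α / 4)) ^ 2

/-- The kernel `|x|^{-n+α/2}` on `ℝⁿ`. -/
def rieszKernel (n : ℕ) (α : ℝ) (x : EuclideanSpace ℝ (Fin n)) : ℝ :=
  ‖x‖ ^ (-(n : ℝ) + α / 2)

/-- The convolution `|x|^{-n+α/2} * f` on `ℝⁿ`. -/
def rieszConv (n : ℕ) (α : ℝ) (f : EuclideanSpace ℝ (Fin n) → ℂ) :
    EuclideanSpace ℝ (Fin n) → ℂ :=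
  rieszKernel n α ⋆[ContinuousLinearMap.lsmul ℝ ℝ, volume] f

/-- Absolute convergence at `x` of the integral that defines `(|x|^{-n+α/2} * f)(x)`. -/
def RieszConvExistsAt (n : ℕ) (α : ℝ) (f : EuclideanSpace ℝ (Fin n) → ℂ)
    (x : EuclideanSpace ℝ (Fin n)) : Prop :=
  ConvolutionExistsAt (rieszKernel n α) f x (ContinuousLinearMap.lsmul ℝ ℝ) volume

/-- The squared `L²` norm `∫ |f|² dx`. -/
def sqNormL2 (n : ℕ) (f : EuclideanSpace ℝ (Fin n) → ℂ) : ℝ≥0∞ :=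
  ∫⁻ x, ENNReal.ofReal (‖f x‖ ^ 2)

/-- The Stein–Weiss quadratic form `∫ |x|^{-α} | |x|^{-n+α/2} * f |² dx`. -/
def steinWeissForm (n : ℕ) (α : ℝ) (f : EuclideanSpace ℝ (Fin n) → ℂ) : ℝ≥0∞ :=
  ∫⁻ x, ENNReal.ofReal (‖x‖ ^ (-α) * ‖rieszConv n α f x‖ ^ 2)

/-- The squared weighted Besov norm
`∫∫ |h(x)-h(y)|² / |x-y|^{n+β} |x|^{-(n-β)/2} |y|^{-(n-β)/2} dx dy`. -/
def weightedBesovForm (n : ℕ) (β : ℝ) (h : EuclideanSpace ℝ (Fin n) → ℂ) : ℝ≥0∞ :=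
  ∫⁻ p : EuclideanSpace ℝ (Fin n) × EuclideanSpace ℝ (Fin n),
    ENNReal.ofReal (‖h p.1 - h p.2‖ ^ 2 / ‖p.1 - p.2‖ ^ ((n : ℝ) + β)
      * ‖p.1‖ ^ (-((n : ℝ) - β) / 2) * ‖p.2‖ ^ (-((n : ℝ) - β) / 2))

/-- The function `h(x) = |x|^{(n-β)/2} (|x|^{-n+β/2} * f)(x)`. -/
def groundStateQuotient (n : ℕ) (β : ℝ) (f : EuclideanSpace ℝ (Fin n) → ℂ) :
    EuclideanSpace ℝ (Fin n) → ℂ :=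
  fun x => ((‖x‖ ^ (((n : ℝ) - β) / 2) : ℝ) : ℂ) * rieszConv n β f x

end

/-!
The proof is a real-variable one: powers of `|x|` are superpositions of heat kernels `p_t`
(`lintegral_rpow_mul_heat`), and all constants come out of the semigroup property.

*The Stein–Weiss inequality.* Convolving two powers of `|x|` gives a power of `|x|` with the
explicit constant `rieszComp` (`lintegral_riesz_mul_riesz`). Hence the Schur test with the weight
`|x|^(-n/2)` proves weighted Stein–Weiss inequalities (`lintegral_steinWeiss`); for the kernel
`|x|^(-n+α/2)` the constant obtained is exactly `C_α / d_α` (`pittC_div_rieszD`). Because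
`|x|^(-n+α/2)` is a multiple of `|x|^(-n+(α-β)/2) * |x|^(-n+β/2)`, the same inequality shows that
the normalized form `(d_α / C_α) ∫ |x|^(-α) | |x|^(-n+α/2) * f |²` decreases with `α`
(`steinWeissForm_anti`), which reduces the error estimate to the case `α = β`.

*The error estimate for `α = β`.* Let `u = |x|^(-n+β/2) * f`, `w = |x|^(-(n-β)/2)` and `h = u / w`.
Expanding the square gives, at every time `t`,
`∬ (h(x)-h(y))² w(x) w(y) p_t(x-y) dx dy = 2 ∫ (u²/w) (p_t * w) - 2 ∫ u (p_t * u)`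
for real `u`. Integrate this against `t^(-γ-1) dt` with `γ = β/2`. The left side becomes the
weighted Besov form. On the right, `∫ t^(-γ-1) (p_t * w - w) dt` is a negative multiple of
`|x|^(-β) w` and produces the Stein–Weiss form; as `p_t * w - w` is not of one sign, the gain and
the loss of every single heat kernel in the superposition for `w` are integrated separately
(`lintegral_heatLoss`, `lintegral_heatGain`). What remains is the energy
`∫ t^(-γ-1) (‖u‖² - ∫ u (p_t * u)) dt`. With `M(s) = ∫ f (p_s * f)`, which is decreasing and at most
`‖f‖²`, it is a multiple of `∬ t^(-γ-1) s^(γ-1) (M(s) - M(s+t)) ds dt`, and the inequality of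
Frullani type `∫ (M(s) - M(s+sr)) ds/s ≤ log(1+r) ‖f‖²` bounds it by a multiple of `‖f‖²`
(`lintegral_heatForm_energy_le`). This gives `groundState_inequality_real` for real `f` in
`L¹ ∩ L²`; real and imaginary parts, truncation to balls and Fatou's lemma extend it to `L²`.

*Equality does not occur.* If `f` attains the Stein–Weiss constant, the error estimate with
`β = min(α, 1)` makes the Besov form vanish, so `h` is constant and the Stein–Weiss form of order
`β` is a multiple of `∫ |x|^(-n) dx = ∞`. It is finite, so `h = 0`, and then `f = 0`.

*The constant is sharp.* Testing on `|x|^(δ-n/2)` cut off to the unit ball and letting `δ → 0`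
recovers the Schur constant (`pittC_div_rieszD_le`).
-/

/-! ### Integrals over the half-line -/

/-- Scaling of an integral over the half-line. -/
theorem lintegral_Ioi_comp_mul {c : ℝ} (hc : 0 < c) (F : ℝ → ℝ≥0∞) :
    ∫⁻ t in Set.Ioi (0 : ℝ), F t = ENNReal.ofReal c * ∫⁻ t in Set.Ioi (0 : ℝ), F (c * t) := by
  have himg : (fun t : ℝ => c * t) '' Set.Ioi (0 : ℝ) = Set.Ioi 0 := by
    rw [Set.image_mul_left_Ioi hc, mul_zero]
  have h := lintegral_image_eq_lintegral_abs_deriv_mul (f := fun t : ℝ => c * t)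
    (f' := fun _ => c) (s := Set.Ioi (0 : ℝ)) measurableSet_Ioi
    (fun x _ => by simpa using ((hasDerivAt_id x).const_mul c).hasDerivWithinAt)
    (fun x _ y _ h => mul_left_cancel₀ hc.ne' h) F
  rw [himg] at h
  rw [h, lintegral_const_mul' _ _ ENNReal.ofReal_ne_top, abs_of_pos hc]

/-- Inversion of the half-line. -/
theorem lintegral_Ioi_comp_inv (F : ℝ → ℝ≥0∞) :
    ∫⁻ t in Set.Ioi (0 : ℝ), F t
      = ∫⁻ t in Set.Ioi (0 : ℝ), ENNReal.ofReal (t ^ (-2 : ℝ)) * F t⁻¹ := by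
  have himg : (fun t : ℝ => t⁻¹) '' Set.Ioi (0 : ℝ) = Set.Ioi 0 := by
    ext t
    simp only [Set.mem_image, Set.mem_Ioi]
    exact ⟨fun ⟨s, hs, h⟩ => h ▸ inv_pos.2 hs, fun h => ⟨t⁻¹, inv_pos.2 h, inv_inv t⟩⟩
  have h := lintegral_image_eq_lintegral_abs_deriv_mul (f := fun t : ℝ => t⁻¹)
    (f' := fun t => -(t ^ 2)⁻¹) (s := Set.Ioi (0 : ℝ)) measurableSet_Ioi
    (fun x hx => (hasDerivAt_inv (ne_of_gt hx)).hasDerivWithinAt)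
    (fun x _ y _ h => inv_injective h) F
  rw [himg] at h
  rw [h]
  refine setLIntegral_congr_fun measurableSet_Ioi fun t (ht : 0 < t) => ?_
  rw [abs_neg, abs_of_pos (by positivity), rpow_neg ht.le, rpow_two]

/-- Euler's integral for the Gamma function as a Lebesgue integral. -/
theorem lintegral_rpow_mul_exp {b c : ℝ} (hb : 0 < b) (hc : 0 < c) :
    ∫⁻ t in Set.Ioi (0 : ℝ), ENNReal.ofReal (t ^ (b - 1) * rexp (-(c * t)))
      = ENNReal.ofReal (Gamma b * c ^ (-b)) := by
  have hint : IntegrableOn (fun t : ℝ => t ^ (b - 1) * rexp (-(c * t))) (Set.Ioi 0) := by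
    have := integrableOn_rpow_mul_exp_neg_mul_rpow (p := 1) (s := b - 1) (b := c)
      (by linarith) one_pos hc
    simpa only [rpow_one, neg_mul] using this
  rw [← ofReal_integral_eq_lintegral_ofReal hint, integral_rpow_mul_exp_neg_mul_Ioi hb hc]
  · congr 1
    rw [one_div, inv_rpow hc.le, ← rpow_neg hc.le, mul_comm]
  · filter_upwards [ae_restrict_mem measurableSet_Ioi] with t (ht : 0 < t)
    positivity

/-- The double integral of a function of `s + t` against power weights reduces to a single
one; the Beta integral appears as a factor that depends on the exponents only. -/
theorem lintegral_lintegral_add_aux {a b : ℝ} {F : ℝ → ℝ≥0∞} (hF : Measurable F) :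
    ∫⁻ t in Set.Ioi (0 : ℝ), ∫⁻ s in Set.Ioi (0 : ℝ),
        ENNReal.ofReal (t ^ (b - 1)) * (ENNReal.ofReal (s ^ (a - 1)) * F (t + s))
      = (∫⁻ v in Set.Ioi (0 : ℝ), ENNReal.ofReal (v ^ (a - 1) * (1 + v) ^ (-(a + b))))
        * ∫⁻ r in Set.Ioi (0 : ℝ), ENNReal.ofReal (r ^ (a + b - 1)) * F r := by
  calc _ = ∫⁻ t in Set.Ioi (0 : ℝ), ∫⁻ v in Set.Ioi (0 : ℝ),
        ENNReal.ofReal (v ^ (a - 1)) *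
          (ENNReal.ofReal (t ^ (a + b - 1)) * F ((1 + v) * t)) := by
        refine setLIntegral_congr_fun measurableSet_Ioi fun t (ht : 0 < t) => ?_
        rw [lintegral_Ioi_comp_mul ht, ← lintegral_const_mul' _ _ ENNReal.ofReal_ne_top]
        refine setLIntegral_congr_fun measurableSet_Ioi fun v (hv : 0 < v) => ?_
        rw [← mul_assoc, ← mul_assoc, ← mul_assoc, ← ENNReal.ofReal_mul ht.le,
          ← ENNReal.ofReal_mul (by positivity), ← ENNReal.ofReal_mul (by positivity)]
        congr 2
        · rw [mul_rpow ht.le hv.le, show a + b - 1 = 1 + (b - 1) + (a - 1) by ring,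
            rpow_add ht, rpow_add ht, rpow_one]
          ring
        · ring
    _ = ∫⁻ v in Set.Ioi (0 : ℝ), ∫⁻ t in Set.Ioi (0 : ℝ), ENNReal.ofReal (v ^ (a - 1)) *
          (ENNReal.ofReal (t ^ (a + b - 1)) * F ((1 + v) * t)) := by
        refine lintegral_lintegral_swap (Measurable.aemeasurable ?_)
        simp only [Function.uncurry_def]
        fun_prop
    _ = ∫⁻ v in Set.Ioi (0 : ℝ), ENNReal.ofReal (v ^ (a - 1) * (1 + v) ^ (-(a + b))) *
          ∫⁻ r in Set.Ioi (0 : ℝ), ENNReal.ofReal (r ^ (a + b - 1)) * F r := by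
        refine setLIntegral_congr_fun measurableSet_Ioi fun v (hv : 0 < v) => ?_
        have h1 : 0 < 1 + v := by linarith
        rw [lintegral_const_mul' _ _ ENNReal.ofReal_ne_top, lintegral_Ioi_comp_mul h1
          (fun r => ENNReal.ofReal (r ^ (a + b - 1)) * F r), ENNReal.ofReal_mul (by positivity),
          mul_assoc]
        congr 1
        rw [← mul_assoc, ← lintegral_const_mul' _ _ (by finiteness)]
        refine setLIntegral_congr_fun measurableSet_Ioi fun t (ht : 0 < t) => ?_
        rw [← mul_assoc, ← ENNReal.ofReal_mul (by positivity), ← ENNReal.ofReal_mul (by positivity)]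
        congr 2
        rw [mul_rpow h1.le ht.le, ← mul_assoc]
        conv_rhs => rw [← rpow_one (1 + v), ← rpow_mul h1.le, ← rpow_add h1, rpow_one,
          ← rpow_add h1]
        rw [show 1 * -(a + b) + 1 + (a + b - 1) = 0 by ring, rpow_zero, one_mul]
    _ = _ := by
        rw [lintegral_mul_const]
        fun_prop

/-- The Beta integral over the half-line. -/
theorem lintegral_beta {a b : ℝ} (ha : 0 < a) (hb : 0 < b) :
    ∫⁻ v in Set.Ioi (0 : ℝ), ENNReal.ofReal (v ^ (a - 1) * (1 + v) ^ (-(a + b)))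
      = ENNReal.ofReal (Gamma a * Gamma b / Gamma (a + b)) := by
  have hΓ : 0 < Gamma (a + b) := Gamma_pos_of_pos (by positivity)
  have h := lintegral_lintegral_add_aux (a := a) (b := b)
    (F := fun r => ENNReal.ofReal (rexp (-(1 * r)))) (by fun_prop)
  have h1 : ∀ c : ℝ, 0 < c → ∫⁻ r in Set.Ioi (0 : ℝ),
      ENNReal.ofReal (r ^ (c - 1)) * ENNReal.ofReal (rexp (-(1 * r)))
        = ENNReal.ofReal (Gamma c) := by
    intro c hc
    have := lintegral_rpow_mul_exp hc one_pos
    rw [one_rpow, mul_one] at this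
    rw [← this]
    refine setLIntegral_congr_fun measurableSet_Ioi fun t (ht : 0 < t) => ?_
    rw [ENNReal.ofReal_mul (by positivity)]
  rw [h1 _ (by positivity)] at h
  have h2 : ∫⁻ t in Set.Ioi (0 : ℝ), ∫⁻ s in Set.Ioi (0 : ℝ), ENNReal.ofReal (t ^ (b - 1)) *
      (ENNReal.ofReal (s ^ (a - 1)) * ENNReal.ofReal (rexp (-(1 * (t + s)))))
        = ENNReal.ofReal (Gamma b) * ENNReal.ofReal (Gamma a) := by
    rw [← h1 b hb, ← h1 a ha, ← lintegral_mul_const _ (by fun_prop)]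
    refine lintegral_congr fun t => ?_
    rw [← lintegral_const_mul _ (by fun_prop)]
    refine lintegral_congr fun s => ?_
    rw [mul_add, neg_add, exp_add, ENNReal.ofReal_mul (by positivity)]
    ring
  rw [h2] at h
  have hne : ENNReal.ofReal (Gamma (a + b)) ≠ 0 := by simpa using hΓ
  rw [ENNReal.ofReal_div_of_pos hΓ, ENNReal.eq_div_iff hne ENNReal.ofReal_ne_top, mul_comm, ← h,
    ENNReal.ofReal_mul (Gamma_pos_of_pos ha).le, mul_comm]

/-- The substitution `r = s + t` in a double integral against power weights: the semigroup
property of the fractional integrals. -/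
theorem lintegral_lintegral_add {a b : ℝ} (ha : 0 < a) (hb : 0 < b) {F : ℝ → ℝ≥0∞}
    (hF : Measurable F) :
    ∫⁻ t in Set.Ioi (0 : ℝ), ∫⁻ s in Set.Ioi (0 : ℝ),
        ENNReal.ofReal (t ^ (b - 1)) * (ENNReal.ofReal (s ^ (a - 1)) * F (t + s))
      = ENNReal.ofReal (Gamma a * Gamma b / Gamma (a + b))
        * ∫⁻ r in Set.Ioi (0 : ℝ), ENNReal.ofReal (r ^ (a + b - 1)) * F r := by
  rw [lintegral_lintegral_add_aux hF, lintegral_beta ha hb]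

/-- Integration by parts against `t ^ (-γ - 1)` for the primitive of a nonnegative function,
in the form given by Tonelli's theorem. -/
theorem lintegral_rpow_mul_primitive {γ : ℝ} (hγ : 0 < γ) {g : ℝ → ℝ≥0∞} (hg : Measurable g) :
    ∫⁻ t in Set.Ioi (0 : ℝ), ENNReal.ofReal (t ^ (-γ - 1)) * ∫⁻ r in Set.Ioo 0 t, g r
      = ENNReal.ofReal γ⁻¹ * ∫⁻ r in Set.Ioi (0 : ℝ), ENNReal.ofReal (r ^ (-γ)) * g r := by
  set G : ℝ × ℝ → ℝ≥0∞ := {p : ℝ × ℝ | p.2 < p.1}.indicator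
    (fun p => ENNReal.ofReal (p.1 ^ (-γ - 1)) * g p.2) with hG
  have hGm : Measurable G :=
    Measurable.indicator (by fun_prop) (measurableSet_lt measurable_snd measurable_fst)
  calc _ = ∫⁻ t in Set.Ioi (0 : ℝ), ∫⁻ r in Set.Ioi (0 : ℝ), G (t, r) := by
        refine setLIntegral_congr_fun measurableSet_Ioi fun t (ht : 0 < t) => ?_
        rw [← lintegral_const_mul' _ _ ENNReal.ofReal_ne_top, ← Set.Iio_inter_Ioi,
          ← setLIntegral_indicator measurableSet_Iio]
        refine lintegral_congr fun r => ?_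
        simp [hG, Set.indicator_apply]
    _ = ∫⁻ r in Set.Ioi (0 : ℝ), ∫⁻ t in Set.Ioi (0 : ℝ), G (t, r) :=
        lintegral_lintegral_swap hGm.aemeasurable
    _ = ∫⁻ r in Set.Ioi (0 : ℝ), ENNReal.ofReal γ⁻¹ * (ENNReal.ofReal (r ^ (-γ)) * g r) := by
        refine setLIntegral_congr_fun measurableSet_Ioi fun r (hr : 0 < r) => ?_
        have h1 : ∀ t, G (t, r) = (Set.Ioi r).indicator
            (fun t => ENNReal.ofReal (t ^ (-γ - 1)) * g r) t := by
          intro t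
          simp [hG, Set.indicator_apply]
        simp_rw [h1]
        rw [setLIntegral_indicator measurableSet_Ioi, Set.Ioi_inter_Ioi, max_eq_left hr.le,
          lintegral_mul_const _ (by fun_prop), ← ofReal_integral_eq_lintegral_ofReal
            (integrableOn_Ioi_rpow_of_lt (by linarith) hr), integral_Ioi_rpow_of_lt (by linarith) hr,
          ← mul_assoc, ← ENNReal.ofReal_mul (by positivity)]
        · congr 2
          rw [show -γ - 1 + 1 = -γ by ring, neg_div_neg_eq]
          field_simp
        · filter_upwards [ae_restrict_mem measurableSet_Ioi] with t (ht : r < t)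
          have := hr.trans ht
          positivity
    _ = _ := by
        rw [lintegral_const_mul' _ _ ENNReal.ofReal_ne_top]

/-- The integral of `t ^ (-γ - 1) * (1 - (1 + t) ^ (-c))`. -/
theorem lintegral_one_sub_rpow {γ c : ℝ} (hγ0 : 0 < γ) (hγ1 : γ < 1) (hc : 0 < c) :
    ∫⁻ t in Set.Ioi (0 : ℝ), ENNReal.ofReal (t ^ (-γ - 1)) *
        ENNReal.ofReal (1 - (1 + t) ^ (-c))
      = ENNReal.ofReal (Gamma (1 - γ) / γ * (Gamma (c + γ) / Gamma c)) := by
  have hprim : ∀ t : ℝ, 0 < t → ENNReal.ofReal (1 - (1 + t) ^ (-c))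
      = ∫⁻ r in Set.Ioo 0 t, ENNReal.ofReal (c * (1 + r) ^ (-c - 1)) := by
    intro t ht
    have hd : ∀ r ∈ Set.uIcc 0 t, HasDerivAt (fun r : ℝ => -(1 + r) ^ (-c))
        (c * (1 + r) ^ (-c - 1)) r := by
      intro r hr
      rw [Set.uIcc_of_le ht.le] at hr
      have h1 : 0 < 1 + r := by linarith [hr.1]
      have := (((hasDerivAt_id r).const_add 1).rpow_const (p := -c) (Or.inl h1.ne')).neg
      convert! this using 1
      simp
    have hcont : ContinuousOn (fun r : ℝ => c * (1 + r) ^ (-c - 1)) (Set.uIcc 0 t) := by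
      intro r hr
      rw [Set.uIcc_of_le ht.le] at hr
      have h1 : 0 < 1 + r := by linarith [hr.1]
      exact (continuousAt_const.mul ((continuousAt_const.add continuousAt_id).rpow_const
        (Or.inl h1.ne'))).continuousWithinAt
    have hii := hcont.intervalIntegrable (μ := volume)
    have h := intervalIntegral.integral_eq_sub_of_hasDerivAt hd hii
    rw [intervalIntegral.integral_of_le ht.le, integral_Ioc_eq_integral_Ioo] at h
    rw [← ofReal_integral_eq_lintegral_ofReal, h]
    · simp; ring_nf
    · exact ((intervalIntegrable_iff_integrableOn_Ioc_of_le ht.le).1 hii).mono_set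
        Set.Ioo_subset_Ioc_self
    · filter_upwards [ae_restrict_mem measurableSet_Ioo] with r hr
      have h1 : 0 < 1 + r := by linarith [hr.1]
      positivity
  calc _ = ∫⁻ t in Set.Ioi (0 : ℝ), ENNReal.ofReal (t ^ (-γ - 1)) *
        ∫⁻ r in Set.Ioo 0 t, ENNReal.ofReal (c * (1 + r) ^ (-c - 1)) := by
        refine setLIntegral_congr_fun measurableSet_Ioi fun t (ht : 0 < t) => ?_
        rw [hprim t ht]
    _ = ENNReal.ofReal γ⁻¹ * ∫⁻ r in Set.Ioi (0 : ℝ), ENNReal.ofReal (r ^ (-γ)) *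
        ENNReal.ofReal (c * (1 + r) ^ (-c - 1)) :=
        lintegral_rpow_mul_primitive hγ0 (by fun_prop)
    _ = ENNReal.ofReal γ⁻¹ * (ENNReal.ofReal c * ∫⁻ r in Set.Ioi (0 : ℝ),
        ENNReal.ofReal (r ^ (1 - γ - 1) * (1 + r) ^ (-((1 - γ) + (c + γ))))) := by
        congr 1
        rw [← lintegral_const_mul' _ _ ENNReal.ofReal_ne_top]
        refine setLIntegral_congr_fun measurableSet_Ioi fun r (hr : 0 < r) => ?_
        rw [← ENNReal.ofReal_mul (by positivity), ← ENNReal.ofReal_mul (by positivity)]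
        congr 1
        rw [show 1 - γ - 1 = -γ by ring, show -((1 - γ) + (c + γ)) = -c - 1 by ring]
        ring
    _ = _ := by
        rw [lintegral_beta (by linarith) (by linarith), ← ENNReal.ofReal_mul hc.le,
          ← ENNReal.ofReal_mul (by positivity), show 1 - γ + (c + γ) = c + 1 by ring,
          Gamma_add_one hc.ne']
        congr 1
        field_simp

/-- The integral of `t ^ (-γ - 1) * log (1 + t)`. -/
theorem lintegral_log {γ : ℝ} (hγ0 : 0 < γ) (hγ1 : γ < 1) :
    ∫⁻ t in Set.Ioi (0 : ℝ), ENNReal.ofReal (t ^ (-γ - 1)) * ENNReal.ofReal (log (1 + t))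
      = ENNReal.ofReal (Gamma (1 - γ) / γ * Gamma γ) := by
  have hprim : ∀ t : ℝ, 0 < t → ENNReal.ofReal (log (1 + t))
      = ∫⁻ r in Set.Ioo 0 t, ENNReal.ofReal ((1 + r)⁻¹) := by
    intro t ht
    have hd : ∀ r ∈ Set.uIcc 0 t, HasDerivAt (fun r : ℝ => log (1 + r)) ((1 + r)⁻¹) r := by
      intro r hr
      rw [Set.uIcc_of_le ht.le] at hr
      have h1 : 0 < 1 + r := by linarith [hr.1]
      have := ((hasDerivAt_id r).const_add 1).log h1.ne'
      convert! this using 1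
      simp
    have hcont : ContinuousOn (fun r : ℝ => (1 + r)⁻¹) (Set.uIcc 0 t) := by
      intro r hr
      rw [Set.uIcc_of_le ht.le] at hr
      have h1 : 0 < 1 + r := by linarith [hr.1]
      exact ((continuousAt_const.add continuousAt_id).inv₀ h1.ne').continuousWithinAt
    have hii := hcont.intervalIntegrable (μ := volume)
    have h := intervalIntegral.integral_eq_sub_of_hasDerivAt hd hii
    rw [intervalIntegral.integral_of_le ht.le, integral_Ioc_eq_integral_Ioo] at h
    rw [← ofReal_integral_eq_lintegral_ofReal, h]
    · simp
    · exact ((intervalIntegrable_iff_integrableOn_Ioc_of_le ht.le).1 hii).mono_set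
        Set.Ioo_subset_Ioc_self
    · filter_upwards [ae_restrict_mem measurableSet_Ioo] with r hr
      have h1 : 0 < 1 + r := by linarith [hr.1]
      positivity
  calc _ = ∫⁻ t in Set.Ioi (0 : ℝ), ENNReal.ofReal (t ^ (-γ - 1)) *
        ∫⁻ r in Set.Ioo 0 t, ENNReal.ofReal ((1 + r)⁻¹) := by
        refine setLIntegral_congr_fun measurableSet_Ioi fun t (ht : 0 < t) => ?_
        rw [hprim t ht]
    _ = ENNReal.ofReal γ⁻¹ * ∫⁻ r in Set.Ioi (0 : ℝ), ENNReal.ofReal (r ^ (-γ)) *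
        ENNReal.ofReal ((1 + r)⁻¹) :=
        lintegral_rpow_mul_primitive hγ0 (by fun_prop)
    _ = ENNReal.ofReal γ⁻¹ * ∫⁻ r in Set.Ioi (0 : ℝ),
        ENNReal.ofReal (r ^ (1 - γ - 1) * (1 + r) ^ (-((1 - γ) + γ))) := by
        congr 1
        refine setLIntegral_congr_fun measurableSet_Ioi fun r (hr : 0 < r) => ?_
        rw [← ENNReal.ofReal_mul (by positivity)]
        congr 1
        rw [show 1 - γ - 1 = -γ by ring, show -((1 - γ) + γ) = -1 by ring,
          rpow_neg_one]
    _ = _ := by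
        rw [lintegral_beta (by linarith) hγ0, ← ENNReal.ofReal_mul (by positivity)]
        congr 1
        rw [show 1 - γ + γ = 1 by ring, Gamma_one]
        field_simp

/-! ### The heat kernel and its power superpositions -/

/-- The Euclidean space `ℝⁿ`. -/
abbrev Euc (n : ℕ) : Type := EuclideanSpace ℝ (Fin n)

/-- The heat kernel `(4πt)^(-n/2) exp(-|x|²/(4t))` on `ℝⁿ`. -/
noncomputable def heat (n : ℕ) (t : ℝ) (x : Euc n) : ℝ :=
  (4 * π * t) ^ (-(n : ℝ) / 2) * rexp (-(‖x‖ ^ 2 / (4 * t)))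

theorem heat_nonneg {n : ℕ} {t : ℝ} (ht : 0 < t) (x : Euc n) : 0 ≤ heat n t x := by
  unfold heat; positivity

theorem heat_neg {n : ℕ} (t : ℝ) (x : Euc n) : heat n t (-x) = heat n t x := by
  simp [heat]

theorem measurable_heat (n : ℕ) : Measurable (fun p : ℝ × Euc n => heat n p.1 p.2) := by
  unfold heat; fun_prop

@[fun_prop]
theorem measurable_heat_comp {n : ℕ} {X : Type*} [MeasurableSpace X] {T : X → ℝ} {Y : X → Euc n}
    (hT : Measurable T) (hY : Measurable Y) : Measurable (fun p => heat n (T p) (Y p)) :=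
  (measurable_heat n).comp (hT.prodMk hY)

/-- The Gaussian integral on `ℝⁿ` as a Lebesgue integral. -/
theorem lintegral_gaussian (n : ℕ) {b : ℝ} (hb : 0 < b) :
    ∫⁻ x : Euc n, ENNReal.ofReal (rexp (-b * ‖x‖ ^ 2)) = ENNReal.ofReal ((π / b) ^ ((n : ℝ) / 2)) := by
  have h := GaussianFourier.integral_rexp_neg_mul_sq_norm (V := Euc n) hb
  rw [finrank_euclideanSpace_fin] at h
  rw [← h, ofReal_integral_eq_lintegral_ofReal]
  · refine Integrable.of_integral_ne_zero ?_
    rw [h]; positivity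
  · exact Filter.Eventually.of_forall fun x => by positivity

/-- The semigroup property of the heat kernel. -/
theorem lintegral_heat_mul_heat {n : ℕ} {t s : ℝ} (ht : 0 < t) (hs : 0 < s) (x : Euc n) :
    ∫⁻ y, ENNReal.ofReal (heat n t (x - y)) * ENNReal.ofReal (heat n s y)
      = ENNReal.ofReal (heat n (t + s) x) := by
  have hb : 0 < (t + s) / (4 * t * s) := by positivity
  have key : ∀ y, ENNReal.ofReal (heat n t (x - y)) * ENNReal.ofReal (heat n s y)
      = ENNReal.ofReal ((4 * π * t) ^ (-(n : ℝ) / 2) * (4 * π * s) ^ (-(n : ℝ) / 2) *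
          rexp (-(‖x‖ ^ 2 / (4 * (t + s))))) * ENNReal.ofReal
          (rexp (-((t + s) / (4 * t * s)) * ‖y - (s / (t + s)) • x‖ ^ 2)) := by
    intro y
    rw [← ENNReal.ofReal_mul (heat_nonneg ht _), ← ENNReal.ofReal_mul (by positivity)]
    congr 1
    have : -(‖x - y‖ ^ 2 / (4 * t)) + -(‖y‖ ^ 2 / (4 * s)) = -(‖x‖ ^ 2 / (4 * (t + s))) +
        -((t + s) / (4 * t * s)) * ‖y - (s / (t + s)) • x‖ ^ 2 := by
      rw [norm_sub_sq_real, norm_sub_sq_real, real_inner_smul_right, norm_smul, mul_pow,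
        norm_of_nonneg (by positivity), real_inner_comm]
      field_simp
      ring
    unfold heat
    rw [mul_mul_mul_comm, ← exp_add, this, exp_add]
    ring
  simp_rw [key]
  rw [lintegral_const_mul' _ _ ENNReal.ofReal_ne_top,
    lintegral_sub_right_eq_self (fun y : Euc n => ENNReal.ofReal
      (rexp (-((t + s) / (4 * t * s)) * ‖y‖ ^ 2))), lintegral_gaussian n hb,
    ← ENNReal.ofReal_mul (by positivity)]
  congr 1
  unfold heat
  have : (4 * π * t) ^ (-(n : ℝ) / 2) * (4 * π * s) ^ (-(n : ℝ) / 2) *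
      (π / ((t + s) / (4 * t * s))) ^ ((n : ℝ) / 2) = (4 * π * (t + s)) ^ (-(n : ℝ) / 2) := by
    rw [← mul_rpow (by positivity) (by positivity), show (n : ℝ) / 2 = -(-(n : ℝ) / 2) by ring,
      rpow_neg (by positivity), ← inv_rpow (by positivity),
      ← mul_rpow (by positivity) (by positivity)]
    congr 1
    field_simp
  rw [← this]
  ring

theorem lintegral_heat {n : ℕ} {t : ℝ} (ht : 0 < t) :
    ∫⁻ x : Euc n, ENNReal.ofReal (heat n t x) = 1 := by
  have : ∀ x : Euc n, ENNReal.ofReal (heat n t x) = ENNReal.ofReal ((4 * π * t) ^ (-(n : ℝ) / 2)) *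
      ENNReal.ofReal (rexp (-(1 / (4 * t)) * ‖x‖ ^ 2)) := by
    intro x
    rw [← ENNReal.ofReal_mul (by positivity)]
    unfold heat
    congr 3
    ring
  simp_rw [this]
  rw [lintegral_const_mul' _ _ ENNReal.ofReal_ne_top, lintegral_gaussian n (by positivity),
    ← ENNReal.ofReal_mul (by positivity), ← ENNReal.ofReal_one]
  congr 1
  rw [show π / (1 / (4 * t)) = 4 * π * t by field_simp, ← rpow_add (by positivity)]
  simp [neg_div]

/-- The constant in `∫₀^∞ t^(b-1) heat t x dt = heatMix n b * |x|^(2b-n)`. -/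
noncomputable def heatMix (n : ℕ) (b : ℝ) : ℝ :=
  π ^ (-(n : ℝ) / 2) * 4 ^ (-b) * Gamma ((n : ℝ) / 2 - b)

theorem heatMix_pos {n : ℕ} {b : ℝ} (hb : b < (n : ℝ) / 2) : 0 < heatMix n b := by
  unfold heatMix; positivity

/-- Powers of `|x|` are superpositions of heat kernels. -/
theorem lintegral_rpow_mul_heat {n : ℕ} {b : ℝ} (hb : b < (n : ℝ) / 2) {x : Euc n} (hx : x ≠ 0) :
    ∫⁻ t in Set.Ioi (0 : ℝ), ENNReal.ofReal (t ^ (b - 1)) * ENNReal.ofReal (heat n t x)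
      = ENNReal.ofReal (heatMix n b * ‖x‖ ^ (2 * b - n)) := by
  have hx' : 0 < ‖x‖ := norm_pos_iff.2 hx
  rw [lintegral_Ioi_comp_inv]
  calc _ = ∫⁻ t in Set.Ioi (0 : ℝ), ENNReal.ofReal ((4 * π) ^ (-(n : ℝ) / 2)) *
        ENNReal.ofReal (t ^ ((n : ℝ) / 2 - b - 1) * rexp (-((‖x‖ ^ 2 / 4) * t))) := by
        refine setLIntegral_congr_fun measurableSet_Ioi fun t (ht : 0 < t) => ?_
        rw [← ENNReal.ofReal_mul (by positivity), ← ENNReal.ofReal_mul (by positivity),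
          ← ENNReal.ofReal_mul (by positivity)]
        congr 1
        unfold heat
        have h1 : ‖x‖ ^ 2 / (4 * t⁻¹) = ‖x‖ ^ 2 / 4 * t := by field_simp
        rw [h1, mul_rpow (by positivity) (by positivity), inv_rpow ht.le, inv_rpow ht.le,
          ← rpow_neg ht.le, ← rpow_neg ht.le,
          show (n : ℝ) / 2 - b - 1 = -2 + (-(b - 1)) + (-(-(n : ℝ) / 2)) by ring,
          rpow_add ht, rpow_add ht]
        ring
    _ = _ := by
        rw [lintegral_const_mul' _ _ ENNReal.ofReal_ne_top,
          lintegral_rpow_mul_exp (by linarith) (by positivity), ← ENNReal.ofReal_mul (by positivity)]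
        congr 1
        unfold heatMix
        rw [div_rpow (by positivity) (by norm_num), mul_rpow (by norm_num) (by positivity),
          ← rpow_natCast, ← rpow_mul hx'.le, div_eq_mul_inv (‖x‖ ^ _), ← rpow_neg (by norm_num),
          show ((2 : ℕ) : ℝ) * -((n : ℝ) / 2 - b) = 2 * b - n by push_cast; ring]
        have : (4 : ℝ) ^ (-b) = 4 ^ (-(n : ℝ) / 2) * 4 ^ (- -((n : ℝ) / 2 - b)) := by
          rw [← rpow_add (by norm_num)]; congr 1; ring
        rw [this]
        ring

/-- The constant `c` in the composition formula `|x|^(2b-n) * |x|^(2a-n) = c |x|^(2(a+b)-n)` for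
Riesz kernels. -/
noncomputable def rieszComp (n : ℕ) (a b : ℝ) : ℝ :=
  heatMix n (a + b) / (heatMix n a * heatMix n b) * (Gamma a * Gamma b / Gamma (a + b))

theorem rieszComp_pos {n : ℕ} {a b : ℝ} (ha : 0 < a) (hb : 0 < b) (hab : a + b < (n : ℝ) / 2) :
    0 < rieszComp n a b := by
  have h1 := heatMix_pos hab
  have h2 : 0 < heatMix n a := heatMix_pos (by linarith)
  have h3 : 0 < heatMix n b := heatMix_pos (by linarith)
  unfold rieszComp
  positivity

theorem rieszComp_nonneg {n : ℕ} {a b : ℝ} (ha : 0 < a) (hb : 0 < b) (hab : a + b < (n : ℝ) / 2) :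
    0 ≤ rieszComp n a b :=
  (rieszComp_pos ha hb hab).le

/-- Convolving a power superposition of heat kernels with another one. -/
theorem lintegral_heat_superposition {n : ℕ} {a b c : ℝ} (ha : 0 < a) (hb : 0 < b) (hc : 0 ≤ c)
    (x : Euc n) :
    ∫⁻ y, (∫⁻ t in Set.Ioi (0 : ℝ), ENNReal.ofReal (t ^ (b - 1)) *
        ENNReal.ofReal (heat n t (x - y))) * (∫⁻ s in Set.Ioi (0 : ℝ), ENNReal.ofReal (s ^ (a - 1)) *
        ENNReal.ofReal (heat n (s + c) y))
      = ENNReal.ofReal (Gamma a * Gamma b / Gamma (a + b)) * ∫⁻ r in Set.Ioi (0 : ℝ),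
        ENNReal.ofReal (r ^ (a + b - 1)) * ENNReal.ofReal (heat n (r + c) x) := by
  calc _ = ∫⁻ y, ∫⁻ t in Set.Ioi (0 : ℝ), ∫⁻ s in Set.Ioi (0 : ℝ),
        ENNReal.ofReal (t ^ (b - 1)) * (ENNReal.ofReal (s ^ (a - 1)) *
          (ENNReal.ofReal (heat n t (x - y)) * ENNReal.ofReal (heat n (s + c) y))) := by
        refine lintegral_congr fun y => ?_
        rw [← lintegral_mul_const _ (by fun_prop)]
        refine lintegral_congr fun t => ?_
        rw [← lintegral_const_mul _ (by fun_prop)]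
        refine lintegral_congr fun s => ?_
        ring
    _ = ∫⁻ t in Set.Ioi (0 : ℝ), ∫⁻ s in Set.Ioi (0 : ℝ), ∫⁻ y,
        ENNReal.ofReal (t ^ (b - 1)) * (ENNReal.ofReal (s ^ (a - 1)) *
          (ENNReal.ofReal (heat n t (x - y)) * ENNReal.ofReal (heat n (s + c) y))) := by
        rw [lintegral_lintegral_swap]
        · refine lintegral_congr fun t => ?_
          rw [lintegral_lintegral_swap]
          refine Measurable.aemeasurable ?_
          simp only [Function.uncurry_def]
          fun_prop
        · refine Measurable.aemeasurable ?_
          simp only [Function.uncurry_def]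
          refine Measurable.lintegral_prod_right' (f := fun p : (Euc n × ℝ) × ℝ =>
            ENNReal.ofReal (p.1.2 ^ (b - 1)) * (ENNReal.ofReal (p.2 ^ (a - 1)) *
          (ENNReal.ofReal (heat n p.1.2 (x - p.1.1)) * ENNReal.ofReal (heat n (p.2 + c) p.1.1)))) ?_
          fun_prop
    _ = ∫⁻ t in Set.Ioi (0 : ℝ), ∫⁻ s in Set.Ioi (0 : ℝ),
        ENNReal.ofReal (t ^ (b - 1)) * (ENNReal.ofReal (s ^ (a - 1)) *
          ENNReal.ofReal (heat n (t + s + c) x)) := by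
        refine setLIntegral_congr_fun measurableSet_Ioi fun t (ht : 0 < t) => ?_
        refine setLIntegral_congr_fun measurableSet_Ioi fun s (hs : 0 < s) => ?_
        rw [lintegral_const_mul' _ _ ENNReal.ofReal_ne_top,
          lintegral_const_mul' _ _ ENNReal.ofReal_ne_top,
          lintegral_heat_mul_heat ht (by linarith), add_assoc]
    _ = _ := lintegral_lintegral_add ha hb (F := fun r => ENNReal.ofReal (heat n (r + c) x))
        (by fun_prop)

/-- A punctured space has full measure in positive dimension. -/
theorem ae_ne {n : ℕ} (hn : 0 < n) (a : Euc n) : ∀ᵐ x : Euc n, x ≠ a := by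
  have : Nonempty (Fin n) := ⟨⟨0, hn⟩⟩
  exact Measure.ae_ne volume a

/-- The composition formula for Riesz kernels. -/
theorem lintegral_riesz_mul_riesz {n : ℕ} {a b : ℝ} (ha : 0 < a) (hb : 0 < b)
    (hab : a + b < (n : ℝ) / 2) {x : Euc n} (hx : x ≠ 0) :
    ∫⁻ y, ENNReal.ofReal (‖x - y‖ ^ (2 * b - n)) * ENNReal.ofReal (‖y‖ ^ (2 * a - n))
      = ENNReal.ofReal (rieszComp n a b * ‖x‖ ^ (2 * (a + b) - n)) := by
  have hn : 0 < n := by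
    rcases Nat.eq_zero_or_pos n with rfl | h
    · norm_num at hab; linarith
    · exact h
  have ha' := heatMix_pos (show a < (n : ℝ) / 2 by linarith)
  have hb' := heatMix_pos (show b < (n : ℝ) / 2 by linarith)
  have h := lintegral_heat_superposition (n := n) ha hb le_rfl x
  simp only [add_zero] at h
  rw [lintegral_rpow_mul_heat hab hx] at h
  have h2 : ∫⁻ y, (∫⁻ t in Set.Ioi (0 : ℝ), ENNReal.ofReal (t ^ (b - 1)) *
        ENNReal.ofReal (heat n t (x - y))) * (∫⁻ s in Set.Ioi (0 : ℝ), ENNReal.ofReal (s ^ (a - 1)) *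
        ENNReal.ofReal (heat n s y)) = ENNReal.ofReal (heatMix n a * heatMix n b) *
        ∫⁻ y, ENNReal.ofReal (‖x - y‖ ^ (2 * b - n)) * ENNReal.ofReal (‖y‖ ^ (2 * a - n)) := by
    rw [← lintegral_const_mul' _ _ ENNReal.ofReal_ne_top]
    refine lintegral_congr_ae ?_
    filter_upwards [ae_ne hn 0, ae_ne hn x] with y hy hyx
    rw [lintegral_rpow_mul_heat (by linarith) hy,
      lintegral_rpow_mul_heat (by linarith) (sub_ne_zero.2 hyx.symm),
      ENNReal.ofReal_mul hb'.le, ENNReal.ofReal_mul ha'.le, ENNReal.ofReal_mul ha'.le]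
    ring
  rw [h2, ← ENNReal.ofReal_mul (by
    positivity)] at h
  have hne : ENNReal.ofReal (heatMix n a * heatMix n b) ≠ 0 := by
    simpa using mul_pos ha' hb'
  rw [← ENNReal.mul_right_inj hne ENNReal.ofReal_ne_top, h, ← ENNReal.ofReal_mul (by positivity)]
  congr 1
  unfold rieszComp
  field_simp

/-! ### The Schur test and the Stein–Weiss inequality -/

/-- The Cauchy–Schwarz inequality for Lebesgue integrals, in the form that bounds an integral
by a pointwise geometric mean. -/
theorem lintegral_sq_le_mul {X : Type*} [MeasurableSpace X] {μ : Measure X} {h a b : X → ℝ≥0∞}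
    (ha : Measurable a) (hb : Measurable b) (hab : ∀ᵐ x ∂μ, h x ^ 2 ≤ a x * b x) :
    (∫⁻ x, h x ∂μ) ^ 2 ≤ (∫⁻ x, a x ∂μ) * ∫⁻ x, b x ∂μ := by
  have hsq : ∀ z : ℝ≥0∞, (z ^ (1 / 2 : ℝ)) ^ 2 = z := fun z => by
    rw [← ENNReal.rpow_natCast, ← ENNReal.rpow_mul]; norm_num
  have hsq' : ∀ z : ℝ≥0∞, (z ^ (1 / 2 : ℝ)) ^ (2 : ℝ) = z := fun z => by
    rw [← ENNReal.rpow_mul]; norm_num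
  have h1 : ∫⁻ x, h x ∂μ ≤ ∫⁻ x, ((fun x => a x ^ (1 / 2 : ℝ)) * fun x => b x ^ (1 / 2 : ℝ)) x ∂μ := by
    refine lintegral_mono_ae ?_
    filter_upwards [hab] with x hx
    rw [Pi.mul_apply, ← ENNReal.mul_rpow_of_nonneg _ _ (by norm_num)]
    rw [← ENNReal.rpow_natCast] at hx
    refine (ENNReal.le_rpow_inv_iff (z := 2) (by norm_num)).2 (by simpa using hx) |>.trans ?_
    rw [one_div]
  have h2 := ENNReal.lintegral_mul_le_Lp_mul_Lq μ Real.HolderConjugate.two_two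
    (f := fun x => a x ^ (1 / 2 : ℝ)) (g := fun x => b x ^ (1 / 2 : ℝ)) (by fun_prop) (by fun_prop)
  simp only [hsq'] at h2
  calc _ ≤ ((∫⁻ x, a x ∂μ) ^ (1 / 2 : ℝ) * (∫⁻ x, b x ∂μ) ^ (1 / 2 : ℝ)) ^ 2 := by
        gcongr
        exact h1.trans h2
    _ = _ := by rw [mul_pow, hsq, hsq]

/-- The Schur test for a nonnegative kernel, with a weight `p`. -/
theorem lintegral_schur {X : Type*} [MeasurableSpace X] {μ : Measure X} [SFinite μ]
    {K : X → X → ℝ≥0∞} (hK : Measurable (Function.uncurry K)) {p g : X → ℝ≥0∞} (hp : Measurable p)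
    (hg : Measurable g) (hp0 : ∀ᵐ x ∂μ, p x ≠ 0) (hpt : ∀ᵐ x ∂μ, p x ≠ ∞) {A : ℝ≥0∞}
    (h1 : ∀ᵐ x ∂μ, ∫⁻ y, K x y * p y ∂μ ≤ A * p x)
    (h2 : ∀ᵐ y ∂μ, ∫⁻ x, K x y * p x ∂μ ≤ A * p y) :
    ∫⁻ x, (∫⁻ y, K x y * g y ∂μ) ^ 2 ∂μ ≤ A ^ 2 * ∫⁻ y, g y ^ 2 ∂μ := by
  have hKx : ∀ x, Measurable (K x) := fun x => hK.comp measurable_prodMk_left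
  have hKy : ∀ y, Measurable (fun x => K x y) := fun y => hK.comp measurable_prodMk_right
  calc _ ≤ ∫⁻ x, A * p x * ∫⁻ y, K x y * (g y ^ 2 * (p y)⁻¹) ∂μ ∂μ := by
        refine lintegral_mono_ae ?_
        filter_upwards [h1] with x hx
        refine (lintegral_sq_le_mul (a := fun y => K x y * p y)
          (b := fun y => K x y * (g y ^ 2 * (p y)⁻¹)) ((hKx x).mul hp)
          ((hKx x).mul (by fun_prop)) ?_).trans (by gcongr)
        filter_upwards [hp0, hpt] with y hy0 hyt
        refine le_of_eq ?_
        calc _ = (K x y * g y) ^ 2 * (p y * (p y)⁻¹) := by rw [ENNReal.mul_inv_cancel hy0 hyt, mul_one]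
          _ = _ := by ring
    _ = ∫⁻ x, ∫⁻ y, A * p x * (K x y * (g y ^ 2 * (p y)⁻¹)) ∂μ ∂μ := by
        refine lintegral_congr fun x => ?_
        rw [lintegral_const_mul]
        exact (hKx x).mul (by fun_prop)
    _ = ∫⁻ y, ∫⁻ x, A * p x * (K x y * (g y ^ 2 * (p y)⁻¹)) ∂μ ∂μ := by
        refine lintegral_lintegral_swap (Measurable.aemeasurable ?_)
        simp only [Function.uncurry_def] at hK ⊢
        fun_prop
    _ = ∫⁻ y, A * (g y ^ 2 * (p y)⁻¹) * ∫⁻ x, K x y * p x ∂μ ∂μ := by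
        refine lintegral_congr fun y => ?_
        rw [← lintegral_const_mul _ (f := fun x => K x y * p x) ((hKy y).mul hp)]
        refine lintegral_congr fun x => ?_
        ring
    _ ≤ ∫⁻ y, A ^ 2 * g y ^ 2 ∂μ := by
        refine lintegral_mono_ae ?_
        filter_upwards [h2, hp0, hpt] with y hy hy0 hyt
        calc _ ≤ A * (g y ^ 2 * (p y)⁻¹) * (A * p y) := by gcongr
          _ = A ^ 2 * g y ^ 2 * (p y * (p y)⁻¹) := by ring
          _ = _ := by rw [ENNReal.mul_inv_cancel hy0 hyt, mul_one]
    _ = _ := by rw [lintegral_const_mul _ (by fun_prop)]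

/-- The symmetry of the composition constant that makes the weight `|x|^(-n/2)` pass the Schur
test in both variables with the same constant. -/
theorem rieszComp_reflect {n : ℕ} {a b : ℝ} :
    rieszComp n ((n : ℝ) / 2 - a - b) b = rieszComp n a b := by
  have key : ∀ a : ℝ, rieszComp n a b = (π ^ (-(n : ℝ) / 2) * 4 ^ (-(a + b)) /
      (π ^ (-(n : ℝ) / 2) * 4 ^ (-a) * heatMix n b) * Gamma b) *
      ((Gamma a * Gamma ((n : ℝ) / 2 - (a + b))) / (Gamma ((n : ℝ) / 2 - a) * Gamma (a + b))) := by
    intro a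
    unfold rieszComp
    conv_lhs => rw [heatMix, heatMix]
    field_simp
  have h4 : ∀ a : ℝ, π ^ (-(n : ℝ) / 2) * 4 ^ (-(a + b)) /
      (π ^ (-(n : ℝ) / 2) * 4 ^ (-a) * heatMix n b) * Gamma b = 4 ^ (-b) / heatMix n b * Gamma b := by
    intro a
    rw [neg_add, rpow_add (by norm_num)]
    field_simp
  rw [key, key a, h4, h4]
  congr 1
  rw [show (n : ℝ) / 2 - ((n : ℝ) / 2 - a - b + b) = a by ring,
    show (n : ℝ) / 2 - ((n : ℝ) / 2 - a - b) = a + b by ring,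
    show (n : ℝ) / 2 - a - b + b = (n : ℝ) / 2 - a by ring,
    show (n : ℝ) / 2 - a - b = (n : ℝ) / 2 - (a + b) by ring]
  ring

/-- A weighted Stein–Weiss inequality with its sharp constant, by the Schur test with the
weight `|x|^(-n/2)`. -/
theorem lintegral_steinWeiss {n : ℕ} {e b : ℝ} (he : 0 ≤ e) (hb : 0 < b)
    (heb : e + 2 * b < (n : ℝ) / 2) {g : Euc n → ℝ≥0∞} (hg : Measurable g) :
    ∫⁻ x, (ENNReal.ofReal (‖x‖ ^ (-(e + 2 * b))) *
        ∫⁻ y, ENNReal.ofReal (‖x - y‖ ^ (2 * b - n)) * g y) ^ 2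
      ≤ ENNReal.ofReal (rieszComp n ((e + (n : ℝ) / 2) / 2) b) ^ 2 *
        ∫⁻ y, (ENNReal.ofReal (‖y‖ ^ (-e)) * g y) ^ 2 := by
  have hn : 0 < n := by
    rcases Nat.eq_zero_or_pos n with rfl | h
    · norm_num at heb; linarith
    · exact h
  set p : Euc n → ℝ≥0∞ := fun x => ENNReal.ofReal (‖x‖ ^ (-((n : ℝ) / 2))) with hp
  set K : Euc n → Euc n → ℝ≥0∞ := fun x y => ENNReal.ofReal (‖x‖ ^ (-(e + 2 * b))) *
    (ENNReal.ofReal (‖x - y‖ ^ (2 * b - n)) * ENNReal.ofReal (‖y‖ ^ e)) with hK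
  set A := ENNReal.ofReal (rieszComp n ((e + (n : ℝ) / 2) / 2) b) with hA
  have key := lintegral_schur (μ := (volume : Measure (Euc n))) (K := K) (p := p) (A := A)
    (g := fun y => ENNReal.ofReal (‖y‖ ^ (-e)) * g y)
    (by simp only [hK, Function.uncurry_def]; fun_prop) (by fun_prop) (by fun_prop) ?_ ?_ ?_ ?_
  · refine le_trans (le_of_eq ?_) key
    refine lintegral_congr fun x => ?_
    congr 1
    rw [← lintegral_const_mul' _ _ ENNReal.ofReal_ne_top]
    refine lintegral_congr_ae ?_
    filter_upwards [ae_ne hn 0] with y hy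
    have hy' := norm_pos_iff.2 hy
    have : ENNReal.ofReal (‖y‖ ^ e) * ENNReal.ofReal (‖y‖ ^ (-e)) = 1 := by
      rw [← ENNReal.ofReal_mul (by positivity), ← rpow_add hy']; simp
    calc _ = ENNReal.ofReal (‖x‖ ^ (-(e + 2 * b))) * (ENNReal.ofReal (‖x - y‖ ^ (2 * b - n)) * g y)
        * (ENNReal.ofReal (‖y‖ ^ e) * ENNReal.ofReal (‖y‖ ^ (-e))) := by rw [this, mul_one]
      _ = _ := by simp only [hK]; ring
  · filter_upwards [ae_ne hn 0] with x hx
    have hx' := norm_pos_iff.2 hx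
    simp only [hp, ne_eq, ENNReal.ofReal_eq_zero, not_le]
    positivity
  · exact Filter.Eventually.of_forall fun x => ENNReal.ofReal_ne_top
  · filter_upwards [ae_ne hn 0] with x hx
    have hx' := norm_pos_iff.2 hx
    have h := lintegral_riesz_mul_riesz (n := n) (a := (e + (n : ℝ) / 2) / 2) (b := b) (by positivity) hb
      (by linarith) hx
    calc _ = ENNReal.ofReal (‖x‖ ^ (-(e + 2 * b))) * ∫⁻ y, ENNReal.ofReal (‖x - y‖ ^ (2 * b - n)) *
          ENNReal.ofReal (‖y‖ ^ (2 * ((e + (n : ℝ) / 2) / 2) - n)) := by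
          rw [← lintegral_const_mul' _ _ ENNReal.ofReal_ne_top]
          refine lintegral_congr_ae ?_
          filter_upwards [ae_ne hn 0] with y hy
          have hy' := norm_pos_iff.2 hy
          rw [show 2 * ((e + (n : ℝ) / 2) / 2) - n = e + -((n : ℝ) / 2) by ring, rpow_add hy',
            ENNReal.ofReal_mul (by positivity)]
          simp only [hK, hp]
          ring
      _ ≤ _ := by
          rw [h, mul_comm, hA, hp, ← ENNReal.ofReal_mul' (by positivity),
            ← ENNReal.ofReal_mul' (by positivity), mul_assoc, ← rpow_add hx']
          apply le_of_eq
          congr 3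
          ring
  · filter_upwards [ae_ne hn 0] with y hy
    have hy' := norm_pos_iff.2 hy
    have h := lintegral_riesz_mul_riesz (n := n) (a := (n : ℝ) / 2 - (e + (n : ℝ) / 2) / 2 - b) (b := b)
      (by linarith) hb (by linarith) hy
    rw [rieszComp_reflect] at h
    calc _ = ENNReal.ofReal (‖y‖ ^ e) * ∫⁻ x, ENNReal.ofReal (‖y - x‖ ^ (2 * b - n)) *
          ENNReal.ofReal (‖x‖ ^ (2 * ((n : ℝ) / 2 - (e + (n : ℝ) / 2) / 2 - b) - n)) := by
          rw [← lintegral_const_mul' _ _ ENNReal.ofReal_ne_top]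
          refine lintegral_congr_ae ?_
          filter_upwards [ae_ne hn 0] with x hx
          have hx' := norm_pos_iff.2 hx
          rw [show 2 * ((n : ℝ) / 2 - (e + (n : ℝ) / 2) / 2 - b) - n
              = -(e + 2 * b) + -((n : ℝ) / 2) by ring, rpow_add hx',
            ENNReal.ofReal_mul (by positivity), norm_sub_rev y x]
          simp only [hK, hp]
          ring
      _ ≤ _ := by
          rw [h, mul_comm, hA, hp, ← ENNReal.ofReal_mul' (by positivity),
            ← ENNReal.ofReal_mul' (by positivity), mul_assoc, ← rpow_add hy']
          apply le_of_eq
          congr 3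
          ring

/-! ### Constants -/

theorem rieszComp_eq {n : ℕ} {a b : ℝ} :
    rieszComp n a b = π ^ ((n : ℝ) / 2) * (Gamma a * Gamma b * Gamma ((n : ℝ) / 2 - (a + b)) /
      (Gamma (a + b) * Gamma ((n : ℝ) / 2 - a) * Gamma ((n : ℝ) / 2 - b))) := by
  have h1 : π ^ (-(n : ℝ) / 2) = (π ^ ((n : ℝ) / 2))⁻¹ := by rw [neg_div, rpow_neg pi_pos.le]
  have h2 : (4 : ℝ) ^ (-(a + b)) = 4 ^ (-a) * 4 ^ (-b) := by
    rw [neg_add, rpow_add (by norm_num)]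
  unfold rieszComp heatMix
  rw [h1, h2]
  field_simp

/-- The constant of the theorem is the square of the Schur constant, taken with the weight
exponent `e = 0` of `lintegral_steinWeiss`. -/
theorem pittC_div_rieszD {n : ℕ} {α : ℝ} (hα : 0 < α) (hαn : α < n) :
    pittC n α / rieszD n α = rieszComp n ((0 + (n : ℝ) / 2) / 2) (α / 4) ^ 2 := by
  rw [rieszComp_eq, show (0 + (n : ℝ) / 2) / 2 = (n : ℝ) / 4 by ring,
    show (n : ℝ) / 2 - ((n : ℝ) / 4 + α / 4) = (n - α) / 4 by ring,
    show (n : ℝ) / 4 + α / 4 = (n + α) / 4 by ring, show (n : ℝ) / 2 - n / 4 = n / 4 by ring,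
    show (n : ℝ) / 2 - α / 4 = (2 * n - α) / 4 by ring]
  have h0 : 0 < Gamma ((n : ℝ) / 4) := Gamma_pos_of_pos (by linarith)
  have h4 : π ^ α / π ^ (-((n : ℝ) - α)) = (π ^ ((n : ℝ) / 2)) ^ 2 := by
    rw [← rpow_sub pi_pos, ← rpow_natCast, ← rpow_mul pi_pos.le]; congr 1; push_cast; ring
  rw [mul_pow, ← h4, pittC, rieszD]
  field_simp

theorem pittC_pos {n : ℕ} {α : ℝ} (hα : 0 < α) (hαn : α < n) : 0 < pittC n α := by
  unfold pittC; positivity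

theorem rieszD_pos {n : ℕ} {α : ℝ} (hα : 0 < α) (hαn : α < n) : 0 < rieszD n α := by
  have h1 : 0 < Gamma ((2 * (n : ℝ) - α) / 4) := Gamma_pos_of_pos (by linarith)
  unfold rieszD; positivity

theorem besovD_pos {n : ℕ} {β : ℝ} (hβ : 0 < β) (hβ2 : β < 2) : 0 < besovD n β := by
  have h2 : 0 < Gamma (1 - β / 2) := Gamma_pos_of_pos (by linarith)
  unfold besovD; positivity

/-- The Schur constants of the orders `α` and `β` are related through the composition of Riesz
kernels. -/
theorem rieszComp_sq_mul {n : ℕ} {α β : ℝ} (hβ : 0 < β) (hβα : β < α) (hαn : α < n) :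
    rieszComp n ((β / 2 + (n : ℝ) / 2) / 2) ((α - β) / 4) ^ 2 * (pittC n β / rieszD n β)
      = rieszComp n (β / 4) ((α - β) / 4) ^ 2 * (pittC n α / rieszD n α) := by
  rw [pittC_div_rieszD (hβ.trans hβα) hαn, pittC_div_rieszD hβ (hβα.trans hαn), ← mul_pow,
    ← mul_pow]
  congr 1
  simp only [rieszComp_eq]
  rw [show (0 + (n : ℝ) / 2) / 2 = (n : ℝ) / 4 by ring,
    show (n : ℝ) / 2 - ((n : ℝ) / 4 + α / 4) = (n - α) / 4 by ring,
    show (n : ℝ) / 2 - ((n : ℝ) / 4 + β / 4) = (n - β) / 4 by ring,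
    show (n : ℝ) / 4 + α / 4 = (n + α) / 4 by ring, show (n : ℝ) / 2 - n / 4 = n / 4 by ring,
    show (n : ℝ) / 4 + β / 4 = (n + β) / 4 by ring,
    show (n : ℝ) / 2 - α / 4 = (2 * n - α) / 4 by ring,
    show (n : ℝ) / 2 - β / 4 = (2 * n - β) / 4 by ring,
    show (β / 2 + (n : ℝ) / 2) / 2 = (n + β) / 4 by ring,
    show (n + β) / 4 + (α - β) / 4 = (n + α) / 4 by ring,
    show β / 4 + (α - β) / 4 = α / 4 by ring,
    show (n : ℝ) / 2 - (n + α) / 4 = (n - α) / 4 by ring,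
    show (n : ℝ) / 2 - (n + β) / 4 = (n - β) / 4 by ring,
    show (n : ℝ) / 2 - α / 4 = (2 * n - α) / 4 by ring]
  have h2 : 0 < Gamma ((2 * (n : ℝ) - α) / 4) := Gamma_pos_of_pos (by linarith)
  have h3 : 0 < Gamma (α / 4) := Gamma_pos_of_pos (by linarith)
  have h7 : 0 < Gamma (((n : ℝ) - β) / 4) := Gamma_pos_of_pos (by linarith)
  generalize Gamma ((2 * (n : ℝ) - α) / 4) = x at *
  generalize Gamma ((2 * (n : ℝ) - β) / 4) = y at *
  generalize Gamma ((n : ℝ) / 2 - (α - β) / 4) = z at *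
  field_simp

/-! ### The heat semigroup acting on a power of `|x|` -/

/-- The factor `(Γ(1-γ)/γ) Γ(c+γ)/Γ(c)`, the value of `∫₀^∞ t^(-γ-1) (1 - (1+t)^(-c)) dt`. -/
noncomputable def fracConst (γ c : ℝ) : ℝ := Gamma (1 - γ) / γ * (Gamma (c + γ) / Gamma c)

theorem fracConst_nonneg {γ c : ℝ} (hγ0 : 0 < γ) (hγ1 : γ < 1) (hc : 0 < c) :
    0 ≤ fracConst γ c := by
  unfold fracConst; positivity

/-- The loss of `heat n s` in time `t` that is due to the decay of its normalizing factor. -/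
noncomputable def heatLoss (n : ℕ) (t s : ℝ) (x : Euc n) : ℝ :=
  (1 - (1 + t / s) ^ (-((n : ℝ) / 2))) * heat n s x

/-- The gain of `heat n s` in time `t` that is due to the growth of its exponential factor. -/
noncomputable def heatGain (n : ℕ) (t s : ℝ) (x : Euc n) : ℝ :=
  heat n (s + t) x - (1 + t / s) ^ (-((n : ℝ) / 2)) * heat n s x

theorem heatLoss_nonneg {n : ℕ} {t s : ℝ} (ht : 0 < t) (hs : 0 < s) (x : Euc n) :
    0 ≤ heatLoss n t s x := by
  refine mul_nonneg (sub_nonneg.2 ?_) (heat_nonneg hs x)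
  refine rpow_le_one_of_one_le_of_nonpos ?_ (by simp; positivity)
  have : 0 < t / s := by positivity
  linarith

theorem heatGain_nonneg {n : ℕ} {t s : ℝ} (ht : 0 < t) (hs : 0 < s) (x : Euc n) :
    0 ≤ heatGain n t s x := by
  have h1 : (4 * π * (s + t)) ^ (-(n : ℝ) / 2)
      = (1 + t / s) ^ (-((n : ℝ) / 2)) * (4 * π * s) ^ (-(n : ℝ) / 2) := by
    rw [neg_div, ← mul_rpow (by positivity) (by positivity)]
    congr 1
    field_simp
  unfold heatGain heat
  rw [h1, sub_nonneg, ← mul_assoc]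
  gcongr
  linarith

theorem heat_add_heatGain {n : ℕ} (t s : ℝ) (x : Euc n) :
    heat n s x + heatGain n t s x = heat n (s + t) x + heatLoss n t s x := by
  unfold heatGain heatLoss; ring

@[fun_prop]
theorem measurable_heatLoss {n : ℕ} {X : Type*} [MeasurableSpace X] {T S : X → ℝ} {Y : X → Euc n}
    (hT : Measurable T) (hS : Measurable S) (hY : Measurable Y) :
    Measurable (fun p => heatLoss n (T p) (S p) (Y p)) := by
  unfold heatLoss; fun_prop

@[fun_prop]
theorem measurable_heatGain {n : ℕ} {X : Type*} [MeasurableSpace X] {T S : X → ℝ} {Y : X → Euc n}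
    (hT : Measurable T) (hS : Measurable S) (hY : Measurable Y) :
    Measurable (fun p => heatGain n (T p) (S p) (Y p)) := by
  unfold heatGain; fun_prop

/-- The balance of gain and loss, integrated over a superposition of heat kernels. -/
theorem lintegral_heat_add_gain {n : ℕ} {a t : ℝ} (ht : 0 < t) (x : Euc n) :
    (∫⁻ s in Set.Ioi (0 : ℝ), ENNReal.ofReal (s ^ (a - 1)) * ENNReal.ofReal (heat n s x))
      + ∫⁻ s in Set.Ioi (0 : ℝ), ENNReal.ofReal (s ^ (a - 1)) * ENNReal.ofReal (heatGain n t s x)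
    = (∫⁻ s in Set.Ioi (0 : ℝ), ENNReal.ofReal (s ^ (a - 1)) * ENNReal.ofReal (heat n (s + t) x))
      + ∫⁻ s in Set.Ioi (0 : ℝ), ENNReal.ofReal (s ^ (a - 1)) *
          ENNReal.ofReal (heatLoss n t s x) := by
  rw [← lintegral_add_left (by fun_prop), ← lintegral_add_left (by fun_prop)]
  refine setLIntegral_congr_fun measurableSet_Ioi fun s (hs : 0 < s) => ?_
  rw [← mul_add, ← mul_add, ← ENNReal.ofReal_add (heat_nonneg hs x) (heatGain_nonneg ht hs x),
    ← ENNReal.ofReal_add (heat_nonneg (by linarith) x) (heatLoss_nonneg ht hs x),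
    heat_add_heatGain]

/-- The heat semigroup acts on superpositions of heat kernels by translation in time. -/
theorem lintegral_heat_mul_superposition {n : ℕ} {a t : ℝ} (ht : 0 < t) (x : Euc n) :
    ∫⁻ y, ENNReal.ofReal (heat n t (x - y)) *
        ∫⁻ s in Set.Ioi (0 : ℝ), ENNReal.ofReal (s ^ (a - 1)) * ENNReal.ofReal (heat n s y)
      = ∫⁻ s in Set.Ioi (0 : ℝ), ENNReal.ofReal (s ^ (a - 1)) *
          ENNReal.ofReal (heat n (s + t) x) := by
  calc _ = ∫⁻ y, ∫⁻ s in Set.Ioi (0 : ℝ), ENNReal.ofReal (s ^ (a - 1)) *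
          (ENNReal.ofReal (heat n t (x - y)) * ENNReal.ofReal (heat n s y)) := by
        refine lintegral_congr fun y => ?_
        rw [← lintegral_const_mul _ (by fun_prop)]
        refine lintegral_congr fun s => ?_
        ring
    _ = ∫⁻ s in Set.Ioi (0 : ℝ), ∫⁻ y, ENNReal.ofReal (s ^ (a - 1)) *
          (ENNReal.ofReal (heat n t (x - y)) * ENNReal.ofReal (heat n s y)) := by
        refine lintegral_lintegral_swap (Measurable.aemeasurable ?_)
        simp only [Function.uncurry_def]
        fun_prop
    _ = _ := by
        refine setLIntegral_congr_fun measurableSet_Ioi fun s (hs : 0 < s) => ?_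
        rw [lintegral_const_mul' _ _ ENNReal.ofReal_ne_top, lintegral_heat_mul_heat ht hs, add_comm t]

/-- Tonelli's theorem in the variables `s` and `τ = t / s`. -/
theorem lintegral_lintegral_scale {γ c : ℝ} {G : ℝ → ℝ → ℝ≥0∞}
    (hG : Measurable (Function.uncurry G)) :
    ∫⁻ t in Set.Ioi (0 : ℝ), ENNReal.ofReal (t ^ (-γ - 1)) *
        ∫⁻ s in Set.Ioi (0 : ℝ), ENNReal.ofReal (s ^ (c - 1)) * G t s
      = ∫⁻ r in Set.Ioi (0 : ℝ), ENNReal.ofReal (r ^ (-γ - 1)) *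
        ∫⁻ s in Set.Ioi (0 : ℝ), ENNReal.ofReal (s ^ (c - γ - 1)) * G (s * r) s := by
  simp only [Function.uncurry_def] at hG
  have hG2 : Measurable (fun p : ℝ × ℝ => G (p.1 * p.2) p.1) :=
    hG.comp (Measurable.prodMk (by fun_prop) (by fun_prop) : Measurable fun p : ℝ × ℝ => (p.1 * p.2, p.1))
  calc _ = ∫⁻ t in Set.Ioi (0 : ℝ), ∫⁻ s in Set.Ioi (0 : ℝ), ENNReal.ofReal (t ^ (-γ - 1)) *
        (ENNReal.ofReal (s ^ (c - 1)) * G t s) := by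
        refine lintegral_congr fun t => ?_
        rw [lintegral_const_mul' _ _ ENNReal.ofReal_ne_top]
    _ = ∫⁻ s in Set.Ioi (0 : ℝ), ∫⁻ t in Set.Ioi (0 : ℝ), ENNReal.ofReal (t ^ (-γ - 1)) *
        (ENNReal.ofReal (s ^ (c - 1)) * G t s) := by
        refine lintegral_lintegral_swap (Measurable.aemeasurable ?_)
        simp only [Function.uncurry_def]
        fun_prop
    _ = ∫⁻ s in Set.Ioi (0 : ℝ), ∫⁻ r in Set.Ioi (0 : ℝ), ENNReal.ofReal (r ^ (-γ - 1)) *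
        (ENNReal.ofReal (s ^ (c - γ - 1)) * G (s * r) s) := by
        refine setLIntegral_congr_fun measurableSet_Ioi fun s (hs : 0 < s) => ?_
        rw [lintegral_Ioi_comp_mul hs, ← lintegral_const_mul' _ _ ENNReal.ofReal_ne_top]
        refine setLIntegral_congr_fun measurableSet_Ioi fun r (hr : 0 < r) => ?_
        simp only [← mul_assoc]
        rw [← ENNReal.ofReal_mul hs.le, ← ENNReal.ofReal_mul (by positivity),
          ← ENNReal.ofReal_mul (by positivity)]
        congr 2
        rw [mul_rpow hs.le hr.le, show c - γ - 1 = 1 + (-γ - 1) + (c - 1) by ring, rpow_add hs,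
          rpow_add hs, rpow_one]
        ring
    _ = ∫⁻ r in Set.Ioi (0 : ℝ), ∫⁻ s in Set.Ioi (0 : ℝ), ENNReal.ofReal (r ^ (-γ - 1)) *
        (ENNReal.ofReal (s ^ (c - γ - 1)) * G (s * r) s) := by
        refine lintegral_lintegral_swap (Measurable.aemeasurable ?_)
        simp only [Function.uncurry_def]
        fun_prop
    _ = _ := by
        refine lintegral_congr fun t => ?_
        rw [lintegral_const_mul' _ _ ENNReal.ofReal_ne_top]

/-- The total loss of a superposition of heat kernels, weighted by `t ^ (-γ - 1)`. -/
theorem lintegral_heatLoss {n : ℕ} (hn : 0 < n) {a γ : ℝ} (hγ0 : 0 < γ) (hγ1 : γ < 1)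
    (x : Euc n) :
    ∫⁻ t in Set.Ioi (0 : ℝ), ENNReal.ofReal (t ^ (-γ - 1)) *
        ∫⁻ s in Set.Ioi (0 : ℝ), ENNReal.ofReal (s ^ (a - 1)) * ENNReal.ofReal (heatLoss n t s x)
      = ENNReal.ofReal (fracConst γ (n / 2)) * ∫⁻ s in Set.Ioi (0 : ℝ),
        ENNReal.ofReal (s ^ (a - γ - 1)) * ENNReal.ofReal (heat n s x) := by
  rw [lintegral_lintegral_scale (G := fun t s => ENNReal.ofReal (heatLoss n t s x))
    (by simp only [Function.uncurry_def]; fun_prop), fracConst,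
    ← lintegral_one_sub_rpow hγ0 hγ1 (half_pos (Nat.cast_pos.2 hn)), ← lintegral_mul_const _ (by fun_prop)]
  refine setLIntegral_congr_fun measurableSet_Ioi fun r (hr : 0 < r) => ?_
  rw [mul_assoc]
  congr 1
  rw [← lintegral_const_mul' _ _ ENNReal.ofReal_ne_top]
  refine setLIntegral_congr_fun measurableSet_Ioi fun s (hs : 0 < s) => ?_
  rw [mul_left_comm]
  congr 1
  rw [heatLoss, mul_div_cancel_left₀ _ hs.ne', ENNReal.ofReal_mul' (heat_nonneg hs x)]

/-- The total gain falls short of the total loss, the right side, by `fracConst γ (a - γ)` times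
the superposition of order `a - γ`. -/
theorem lintegral_heatGain {n : ℕ} (hn : 0 < n) {a γ : ℝ} (hγ0 : 0 < γ) (hγ1 : γ < 1)
    (haγ : γ < a) (han : a - γ < (n : ℝ) / 2) {x : Euc n} (hx : x ≠ 0) :
    (∫⁻ t in Set.Ioi (0 : ℝ), ENNReal.ofReal (t ^ (-γ - 1)) *
        ∫⁻ s in Set.Ioi (0 : ℝ), ENNReal.ofReal (s ^ (a - 1)) * ENNReal.ofReal (heatGain n t s x))
      + ENNReal.ofReal (fracConst γ (a - γ)) * ∫⁻ s in Set.Ioi (0 : ℝ),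
        ENNReal.ofReal (s ^ (a - γ - 1)) * ENNReal.ofReal (heat n s x)
      = ENNReal.ofReal (fracConst γ (n / 2)) * ∫⁻ s in Set.Ioi (0 : ℝ),
        ENNReal.ofReal (s ^ (a - γ - 1)) * ENNReal.ofReal (heat n s x) := by
  set P := ∫⁻ s in Set.Ioi (0 : ℝ), ENNReal.ofReal (s ^ (a - γ - 1)) * ENNReal.ofReal (heat n s x)
    with hP
  have hPt : P ≠ ∞ := by
    rw [hP, lintegral_rpow_mul_heat han hx]; exact ENNReal.ofReal_ne_top
  have inner : ∀ r : ℝ, 0 < r → ∫⁻ s in Set.Ioi (0 : ℝ), ENNReal.ofReal (s ^ (a - γ - 1)) *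
      ENNReal.ofReal (heatGain n (s * r) s x)
      = ENNReal.ofReal ((1 + r) ^ (-(a - γ)) - (1 + r) ^ (-((n : ℝ) / 2))) * P := by
    intro r hr
    have h1 : 0 < 1 + r := by linarith
    have hle : (1 + r) ^ (-((n : ℝ) / 2)) ≤ (1 + r) ^ (-(a - γ)) :=
      rpow_le_rpow_of_exponent_le (by linarith) (by linarith)
    have hfin : ENNReal.ofReal ((1 + r) ^ (-((n : ℝ) / 2))) * P ≠ ∞ := by finiteness
    rw [← ENNReal.add_left_inj hfin, ← add_mul, ← ENNReal.ofReal_add (by linarith) (by positivity),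
      sub_add_cancel]
    have h2 : P = ENNReal.ofReal (1 + r) * ∫⁻ s in Set.Ioi (0 : ℝ),
        ENNReal.ofReal (((1 + r) * s) ^ (a - γ - 1)) * ENNReal.ofReal (heat n ((1 + r) * s) x) := by
      rw [hP, lintegral_Ioi_comp_mul h1]
    have h3 : ENNReal.ofReal ((1 + r) ^ (-(a - γ))) * P = ∫⁻ s in Set.Ioi (0 : ℝ),
        ENNReal.ofReal (s ^ (a - γ - 1)) * ENNReal.ofReal (heat n (s + s * r) x) := by
      rw [h2, ← mul_assoc, ← ENNReal.ofReal_mul (by positivity),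
        ← lintegral_const_mul' _ _ ENNReal.ofReal_ne_top]
      refine setLIntegral_congr_fun measurableSet_Ioi fun s (hs : 0 < s) => ?_
      rw [← mul_assoc, ← ENNReal.ofReal_mul (by positivity), mul_rpow h1.le hs.le]
      congr 2
      · have : (1 + r) ^ (-(a - γ)) * (1 + r) * (1 + r) ^ (a - γ - 1) = 1 := by
          nth_rw 2 [← rpow_one (1 + r)]
          rw [← rpow_add h1, ← rpow_add h1]
          ring_nf
          exact rpow_zero _
        rw [← mul_assoc, this, one_mul]
      · congr 1; ring
    rw [h3, ← lintegral_const_mul' _ _ ENNReal.ofReal_ne_top, ← lintegral_add_left (by fun_prop)]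
    refine setLIntegral_congr_fun measurableSet_Ioi fun s (hs : 0 < s) => ?_
    rw [mul_left_comm, ← mul_add]
    congr 1
    rw [← ENNReal.ofReal_mul (by positivity),
      ← ENNReal.ofReal_add (heatGain_nonneg (by positivity) hs x)
        (mul_nonneg (by positivity) (heat_nonneg hs x)), heatGain, mul_div_cancel_left₀ _ hs.ne',
      sub_add_cancel]
  rw [lintegral_lintegral_scale (G := fun t s => ENNReal.ofReal (heatGain n t s x))
    (by simp only [Function.uncurry_def]; fun_prop), fracConst, fracConst,
    ← lintegral_one_sub_rpow hγ0 hγ1 (half_pos (Nat.cast_pos.2 hn)), ← lintegral_one_sub_rpow hγ0 hγ1 (by linarith),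
    ← lintegral_mul_const _ (by fun_prop), ← lintegral_mul_const _ (by fun_prop),
    ← lintegral_add_right _ (by fun_prop)]
  refine setLIntegral_congr_fun measurableSet_Ioi fun r (hr : 0 < r) => ?_
  have h1 : 0 < 1 + r := by linarith
  have hle : (1 + r) ^ (-((n : ℝ) / 2)) ≤ (1 + r) ^ (-(a - γ)) :=
    rpow_le_rpow_of_exponent_le (by linarith) (by linarith)
  have hle1 : (1 + r) ^ (-(a - γ)) ≤ 1 :=
    rpow_le_one_of_one_le_of_nonpos (by linarith) (by linarith)
  rw [inner r hr, ← mul_assoc, ← add_mul, ← mul_add, ← ENNReal.ofReal_add (by linarith)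
    (by linarith)]
  congr 3
  ring

/-! ### The heat quadratic form of a function in `L¹ ∩ L²` -/

/-- Fubini's theorem for a nonnegative kernel `G` whose `X`-marginal is `Q`, applied to a
vector-valued function on the second factor. -/
theorem integral_kernel_swap_smul {X Y E : Type*} [MeasurableSpace X] [MeasurableSpace Y]
    [NormedAddCommGroup E] [NormedSpace ℝ E] [CompleteSpace E]
    {μ : Measure X} {ν : Measure Y} [SFinite μ] [SFinite ν] {G : X → Y → ℝ}
    (hG : Measurable (Function.uncurry G)) (hG0 : ∀ᵐ y ∂ν, ∀ᵐ x ∂μ, 0 ≤ G x y)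
    {F : Y → E} (hF : StronglyMeasurable F) {Q : Y → ℝ≥0∞}
    (hQ : ∀ᵐ y ∂ν, ∫⁻ x, ENNReal.ofReal (G x y) ∂μ = Q y)
    (hfin : ∫⁻ y, Q y * ‖F y‖ₑ ∂ν ≠ ∞) :
    Integrable (fun x => ∫ y, G x y • F y ∂ν) μ ∧
      ∫ x, ∫ y, G x y • F y ∂ν ∂μ = ∫ y, (Q y).toReal • F y ∂ν := by
  simp only [Function.uncurry_def] at hG
  have hm : StronglyMeasurable (fun p : X × Y => G p.1 p.2 • F p.2) :=
    hG.stronglyMeasurable.smul (hF.comp_measurable measurable_snd)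
  have hGy : ∀ y, Measurable (fun x => G x y) := fun y => hG.comp measurable_prodMk_right
  have hint : Integrable (fun p : X × Y => G p.1 p.2 • F p.2) (μ.prod ν) := by
    refine ⟨hm.aestronglyMeasurable, ?_⟩
    rw [hasFiniteIntegral_iff_enorm, lintegral_prod_symm _ hm.enorm.aemeasurable]
    refine lt_of_le_of_lt (le_of_eq ?_) (lt_top_iff_ne_top.2 hfin)
    refine lintegral_congr_ae ?_
    filter_upwards [hQ, hG0] with y hy h0
    rw [← hy, ← lintegral_mul_const _ (hGy y).ennreal_ofReal]
    refine lintegral_congr_ae ?_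
    filter_upwards [h0] with x hx
    rw [enorm_smul, Real.enorm_eq_ofReal hx]
  refine ⟨hint.integral_prod_left, ?_⟩
  rw [integral_integral_swap hint]
  refine integral_congr_ae ?_
  filter_upwards [hQ, hG0] with y hy h0
  rw [integral_smul_const, integral_eq_lintegral_of_nonneg_ae h0 (hGy y).aestronglyMeasurable, hy]

/-- `integral_kernel_swap_smul` for a real-valued function. -/
theorem integral_kernel_swap {X Y : Type*} [MeasurableSpace X] [MeasurableSpace Y]
    {μ : Measure X} {ν : Measure Y} [SFinite μ] [SFinite ν] {G : X → Y → ℝ}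
    (hG : Measurable (Function.uncurry G)) (hG0 : ∀ᵐ y ∂ν, ∀ᵐ x ∂μ, 0 ≤ G x y)
    {F : Y → ℝ} (hF : Measurable F) {Q : Y → ℝ≥0∞}
    (hQ : ∀ᵐ y ∂ν, ∫⁻ x, ENNReal.ofReal (G x y) ∂μ = Q y)
    (hfin : ∫⁻ y, Q y * ‖F y‖ₑ ∂ν ≠ ∞) :
    Integrable (fun x => ∫ y, G x y * F y ∂ν) μ ∧
      ∫ x, ∫ y, G x y * F y ∂ν ∂μ = ∫ y, (Q y).toReal * F y ∂ν := by
  simpa only [smul_eq_mul] using integral_kernel_swap_smul hG hG0 hF.stronglyMeasurable hQ hfin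

/-- The convolution `k * m` of a nonnegative real kernel with a `[0, ∞]`-valued function, always
defined as a Lebesgue integral. -/
noncomputable def kconv {n : ℕ} (k : Euc n → ℝ) (m : Euc n → ℝ≥0∞) (x : Euc n) : ℝ≥0∞ :=
  ∫⁻ y, ENNReal.ofReal (k (x - y)) * m y

/-- The convolution `k * f` of real functions. -/
noncomputable def rconv {n : ℕ} (k f : Euc n → ℝ) (x : Euc n) : ℝ := ∫ z, k (x - z) * f z

@[fun_prop]
theorem measurable_rconv {n : ℕ} {k f : Euc n → ℝ} (hk : Measurable k) (hf : Measurable f) :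
    Measurable (rconv k f) := by
  have : StronglyMeasurable (fun p : Euc n × Euc n => k (p.1 - p.2) * f p.2) :=
    Measurable.stronglyMeasurable (by fun_prop)
  exact this.integral_prod_right'.measurable

/-- The `L²` norm of `k * f` for an even kernel `k`, through the kernel `q = k * k`. -/
theorem integral_sq_rconv {n : ℕ} {k f : Euc n → ℝ} (hk : Measurable k) (hk0 : ∀ x, 0 ≤ k x)
    (hke : ∀ x, k (-x) = k x) (hf : Measurable f) {q : Euc n → ℝ≥0∞}
    (hq : ∀ᵐ p : Euc n × Euc n, kconv k (fun y => ENNReal.ofReal (k y)) (p.1 - p.2) = q (p.1 - p.2))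
    (hfin : ∫⁻ p : Euc n × Euc n, q (p.1 - p.2) * ‖f p.1 * f p.2‖ₑ ≠ ∞) :
    Integrable (fun x => rconv k f x ^ 2) ∧
      ∫ x, rconv k f x ^ 2 = ∫ p : Euc n × Euc n, (q (p.1 - p.2)).toReal * (f p.1 * f p.2) := by
  have h := integral_kernel_swap (μ := (volume : Measure (Euc n)))
    (ν := (volume : Measure (Euc n × Euc n))) (G := fun x p => k (x - p.1) * k (x - p.2))
    (F := fun p => f p.1 * f p.2) (Q := fun p => q (p.1 - p.2))
    (by simp only [Function.uncurry_def]; fun_prop)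
    (Filter.Eventually.of_forall fun p => Filter.Eventually.of_forall fun x =>
      mul_nonneg (hk0 _) (hk0 _)) (by fun_prop) ?_ hfin
  · have hsq : ∀ x, ∫ p : Euc n × Euc n, k (x - p.1) * k (x - p.2) * (f p.1 * f p.2)
        = rconv k f x ^ 2 := by
      intro x
      rw [sq, rconv, ← integral_prod_mul, ← Measure.volume_eq_prod]
      refine integral_congr_ae (Filter.Eventually.of_forall fun p => ?_)
      dsimp only
      ring
    simp only [hsq] at h
    exact h
  · filter_upwards [hq] with p hp
    rw [← hp, kconv, ← lintegral_sub_right_eq_self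
      (fun y => ENNReal.ofReal (k (p.1 - p.2 - y)) * ENNReal.ofReal (k y)) p.2]
    refine lintegral_congr fun x => ?_
    rw [← ENNReal.ofReal_mul (hk0 _), ← hke (x - p.1)]
    congr 3
    abel

/-- The quadratic form of `m` at `k * f` for an even kernel `k`, through the kernel
`q = k * m * k`. -/
theorem integral_rconv_mul_rconv {n : ℕ} {k m f : Euc n → ℝ} (hk : Measurable k)
    (hk0 : ∀ x, 0 ≤ k x) (hke : ∀ x, k (-x) = k x) (hm : Measurable m) (hm0 : ∀ x, 0 ≤ m x)
    (hf : Measurable f) {q : Euc n → ℝ≥0∞}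
    (hq : ∀ᵐ p : Euc n × Euc n,
      kconv k (kconv m (fun y => ENNReal.ofReal (k y))) (p.1 - p.2) = q (p.1 - p.2))
    (hfin : ∫⁻ p : Euc n × Euc n, q (p.1 - p.2) * ‖f p.1 * f p.2‖ₑ ≠ ∞) :
    Integrable (fun p : Euc n × Euc n => rconv k f p.1 * rconv k f p.2 * m (p.1 - p.2)) ∧
      ∫ p : Euc n × Euc n, rconv k f p.1 * rconv k f p.2 * m (p.1 - p.2)
        = ∫ p : Euc n × Euc n, (q (p.1 - p.2)).toReal * (f p.1 * f p.2) := by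
  have h := integral_kernel_swap (μ := (volume : Measure (Euc n × Euc n)))
    (ν := (volume : Measure (Euc n × Euc n)))
    (G := fun x p => k (x.1 - p.1) * (m (x.1 - x.2) * k (x.2 - p.2)))
    (F := fun p => f p.1 * f p.2) (Q := fun p => q (p.1 - p.2))
    (by simp only [Function.uncurry_def]; fun_prop)
    (Filter.Eventually.of_forall fun p => Filter.Eventually.of_forall fun x =>
      mul_nonneg (hk0 _) (mul_nonneg (hm0 _) (hk0 _))) (by fun_prop) ?_ hfin
  · have hsq : ∀ x : Euc n × Euc n, ∫ p : Euc n × Euc n,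
        k (x.1 - p.1) * (m (x.1 - x.2) * k (x.2 - p.2)) * (f p.1 * f p.2)
        = rconv k f x.1 * rconv k f x.2 * m (x.1 - x.2) := by
      intro x
      rw [rconv, rconv, ← integral_prod_mul, ← integral_mul_const, ← Measure.volume_eq_prod]
      refine integral_congr_ae (Filter.Eventually.of_forall fun p => ?_)
      dsimp only
      ring
    simp only [hsq] at h
    exact h
  · filter_upwards [hq] with p hp
    have hmeas : Measurable (fun x : Euc n × Euc n =>
        ENNReal.ofReal (k (x.1 - p.1) * (m (x.1 - x.2) * k (x.2 - p.2)))) := by fun_prop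
    rw [← hp, kconv, ← lintegral_sub_right_eq_self (fun x => ENNReal.ofReal (k (p.1 - p.2 - x)) *
        kconv m (fun y => ENNReal.ofReal (k y)) x) p.2, Measure.volume_eq_prod,
      lintegral_prod _ hmeas.aemeasurable]
    refine lintegral_congr fun x => ?_
    rw [kconv, ← lintegral_sub_right_eq_self
        (fun y => ENNReal.ofReal (m (x - p.2 - y)) * ENNReal.ofReal (k y)) p.2,
      ← lintegral_const_mul' _ _ ENNReal.ofReal_ne_top]
    refine lintegral_congr fun y => ?_
    rw [← ENNReal.ofReal_mul (hm0 _), ← ENNReal.ofReal_mul (hk0 _), ← hke (x - p.1),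
      show -(x - p.1) = p.1 - p.2 - (x - p.2) by abel, show x - p.2 - (y - p.2) = x - y by abel]

/-- The quadratic form of the heat semigroup, `⟨f, exp(sΔ) f⟩`. -/
noncomputable def heatForm {n : ℕ} (f : Euc n → ℝ) (s : ℝ) : ℝ :=
  ∫ p : Euc n × Euc n, heat n s (p.1 - p.2) * (f p.1 * f p.2)

theorem measurable_heatForm {n : ℕ} {f : Euc n → ℝ} (hf : Measurable f) :
    Measurable (heatForm f) := by
  have : StronglyMeasurable (fun p : ℝ × (Euc n × Euc n) =>
      heat n p.1 (p.2.1 - p.2.2) * (f p.2.1 * f p.2.2)) :=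
    Measurable.stronglyMeasurable (by fun_prop)
  exact this.integral_prod_right'.measurable

theorem heat_le {n : ℕ} {s : ℝ} (hs : 0 < s) (x : Euc n) :
    heat n s x ≤ (4 * π * s) ^ (-(n : ℝ) / 2) := by
  unfold heat
  refine mul_le_of_le_one_right (by positivity) (exp_le_one_iff.2 ?_)
  have : 0 ≤ ‖x‖ ^ 2 / (4 * s) := by positivity
  linarith

/-- The absolute heat form is bounded by the `L²` norm. -/
theorem lintegral_heat_abs_le_sq {n : ℕ} {f : Euc n → ℝ} (hf : Measurable f) {s : ℝ} (hs : 0 < s) :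
    ∫⁻ p : Euc n × Euc n, ENNReal.ofReal (heat n s (p.1 - p.2)) * ‖f p.1 * f p.2‖ₑ
      ≤ ∫⁻ x, ENNReal.ofReal (f x ^ 2) := by
  have hmass : ∀ x : Euc n, ∫⁻ y, ENNReal.ofReal (heat n s (x - y)) = 1 := by
    intro x
    rw [lintegral_sub_left_eq_self (fun y => ENNReal.ofReal (heat n s y)), lintegral_heat hs]
  have hmass' : ∀ y : Euc n, ∫⁻ x, ENNReal.ofReal (heat n s (x - y)) = 1 := by
    intro y
    rw [lintegral_sub_right_eq_self (fun y => ENNReal.ofReal (heat n s y)), lintegral_heat hs]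
  have h1 : ∫⁻ p : Euc n × Euc n, ENNReal.ofReal (heat n s (p.1 - p.2)) * ENNReal.ofReal (f p.1 ^ 2)
      = ∫⁻ x, ENNReal.ofReal (f x ^ 2) := by
    rw [Measure.volume_eq_prod, lintegral_prod _ (by fun_prop)]
    refine lintegral_congr fun x => ?_
    dsimp only
    rw [lintegral_mul_const _ (by fun_prop), hmass, one_mul]
  have h2 : ∫⁻ p : Euc n × Euc n, ENNReal.ofReal (heat n s (p.1 - p.2)) * ENNReal.ofReal (f p.2 ^ 2)
      = ∫⁻ x, ENNReal.ofReal (f x ^ 2) := by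
    rw [Measure.volume_eq_prod, lintegral_prod_symm _ (by fun_prop)]
    refine lintegral_congr fun x => ?_
    dsimp only
    rw [lintegral_mul_const _ (by fun_prop), hmass', one_mul]
  have h3 : (2 : ℝ≥0∞) * ∫⁻ p : Euc n × Euc n, ENNReal.ofReal (heat n s (p.1 - p.2)) *
      ‖f p.1 * f p.2‖ₑ ≤ 2 * ∫⁻ x, ENNReal.ofReal (f x ^ 2) := by
    rw [two_mul (∫⁻ x, ENNReal.ofReal (f x ^ 2))]
    nth_rw 1 [← h1]
    rw [← h2, ← lintegral_add_left (by fun_prop), ← lintegral_const_mul' _ _ (by simp)]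
    refine lintegral_mono fun p => ?_
    dsimp only
    rw [← mul_add, mul_left_comm]
    gcongr
    rw [← ENNReal.ofReal_add (sq_nonneg _) (sq_nonneg _), Real.enorm_eq_ofReal_abs,
      ← ENNReal.ofReal_ofNat, ← ENNReal.ofReal_mul (by norm_num)]
    refine ENNReal.ofReal_le_ofReal ?_
    rw [abs_mul, ← sq_abs (f p.1), ← sq_abs (f p.2)]
    nlinarith [sq_nonneg (|f p.1| - |f p.2|)]
  exact (ENNReal.mul_le_mul_iff_right (by simp) (by simp)).1 h3

/-- The absolute heat form decays like `s^(-n/2)` for integrable functions. -/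
theorem lintegral_heat_abs_le_rpow {n : ℕ} {f : Euc n → ℝ} (hf : Measurable f) {s : ℝ}
    (hs : 0 < s) :
    ∫⁻ p : Euc n × Euc n, ENNReal.ofReal (heat n s (p.1 - p.2)) * ‖f p.1 * f p.2‖ₑ
      ≤ ENNReal.ofReal ((4 * π * s) ^ (-(n : ℝ) / 2)) * (∫⁻ x, ‖f x‖ₑ) ^ 2 := by
  calc _ ≤ ∫⁻ p : Euc n × Euc n, ENNReal.ofReal ((4 * π * s) ^ (-(n : ℝ) / 2)) *
        (‖f p.1‖ₑ * ‖f p.2‖ₑ) := by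
        refine lintegral_mono fun p => ?_
        dsimp only
        rw [enorm_mul]
        gcongr
        exact heat_le hs _
    _ = _ := by
        rw [lintegral_const_mul _ (by fun_prop), Measure.volume_eq_prod,
          lintegral_prod_mul (f := fun x => ‖f x‖ₑ) (g := fun x => ‖f x‖ₑ) (by fun_prop)
            (by fun_prop), sq]

/-- Absolute convergence of the power superposition of heat forms: the `L²` bound is used for
`s ≤ 1` and the `L¹` bound for `s > 1`. -/
theorem lintegral_rpow_mul_heat_abs_ne_top {n : ℕ} {f : Euc n → ℝ} (hf : Measurable f)
    (hf1 : ∫⁻ x, ‖f x‖ₑ ≠ ∞) (hf2 : ∫⁻ x, ENNReal.ofReal (f x ^ 2) ≠ ∞) {c t : ℝ} (hc : 0 < c)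
    (hcn : c < (n : ℝ) / 2) (ht : 0 ≤ t) :
    ∫⁻ s in Set.Ioi (0 : ℝ), ENNReal.ofReal (s ^ (c - 1)) * ∫⁻ p : Euc n × Euc n,
      ENNReal.ofReal (heat n (s + t) (p.1 - p.2)) * ‖f p.1 * f p.2‖ₑ ≠ ∞ := by
  rw [← Set.Ioc_union_Ioi_eq_Ioi zero_le_one]
  refine ne_top_of_le_ne_top ?_ (lintegral_union_le _ _ _)
  refine ENNReal.add_ne_top.2 ⟨?_, ?_⟩
  · refine ne_top_of_le_ne_top (b := ∫⁻ s in Set.Ioc (0 : ℝ) 1, ENNReal.ofReal (s ^ (c - 1)) *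
      ∫⁻ x, ENNReal.ofReal (f x ^ 2)) ?_ ?_
    · rw [lintegral_mul_const _ (by fun_prop)]
      refine ENNReal.mul_ne_top ?_ hf2
      have h := (intervalIntegrable_iff_integrableOn_Ioc_of_le zero_le_one).1
        (intervalIntegral.intervalIntegrable_rpow' (a := 0) (b := 1) (r := c - 1) (by linarith))
      exact (Integrable.lintegral_lt_top h).ne
    · refine setLIntegral_mono' measurableSet_Ioc fun s hs => ?_
      gcongr
      exact lintegral_heat_abs_le_sq hf (by linarith [hs.1])
  · refine ne_top_of_le_ne_top (b := ∫⁻ s in Set.Ioi (1 : ℝ), ENNReal.ofReal (s ^ (c - 1 - (n : ℝ) / 2)) *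
      (ENNReal.ofReal ((4 * π) ^ (-(n : ℝ) / 2)) * (∫⁻ x, ‖f x‖ₑ) ^ 2)) ?_ ?_
    · rw [lintegral_mul_const _ (by fun_prop)]
      refine ENNReal.mul_ne_top ?_ (by finiteness)
      exact (Integrable.lintegral_lt_top (integrableOn_Ioi_rpow_of_lt (by linarith) one_pos)).ne
    · refine setLIntegral_mono' measurableSet_Ioi fun s (hs : 1 < s) => ?_
      have hs0 : 0 < s := by linarith
      calc _ ≤ ENNReal.ofReal (s ^ (c - 1)) * (ENNReal.ofReal ((4 * π * (s + t)) ^ (-(n : ℝ) / 2)) *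
            (∫⁻ x, ‖f x‖ₑ) ^ 2) := by
            gcongr
            exact lintegral_heat_abs_le_rpow hf (by linarith)
        _ ≤ ENNReal.ofReal (s ^ (c - 1)) * (ENNReal.ofReal (s ^ (-((n : ℝ) / 2)) *
            (4 * π) ^ (-(n : ℝ) / 2)) * (∫⁻ x, ‖f x‖ₑ) ^ 2) := by
            gcongr
            rw [← neg_div, ← mul_rpow hs0.le (by positivity)]
            refine rpow_le_rpow_of_nonpos (by positivity) ?_ ?_
            · nlinarith [pi_pos]
            · rw [neg_div]; simp; positivity
        _ = _ := by
            rw [show c - 1 - (n : ℝ) / 2 = (c - 1) + -((n : ℝ) / 2) by ring, rpow_add hs0,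
              ENNReal.ofReal_mul (by positivity), ENNReal.ofReal_mul (by positivity)]
            ring

theorem kconv_heat_heat {n : ℕ} {s t : ℝ} (hs : 0 < s) (ht : 0 < t) (x : Euc n) :
    kconv (heat n t) (fun y => ENNReal.ofReal (heat n s y)) x = ENNReal.ofReal (heat n (t + s) x) :=
  lintegral_heat_mul_heat ht hs x

theorem heatForm_le {n : ℕ} {f : Euc n → ℝ} (hf : Measurable f)
    (hf2 : ∫⁻ x, ENNReal.ofReal (f x ^ 2) ≠ ∞) {s : ℝ} (hs : 0 < s) :
    heatForm f s ≤ (∫⁻ x, ENNReal.ofReal (f x ^ 2)).toReal := by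
  refine (le_abs_self _).trans ?_
  rw [← Real.norm_eq_abs, heatForm]
  refine (norm_integral_le_lintegral_norm _).trans (ENNReal.toReal_mono hf2 ?_)
  refine le_trans (le_of_eq ?_) (lintegral_heat_abs_le_sq hf hs)
  refine lintegral_congr fun p => ?_
  rw [ofReal_norm, enorm_mul, Real.enorm_eq_ofReal (heat_nonneg hs _)]

theorem heatForm_eq_integral_sq {n : ℕ} {f : Euc n → ℝ} (hf : Measurable f)
    (hf2 : ∫⁻ x, ENNReal.ofReal (f x ^ 2) ≠ ∞) {s : ℝ} (hs : 0 < s) :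
    Integrable (fun x => rconv (heat n (s / 2)) f x ^ 2) ∧
      heatForm f s = ∫ x, rconv (heat n (s / 2)) f x ^ 2 := by
  have h := integral_sq_rconv (k := heat n (s / 2)) (f := f)
    (q := fun x => ENNReal.ofReal (heat n s x)) (by fun_prop)
    (fun x => heat_nonneg (half_pos hs) x) (fun x => heat_neg _ x) hf
    (Filter.Eventually.of_forall fun p => by
      rw [kconv_heat_heat (half_pos hs) (half_pos hs), add_halves])
    (ne_top_of_le_ne_top hf2 (lintegral_heat_abs_le_sq hf hs))
  refine ⟨h.1, ?_⟩
  rw [h.2, heatForm]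
  simp only [ENNReal.toReal_ofReal (heat_nonneg hs _)]

theorem heatForm_nonneg {n : ℕ} {f : Euc n → ℝ} (hf : Measurable f)
    (hf2 : ∫⁻ x, ENNReal.ofReal (f x ^ 2) ≠ ∞) {s : ℝ} (hs : 0 < s) : 0 ≤ heatForm f s := by
  rw [(heatForm_eq_integral_sq hf hf2 hs).2]
  exact integral_nonneg fun x => sq_nonneg _

/-- The heat form decreases in time: `⟨f, exp((s+t)Δ) f⟩` is the heat form of `exp((s/2)Δ) f` at
time `t`. -/
theorem heatForm_add_le {n : ℕ} {f : Euc n → ℝ} (hf : Measurable f)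
    (hf2 : ∫⁻ x, ENNReal.ofReal (f x ^ 2) ≠ ∞) {s t : ℝ} (hs : 0 < s) (ht : 0 < t) :
    heatForm f (s + t) ≤ heatForm f s := by
  obtain ⟨hi, he⟩ := heatForm_eq_integral_sq hf hf2 hs
  have h := integral_rconv_mul_rconv (k := heat n (s / 2)) (m := heat n t) (f := f)
    (q := fun x => ENNReal.ofReal (heat n (s + t) x)) (by fun_prop)
    (fun x => heat_nonneg (half_pos hs) x) (fun x => heat_neg _ x) (by fun_prop)
    (fun x => heat_nonneg ht x) hf
    (Filter.Eventually.of_forall fun p => by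
      have : kconv (heat n t) (fun y => ENNReal.ofReal (heat n (s / 2) y))
          = fun y => ENNReal.ofReal (heat n (t + s / 2) y) :=
        funext fun y => kconv_heat_heat (half_pos hs) ht y
      rw [this, kconv_heat_heat (by positivity) (half_pos hs),
        show s / 2 + (t + s / 2) = s + t by ring])
    (ne_top_of_le_ne_top hf2 (lintegral_heat_abs_le_sq hf (by positivity)))
  have h1 : heatForm f (s + t) = heatForm (rconv (heat n (s / 2)) f) t := by
    simp only [ENNReal.toReal_ofReal (heat_nonneg (add_pos hs ht) _)] at h
    rw [heatForm, ← h.2, heatForm]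
    refine integral_congr_ae (Filter.Eventually.of_forall fun p => ?_)
    dsimp only
    ring
  have hg2 : ∫⁻ x, ENNReal.ofReal (rconv (heat n (s / 2)) f x ^ 2) = ENNReal.ofReal (heatForm f s) := by
    rw [he, ofReal_integral_eq_lintegral_ofReal hi]
    exact Filter.Eventually.of_forall fun x => sq_nonneg _
  rw [h1]
  refine (heatForm_le (by fun_prop) (by rw [hg2]; exact ENNReal.ofReal_ne_top) ht).trans ?_
  rw [hg2, ENNReal.toReal_ofReal (heatForm_nonneg hf hf2 hs)]

/-! ### A Frullani inequality -/

/-- The inequality `∫ (M(s) - M(s+sr)) ds/s ≤ log(1+r) Φ` for a decreasing function `M` with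
values in `[0, Φ]`. On `(δ, R]` the integral telescopes, after scaling, to at most the one of `M(s)/s`
over `(δ, (1+r)δ]`. -/
theorem lintegral_frullani {M : ℝ → ℝ} (hM : Measurable M) {Φ : ℝ≥0∞} (hΦ : Φ ≠ ∞)
    (hanti : ∀ s t, 0 < s → 0 < t → M (s + t) ≤ M s) (h0 : ∀ s, 0 < s → 0 ≤ M s)
    (hle : ∀ s, 0 < s → ENNReal.ofReal (M s) ≤ Φ) {r : ℝ} (hr : 0 < r) :
    ∫⁻ s in Set.Ioi (0 : ℝ), ENNReal.ofReal (s ^ (-1 : ℝ)) * ENNReal.ofReal (M s - M (s + s * r))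
      ≤ ENNReal.ofReal (log (1 + r)) * Φ := by
  have hl : 0 < 1 + r := by linarith
  have key : ∀ δ R : ℝ, 0 < δ → δ < R → ∫⁻ s in Set.Ioc δ R, ENNReal.ofReal (s ^ (-1 : ℝ)) *
      ENNReal.ofReal (M s - M (s + s * r)) ≤ ENNReal.ofReal (log (1 + r)) * Φ := by
    intro δ R hδ hR
    set N : ℝ → ℝ≥0∞ := fun s => ENNReal.ofReal (s ^ (-1 : ℝ)) * ENNReal.ofReal (M s) with hN
    have hsub : Set.Ioc δ ((1 + r) * δ) ⊆ Set.Ioi 0 := fun s hs => hδ.trans hs.1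
    have hlog : ∫⁻ s in Set.Ioc δ ((1 + r) * δ), ENNReal.ofReal (s ^ (-1 : ℝ))
        = ENNReal.ofReal (log (1 + r)) := by
      have hδ' : δ ≤ (1 + r) * δ := by nlinarith
      have h0' : (0 : ℝ) ∉ Set.uIcc δ ((1 + r) * δ) := by
        rw [Set.uIcc_of_le hδ']; exact fun h => absurd h.1 (not_le.2 hδ)
      have h := integral_inv (a := δ) (b := (1 + r) * δ) h0'
      rw [intervalIntegral.integral_of_le hδ', mul_div_cancel_right₀ _ hδ.ne'] at h
      rw [← h, ofReal_integral_eq_lintegral_ofReal]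
      · simp only [rpow_neg_one]
      · exact (intervalIntegrable_iff_integrableOn_Ioc_of_le hδ').1
          (intervalIntegral.intervalIntegrable_inv (fun x hx hx0 => h0' (hx0 ▸ hx)) continuousOn_id)
      · filter_upwards [ae_restrict_mem measurableSet_Ioc] with s hs
        exact inv_nonneg.2 (hsub hs).le
    have hscale : ∫⁻ s in Set.Ioc δ R, ENNReal.ofReal (s ^ (-1 : ℝ)) *
        ENNReal.ofReal (M (s + s * r)) = ∫⁻ s in Set.Ioc ((1 + r) * δ) ((1 + r) * R), N s := by
      have hI : ∀ a b : ℝ, 0 < a → ∀ F : ℝ → ℝ≥0∞, ∫⁻ s in Set.Ioc a b, F s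
          = ∫⁻ s in Set.Ioi (0 : ℝ), (Set.Ioc a b).indicator F s := by
        intro a b ha F
        rw [setLIntegral_indicator measurableSet_Ioc, Set.inter_eq_left.2]
        exact fun s hs => ha.trans hs.1
      rw [hI _ _ hδ, hI _ _ (by positivity), lintegral_Ioi_comp_mul hl
          ((Set.Ioc ((1 + r) * δ) ((1 + r) * R)).indicator N),
        ← lintegral_const_mul' _ _ ENNReal.ofReal_ne_top]
      refine setLIntegral_congr_fun measurableSet_Ioi fun s (hs : 0 < s) => ?_
      have hmem : (1 + r) * s ∈ Set.Ioc ((1 + r) * δ) ((1 + r) * R) ↔ s ∈ Set.Ioc δ R := by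
        simp [hl]
      by_cases hsm : s ∈ Set.Ioc δ R
      · rw [Set.indicator_of_mem hsm, Set.indicator_of_mem (hmem.2 hsm), hN]
        dsimp only
        rw [← mul_assoc, ← ENNReal.ofReal_mul hl.le]
        congr 2
        · rw [mul_rpow hl.le hs.le, rpow_neg_one (1 + r), mul_inv_cancel_left₀ hl.ne']
        · congr 1; ring
      · rw [Set.indicator_of_notMem hsm, Set.indicator_of_notMem (fun h => hsm (hmem.1 h)), mul_zero]
    have hfin : ∫⁻ s in Set.Ioc ((1 + r) * δ) ((1 + r) * R), N s ≠ ∞ := by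
      refine ne_top_of_le_ne_top (b := ∫⁻ s in Set.Ioc ((1 + r) * δ) ((1 + r) * R),
        ENNReal.ofReal (((1 + r) * δ) ^ (-1 : ℝ)) * Φ) ?_ ?_
      · rw [setLIntegral_const]
        refine ENNReal.mul_ne_top (by finiteness) (by simp)
      · refine setLIntegral_mono' measurableSet_Ioc fun s hs => ?_
        have hs0 : 0 < (1 + r) * δ := by positivity
        gcongr ?_ * ?_
        · exact ENNReal.ofReal_le_ofReal (rpow_le_rpow_of_nonpos hs0 hs.1.le (by norm_num))
        · exact hle s (hs0.trans hs.1)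
    rw [← ENNReal.add_le_add_iff_right hfin]
    nth_rw 1 [← hscale]
    rw [← lintegral_add_right _ (by fun_prop)]
    calc _ = ∫⁻ s in Set.Ioc δ R, N s := by
          refine setLIntegral_congr_fun measurableSet_Ioc fun s hs => ?_
          have hs0 : 0 < s := hδ.trans hs.1
          rw [← mul_add, ← ENNReal.ofReal_add (sub_nonneg.2 (hanti s (s * r) hs0 (by positivity)))
            (h0 _ (by positivity)), sub_add_cancel]
      _ ≤ ∫⁻ s in Set.Ioc δ ((1 + r) * δ) ∪ Set.Ioc ((1 + r) * δ) ((1 + r) * R), N s := by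
          refine lintegral_mono_set fun s hs => ?_
          rcases le_or_gt s ((1 + r) * δ) with h | h
          · exact Or.inl ⟨hs.1, h⟩
          · exact Or.inr ⟨h, hs.2.trans (by nlinarith)⟩
      _ ≤ _ := by
          refine (lintegral_union_le _ _ _).trans ?_
          gcongr
          rw [← hlog, ← lintegral_mul_const _ (by fun_prop)]
          refine setLIntegral_mono' measurableSet_Ioc fun s hs => ?_
          exact mul_le_mul_right (hle s (hsub hs)) _
  have hU : Set.Ioi (0 : ℝ) = ⋃ k : ℕ, Set.Ioc (1 / ((k : ℝ) + 2)) (k + 2) := by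
    ext s
    simp only [Set.mem_Ioi, Set.mem_iUnion, Set.mem_Ioc]
    constructor
    · intro hs
      obtain ⟨k, hk⟩ := exists_nat_gt (max s s⁻¹)
      refine ⟨k, ?_, by linarith [le_max_left s s⁻¹]⟩
      have : s⁻¹ < k + 2 := by linarith [le_max_right s s⁻¹]
      rw [one_div]
      exact inv_lt_of_inv_lt₀ hs this
    · rintro ⟨k, hk, -⟩
      exact lt_trans (by positivity) hk
  have hmono : Monotone (fun k : ℕ => Set.Ioc (1 / ((k : ℝ) + 2)) ((k : ℝ) + 2)) := by
    intro i j hij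
    have : (i : ℝ) ≤ j := by exact_mod_cast hij
    refine Set.Ioc_subset_Ioc ?_ (by linarith)
    gcongr
  rw [hU, setLIntegral_iUnion_of_directed _ hmono.directed_le]
  refine iSup_le fun k => key _ _ (by positivity) ?_
  rw [div_lt_iff₀ (by positivity)]
  nlinarith [(Nat.cast_nonneg k : (0 : ℝ) ≤ k)]

/-- The energy of the fractional Laplacian, expressed by the heat form, is at most the squared
`L²` norm. -/
theorem lintegral_heatForm_energy_le {n : ℕ} {f : Euc n → ℝ} (hf : Measurable f)
    (hf2 : ∫⁻ x, ENNReal.ofReal (f x ^ 2) ≠ ∞) {γ : ℝ} (hγ0 : 0 < γ) (hγ1 : γ < 1) :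
    ∫⁻ t in Set.Ioi (0 : ℝ), ENNReal.ofReal (t ^ (-γ - 1)) * ∫⁻ s in Set.Ioi (0 : ℝ),
        ENNReal.ofReal (s ^ (γ - 1)) * ENNReal.ofReal (heatForm f s - heatForm f (s + t))
      ≤ ENNReal.ofReal (Gamma (1 - γ) / γ * Gamma γ) * ∫⁻ x, ENNReal.ofReal (f x ^ 2) := by
  have hM := measurable_heatForm hf
  rw [lintegral_lintegral_scale (c := γ)
    (G := fun t s => ENNReal.ofReal (heatForm f s - heatForm f (s + t)))
    (by simp only [Function.uncurry_def]; fun_prop), ← lintegral_log hγ0 hγ1,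
    ← lintegral_mul_const _ (by fun_prop)]
  refine setLIntegral_mono' measurableSet_Ioi fun r (hr : 0 < r) => ?_
  rw [mul_assoc]
  gcongr
  rw [show γ - γ - 1 = (-1 : ℝ) by ring]
  refine lintegral_frullani hM hf2 (fun s t hs ht => heatForm_add_le hf hf2 hs ht)
    (fun s hs => heatForm_nonneg hf hf2 hs) (fun s hs => ?_) hr
  exact (ENNReal.ofReal_le_iff_le_toReal hf2).2 (heatForm_le hf hf2 hs)

/-! ### Riesz potentials and the heat form -/

/-- The constant `heatMix n b ^ (-2) Γ(b)² / Γ(2b)` in `k * k = c ∫ s^(2b-1) heat s ds` for the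
Riesz kernel `k = |x|^(2b-n)`. -/
noncomputable def rieszSq (n : ℕ) (b : ℝ) : ℝ :=
  (heatMix n b)⁻¹ ^ 2 * (Gamma b * Gamma b / Gamma (b + b))

theorem rieszSq_pos {n : ℕ} {b : ℝ} (hb : 0 < b) (hbn : b < (n : ℝ) / 2) : 0 < rieszSq n b := by
  have h1 := heatMix_pos hbn
  unfold rieszSq; positivity

/-- The kernel of `exp(tΔ)` composed twice with the Riesz potential of kernel `|x|^(2b-n)`. -/
noncomputable def rieszHeat (n : ℕ) (b t : ℝ) (x : Euc n) : ℝ≥0∞ :=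
  ENNReal.ofReal (rieszSq n b) * ∫⁻ s in Set.Ioi (0 : ℝ), ENNReal.ofReal (s ^ (b + b - 1)) *
    ENNReal.ofReal (heat n (s + t) x)

/-- The Riesz kernel `|x|^(2b-n)`. -/
noncomputable def rpowKernel (n : ℕ) (b : ℝ) (x : Euc n) : ℝ := ‖x‖ ^ (2 * b - n)

@[fun_prop]
theorem measurable_rpowKernel (n : ℕ) (b : ℝ) : Measurable (rpowKernel n b) := by
  unfold rpowKernel; fun_prop

theorem rpowKernel_nonneg {n : ℕ} {b : ℝ} (x : Euc n) : 0 ≤ rpowKernel n b x := by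
  unfold rpowKernel; positivity

theorem rpowKernel_neg {n : ℕ} {b : ℝ} (x : Euc n) : rpowKernel n b (-x) = rpowKernel n b x := by
  simp [rpowKernel]

/-- The Riesz kernel convolved with its evolution `m` under the heat semigroup at time `t`. -/
theorem kconv_rpowKernel {n : ℕ} (hn : 0 < n) {b t : ℝ} (hb : 0 < b) (hbn : b < (n : ℝ) / 2)
    (ht : 0 ≤ t) {m : Euc n → ℝ≥0∞} (hm : ∀ᵐ y, ENNReal.ofReal (heatMix n b) * m y
      = ∫⁻ s in Set.Ioi (0 : ℝ), ENNReal.ofReal (s ^ (b - 1)) * ENNReal.ofReal (heat n (s + t) y))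
    (x : Euc n) : kconv (rpowKernel n b) m x = rieszHeat n b t x := by
  have hh := heatMix_pos hbn
  have hne : ENNReal.ofReal (heatMix n b ^ 2) ≠ 0 := by simp; positivity
  rw [← ENNReal.mul_right_inj hne ENNReal.ofReal_ne_top, kconv, rieszHeat, ← mul_assoc,
    ← ENNReal.ofReal_mul (by positivity),
    show heatMix n b ^ 2 * rieszSq n b = Gamma b * Gamma b / Gamma (b + b) by
      unfold rieszSq; field_simp,
    ← lintegral_heat_superposition hb hb ht x, ← lintegral_const_mul' _ _ ENNReal.ofReal_ne_top]
  refine lintegral_congr_ae ?_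
  filter_upwards [hm, ae_ne hn x] with y hy hyx
  rw [← hy, lintegral_rpow_mul_heat hbn (sub_ne_zero.2 hyx.symm), sq, ENNReal.ofReal_mul hh.le,
    ENNReal.ofReal_mul hh.le, rpowKernel]
  ring

theorem kconv_rpowKernel_self {n : ℕ} (hn : 0 < n) {b : ℝ} (hb : 0 < b) (hbn : b < (n : ℝ) / 2)
    (x : Euc n) : kconv (rpowKernel n b) (fun y => ENNReal.ofReal (rpowKernel n b y)) x
      = rieszHeat n b 0 x := by
  refine kconv_rpowKernel hn hb hbn le_rfl ?_ x
  filter_upwards [ae_ne hn 0] with y hy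
  simp only [add_zero]
  rw [lintegral_rpow_mul_heat hbn hy, ENNReal.ofReal_mul (heatMix_pos hbn).le, rpowKernel]

/-- The heat evolution of the Riesz kernel is a superposition of translated heat kernels. -/
theorem ofReal_mul_kconv_heat_rpowKernel {n : ℕ} (hn : 0 < n) {b t : ℝ} (hbn : b < (n : ℝ) / 2)
    (ht : 0 < t) (x : Euc n) : ENNReal.ofReal (heatMix n b) *
      kconv (heat n t) (fun y => ENNReal.ofReal (rpowKernel n b y)) x
    = ∫⁻ s in Set.Ioi (0 : ℝ), ENNReal.ofReal (s ^ (b - 1)) *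
        ENNReal.ofReal (heat n (s + t) x) := by
  rw [← lintegral_heat_mul_superposition ht, kconv, ← lintegral_const_mul' _ _ ENNReal.ofReal_ne_top]
  refine lintegral_congr_ae ?_
  filter_upwards [ae_ne hn 0] with y hy
  rw [lintegral_rpow_mul_heat hbn hy, ENNReal.ofReal_mul (heatMix_pos hbn).le, rpowKernel]
  ring

theorem kconv_rpowKernel_heat {n : ℕ} (hn : 0 < n) {b t : ℝ} (hb : 0 < b) (hbn : b < (n : ℝ) / 2)
    (ht : 0 < t) (x : Euc n) : kconv (rpowKernel n b)
      (kconv (heat n t) (fun y => ENNReal.ofReal (rpowKernel n b y))) x = rieszHeat n b t x :=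
  kconv_rpowKernel hn hb hbn ht.le
    (Filter.Eventually.of_forall fun y => ofReal_mul_kconv_heat_rpowKernel hn hbn ht y) x

theorem lintegral_rieszHeat_abs {n : ℕ} {f : Euc n → ℝ} (hf : Measurable f)
    (hf1 : ∫⁻ x, ‖f x‖ₑ ≠ ∞) (hf2 : ∫⁻ x, ENNReal.ofReal (f x ^ 2) ≠ ∞) {b t : ℝ} (hb : 0 < b)
    (hbn : b + b < (n : ℝ) / 2) (ht : 0 ≤ t) :
    ∫⁻ p : Euc n × Euc n, rieszHeat n b t (p.1 - p.2) * ‖f p.1 * f p.2‖ₑ ≠ ∞ := by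
  have h := lintegral_rpow_mul_heat_abs_ne_top hf hf1 hf2 (add_pos hb hb) hbn ht
  have h2 : ∫⁻ p : Euc n × Euc n, rieszHeat n b t (p.1 - p.2) * ‖f p.1 * f p.2‖ₑ
      = ENNReal.ofReal (rieszSq n b) * ∫⁻ s in Set.Ioi (0 : ℝ), ENNReal.ofReal (s ^ (b + b - 1)) *
        ∫⁻ p : Euc n × Euc n, ENNReal.ofReal (heat n (s + t) (p.1 - p.2)) * ‖f p.1 * f p.2‖ₑ := by
    calc _ = ∫⁻ p : Euc n × Euc n, ENNReal.ofReal (rieszSq n b) * ∫⁻ s in Set.Ioi (0 : ℝ),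
          ENNReal.ofReal (s ^ (b + b - 1)) *
            (ENNReal.ofReal (heat n (s + t) (p.1 - p.2)) * ‖f p.1 * f p.2‖ₑ) := by
          refine lintegral_congr fun p => ?_
          rw [rieszHeat, mul_assoc, ← lintegral_mul_const _ (by fun_prop)]
          simp only [mul_assoc]
      _ = ENNReal.ofReal (rieszSq n b) * ∫⁻ s in Set.Ioi (0 : ℝ), ∫⁻ p : Euc n × Euc n,
          ENNReal.ofReal (s ^ (b + b - 1)) *
            (ENNReal.ofReal (heat n (s + t) (p.1 - p.2)) * ‖f p.1 * f p.2‖ₑ) := by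
          rw [lintegral_const_mul' _ _ ENNReal.ofReal_ne_top, lintegral_lintegral_swap]
          refine Measurable.aemeasurable ?_
          simp only [Function.uncurry_def]
          fun_prop
      _ = _ := by
          congr 1
          refine lintegral_congr fun s => ?_
          rw [lintegral_const_mul' _ _ ENNReal.ofReal_ne_top]
  rw [h2]
  exact ENNReal.mul_ne_top ENNReal.ofReal_ne_top h

/-- The quadratic form of `rieszHeat` is a superposition of heat forms. -/
theorem ofReal_integral_rieszHeat {n : ℕ} {f : Euc n → ℝ} (hf : Measurable f)
    (hf1 : ∫⁻ x, ‖f x‖ₑ ≠ ∞) (hf2 : ∫⁻ x, ENNReal.ofReal (f x ^ 2) ≠ ∞) {b t : ℝ} (hb : 0 < b)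
    (hbn : b + b < (n : ℝ) / 2) (ht : 0 ≤ t) :
    0 ≤ ∫ p : Euc n × Euc n, (rieszHeat n b t (p.1 - p.2)).toReal * (f p.1 * f p.2) ∧
    ENNReal.ofReal (∫ p : Euc n × Euc n, (rieszHeat n b t (p.1 - p.2)).toReal * (f p.1 * f p.2))
      = ENNReal.ofReal (rieszSq n b) * ∫⁻ s in Set.Ioi (0 : ℝ), ENNReal.ofReal (s ^ (b + b - 1)) *
        ENNReal.ofReal (heatForm f (s + t)) := by
  have hc := rieszSq_pos hb (show b < (n : ℝ) / 2 by linarith)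
  obtain ⟨hi, he⟩ := integral_kernel_swap (μ := volume.restrict (Set.Ioi (0 : ℝ)))
    (ν := (volume : Measure (Euc n × Euc n)))
    (G := fun s p => rieszSq n b * s ^ (b + b - 1) * heat n (s + t) (p.1 - p.2))
    (F := fun p => f p.1 * f p.2) (Q := fun p => rieszHeat n b t (p.1 - p.2))
    (by simp only [Function.uncurry_def]; fun_prop)
    (Filter.Eventually.of_forall fun p => by
      filter_upwards [ae_restrict_mem measurableSet_Ioi] with s (hs : 0 < s)
      exact mul_nonneg (by positivity) (heat_nonneg (by linarith) _))
    (by fun_prop)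
    (Filter.Eventually.of_forall fun p => by
      rw [rieszHeat, ← lintegral_const_mul' _ _ ENNReal.ofReal_ne_top]
      refine setLIntegral_congr_fun measurableSet_Ioi fun s (hs : 0 < s) => ?_
      rw [ENNReal.ofReal_mul (by positivity), ENNReal.ofReal_mul hc.le, mul_assoc])
    (lintegral_rieszHeat_abs hf hf1 hf2 hb hbn ht)
  have hh : ∀ s, ∫ p : Euc n × Euc n, rieszSq n b * s ^ (b + b - 1) * heat n (s + t) (p.1 - p.2) *
      (f p.1 * f p.2) = rieszSq n b * s ^ (b + b - 1) * heatForm f (s + t) := by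
    intro s
    rw [heatForm, ← integral_const_mul]
    simp only [mul_assoc]
  simp only [hh] at hi he
  have hnn : ∀ᵐ s ∂(volume.restrict (Set.Ioi (0 : ℝ))),
      0 ≤ rieszSq n b * s ^ (b + b - 1) * heatForm f (s + t) := by
    filter_upwards [ae_restrict_mem measurableSet_Ioi] with s (hs : 0 < s)
    exact mul_nonneg (by positivity) (heatForm_nonneg hf hf2 (by linarith))
  rw [← he]
  refine ⟨integral_nonneg_of_ae hnn, ?_⟩
  rw [ofReal_integral_eq_lintegral_ofReal hi hnn, ← lintegral_const_mul' _ _ ENNReal.ofReal_ne_top]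
  refine setLIntegral_congr_fun measurableSet_Ioi fun s (hs : 0 < s) => ?_
  rw [ENNReal.ofReal_mul (by positivity), ENNReal.ofReal_mul hc.le, mul_assoc]

/-- The `L²` norm of a Riesz potential of `f` as a superposition of heat forms of `f`. -/
theorem lintegral_sq_riesz {n : ℕ} (hn : 0 < n) {f : Euc n → ℝ} (hf : Measurable f)
    (hf1 : ∫⁻ x, ‖f x‖ₑ ≠ ∞) (hf2 : ∫⁻ x, ENNReal.ofReal (f x ^ 2) ≠ ∞) {b : ℝ} (hb : 0 < b)
    (hbn : b + b < (n : ℝ) / 2) :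
    ∫⁻ x, ENNReal.ofReal (rconv (rpowKernel n b) f x ^ 2)
      = ENNReal.ofReal (rieszSq n b) * ∫⁻ s in Set.Ioi (0 : ℝ), ENNReal.ofReal (s ^ (b + b - 1)) *
        ENNReal.ofReal (heatForm f s) := by
  obtain ⟨hi, he⟩ := integral_sq_rconv (k := rpowKernel n b) (f := f) (q := rieszHeat n b 0)
    (by fun_prop) rpowKernel_nonneg rpowKernel_neg hf
    (Filter.Eventually.of_forall fun p => kconv_rpowKernel_self hn hb (by linarith) _)
    (lintegral_rieszHeat_abs hf hf1 hf2 hb hbn le_rfl)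
  rw [← ofReal_integral_eq_lintegral_ofReal hi (Filter.Eventually.of_forall fun x => sq_nonneg _),
    he, (ofReal_integral_rieszHeat hf hf1 hf2 hb hbn le_rfl).2]
  simp only [add_zero]

/-- The heat form of a Riesz potential of `f` as a superposition of heat forms of `f`. -/
theorem heatForm_riesz {n : ℕ} (hn : 0 < n) {f : Euc n → ℝ} (hf : Measurable f)
    (hf1 : ∫⁻ x, ‖f x‖ₑ ≠ ∞) (hf2 : ∫⁻ x, ENNReal.ofReal (f x ^ 2) ≠ ∞) {b t : ℝ} (hb : 0 < b)
    (hbn : b + b < (n : ℝ) / 2) (ht : 0 < t) :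
    Integrable (fun p : Euc n × Euc n => rconv (rpowKernel n b) f p.1 *
        rconv (rpowKernel n b) f p.2 * heat n t (p.1 - p.2)) ∧
      0 ≤ heatForm (rconv (rpowKernel n b) f) t ∧
      ENNReal.ofReal (heatForm (rconv (rpowKernel n b) f) t)
        = ENNReal.ofReal (rieszSq n b) * ∫⁻ s in Set.Ioi (0 : ℝ),
          ENNReal.ofReal (s ^ (b + b - 1)) * ENNReal.ofReal (heatForm f (s + t)) := by
  obtain ⟨hi, he⟩ := integral_rconv_mul_rconv (k := rpowKernel n b) (m := heat n t) (f := f)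
    (q := rieszHeat n b t) (by fun_prop) rpowKernel_nonneg rpowKernel_neg (by fun_prop)
    (fun x => heat_nonneg ht x) hf
    (Filter.Eventually.of_forall fun p => kconv_rpowKernel_heat hn hb (by linarith) ht _)
    (lintegral_rieszHeat_abs hf hf1 hf2 hb hbn ht.le)
  have h1 : heatForm (rconv (rpowKernel n b) f) t = ∫ p : Euc n × Euc n,
      rconv (rpowKernel n b) f p.1 * rconv (rpowKernel n b) f p.2 * heat n t (p.1 - p.2) := by
    rw [heatForm]
    refine integral_congr_ae (Filter.Eventually.of_forall fun p => ?_)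
    dsimp only
    ring
  have h2 := ofReal_integral_rieszHeat hf hf1 hf2 hb hbn ht.le
  rw [h1, he]
  exact ⟨hi, h2⟩

/-- The `L²` norm of a Riesz potential is its heat form plus the energy lost up to time `t`. -/
theorem lintegral_sq_riesz_eq_add {n : ℕ} (hn : 0 < n) {f : Euc n → ℝ} (hf : Measurable f)
    (hf1 : ∫⁻ x, ‖f x‖ₑ ≠ ∞) (hf2 : ∫⁻ x, ENNReal.ofReal (f x ^ 2) ≠ ∞) {b t : ℝ} (hb : 0 < b)
    (hbn : b + b < (n : ℝ) / 2) (ht : 0 < t) :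
    ∫⁻ x, ENNReal.ofReal (rconv (rpowKernel n b) f x ^ 2)
      = ENNReal.ofReal (heatForm (rconv (rpowKernel n b) f) t) + ENNReal.ofReal (rieszSq n b) *
        ∫⁻ s in Set.Ioi (0 : ℝ), ENNReal.ofReal (s ^ (b + b - 1)) *
          ENNReal.ofReal (heatForm f s - heatForm f (s + t)) := by
  have hM := measurable_heatForm hf
  rw [lintegral_sq_riesz hn hf hf1 hf2 hb hbn, (heatForm_riesz hn hf hf1 hf2 hb hbn ht).2.2,
    ← mul_add, ← lintegral_add_left (by fun_prop)]
  congr 1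
  refine setLIntegral_congr_fun measurableSet_Ioi fun s (hs : 0 < s) => ?_
  rw [← mul_add, ← ENNReal.ofReal_add (heatForm_nonneg hf hf2 (by linarith))
    (sub_nonneg.2 (heatForm_add_le hf hf2 hs ht)), add_sub_cancel]

/-! ### The ground state representation for real functions in `L¹ ∩ L²` -/

theorem lintegral_prod_heat_left {n : ℕ} {t : ℝ} {u w : Euc n → ℝ}
    (hu : Measurable u) (hw : Measurable w) (hw0 : ∀ x, 0 ≤ w x) :
    ∫⁻ p : Euc n × Euc n, ENNReal.ofReal (u p.1 ^ 2 / w p.1 * w p.2 * heat n t (p.1 - p.2))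
      = ∫⁻ x, ENNReal.ofReal (u x ^ 2 / w x) *
        kconv (heat n t) (fun y => ENNReal.ofReal (w y)) x := by
  rw [Measure.volume_eq_prod, lintegral_prod _ (by fun_prop)]
  refine lintegral_congr fun x => ?_
  rw [kconv, ← lintegral_const_mul' _ _ ENNReal.ofReal_ne_top]
  refine lintegral_congr fun y => ?_
  have := hw0 x
  have := hw0 y
  rw [ENNReal.ofReal_mul (by positivity), ENNReal.ofReal_mul (by positivity)]
  ring

theorem lintegral_prod_heat_right {n : ℕ} {t : ℝ} {u w : Euc n → ℝ}
    (hu : Measurable u) (hw : Measurable w) (hw0 : ∀ x, 0 ≤ w x) :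
    ∫⁻ p : Euc n × Euc n, ENNReal.ofReal (u p.2 ^ 2 / w p.2 * w p.1 * heat n t (p.1 - p.2))
      = ∫⁻ x, ENNReal.ofReal (u x ^ 2 / w x) *
        kconv (heat n t) (fun y => ENNReal.ofReal (w y)) x := by
  rw [Measure.volume_eq_prod, lintegral_prod_symm _ (by fun_prop)]
  refine lintegral_congr fun x => ?_
  rw [kconv, ← lintegral_const_mul' _ _ ENNReal.ofReal_ne_top]
  refine lintegral_congr fun y => ?_
  have := hw0 x
  have := hw0 y
  dsimp only
  rw [← heat_neg t (y - x), neg_sub, ENNReal.ofReal_mul (by positivity),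
    ENNReal.ofReal_mul (by positivity)]
  ring

/-- The ground state substitution `u = w h` at a fixed time of the heat semigroup. -/
theorem lintegral_groundState_heat_le {n : ℕ} {t : ℝ} (ht : 0 < t) {u w : Euc n → ℝ}
    (hu : Measurable u) (hw : Measurable w) (hw0 : ∀ x, 0 ≤ w x) (hwp : ∀ᵐ x, w x ≠ 0)
    (hi : Integrable (fun p : Euc n × Euc n => u p.1 * u p.2 * heat n t (p.1 - p.2)))
    (hf0 : 0 ≤ heatForm u t) :
    (∫⁻ p : Euc n × Euc n, ENNReal.ofReal ((u p.1 / w p.1 - u p.2 / w p.2) ^ 2 * (w p.1 * w p.2) *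
        heat n t (p.1 - p.2))) + 2 * ENNReal.ofReal (heatForm u t)
      ≤ 2 * ∫⁻ x, ENNReal.ofReal (u x ^ 2 / w x) *
        kconv (heat n t) (fun y => ENNReal.ofReal (w y)) x := by
  set A : Euc n × Euc n → ℝ := fun p => u p.1 ^ 2 / w p.1 * w p.2 * heat n t (p.1 - p.2) with hA
  set A' : Euc n × Euc n → ℝ := fun p => u p.2 ^ 2 / w p.2 * w p.1 * heat n t (p.1 - p.2) with hA'
  set B : Euc n × Euc n → ℝ := fun p => (u p.1 / w p.1 - u p.2 / w p.2) ^ 2 * (w p.1 * w p.2) *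
        heat n t (p.1 - p.2) with hB
  have hA0 : ∀ p, 0 ≤ A p := fun p => mul_nonneg (mul_nonneg (div_nonneg (sq_nonneg _) (hw0 _))
    (hw0 _)) (heat_nonneg ht _)
  have hA'0 : ∀ p, 0 ≤ A' p := fun p => mul_nonneg (mul_nonneg (div_nonneg (sq_nonneg _) (hw0 _))
    (hw0 _)) (heat_nonneg ht _)
  have hB0 : ∀ p, 0 ≤ B p := fun p => mul_nonneg (mul_nonneg (sq_nonneg _)
    (mul_nonneg (hw0 _) (hw0 _))) (heat_nonneg ht _)
  have e1 := lintegral_prod_heat_left (t := t) hu hw hw0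
  have e2 := lintegral_prod_heat_right (t := t) hu hw hw0
  set R := ∫⁻ x, ENNReal.ofReal (u x ^ 2 / w x) *
        kconv (heat n t) (fun y => ENNReal.ofReal (w y)) x with hR
  by_cases hRt : R = ∞
  · rw [hRt]; simp
  have hAi : Integrable A := (lintegral_ofReal_ne_top_iff_integrable
    (by fun_prop) (Filter.Eventually.of_forall hA0)).1 (by rw [e1]; exact hRt)
  have hA'i : Integrable A' := (lintegral_ofReal_ne_top_iff_integrable
    (by fun_prop) (Filter.Eventually.of_forall hA'0)).1 (by rw [e2]; exact hRt)
  have hae : B =ᵐ[volume] fun p => A p + A' p - 2 * (u p.1 * u p.2 * heat n t (p.1 - p.2)) := by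
    filter_upwards [Measure.quasiMeasurePreserving_fst.ae hwp,
      Measure.quasiMeasurePreserving_snd.ae hwp] with p h1 h2
    simp only [hA, hA', hB]
    field_simp
    ring
  have hBi : Integrable B := ((hAi.add hA'i).sub (hi.const_mul 2)).congr hae.symm
  have hBe : ∫ p, B p = (∫ p, A p) + (∫ p, A' p) - 2 * heatForm u t := by
    have h1 : ∫ p, (A p + A' p) = (∫ p, A p) + ∫ p, A' p := integral_add hAi hA'i
    rw [integral_congr_ae hae, integral_sub (f := fun p => A p + A' p) (hAi.add hA'i)
      (hi.const_mul 2), h1, integral_const_mul, heatForm]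
    congr 2
    refine integral_congr_ae (Filter.Eventually.of_forall fun p => ?_)
    dsimp only
    ring
  have e3 : ∫⁻ p, ENNReal.ofReal (B p) = ENNReal.ofReal (∫ p, B p) :=
    (ofReal_integral_eq_lintegral_ofReal hBi (Filter.Eventually.of_forall hB0)).symm
  rw [← ofReal_integral_eq_lintegral_ofReal hAi (Filter.Eventually.of_forall hA0)] at e1
  rw [← ofReal_integral_eq_lintegral_ofReal hA'i (Filter.Eventually.of_forall hA'0)] at e2
  rw [e3, two_mul R]
  nth_rw 1 [← e1]
  rw [← e2, two_mul (ENNReal.ofReal (heatForm u t)), ← ENNReal.ofReal_add hf0 hf0,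
    ← ENNReal.ofReal_add (integral_nonneg hB0) (by positivity),
    ← ENNReal.ofReal_add (integral_nonneg hA0) (integral_nonneg hA'0), hBe, ← two_mul,
    sub_add_cancel]

theorem enorm_rconv_le {n : ℕ} {k f : Euc n → ℝ} (hk0 : ∀ x, 0 ≤ k x) (x : Euc n) :
    ‖rconv k f x‖ₑ ≤ kconv k (fun y => ‖f y‖ₑ) x := by
  refine (enorm_integral_le_lintegral_enorm _).trans (le_of_eq ?_)
  refine lintegral_congr fun y => ?_
  rw [enorm_mul, Real.enorm_eq_ofReal (hk0 _)]

theorem ofReal_sq_eq_enorm (r : ℝ) : ENNReal.ofReal (r ^ 2) = ‖r‖ₑ ^ 2 := by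
  rw [Real.enorm_eq_ofReal_abs, ← ENNReal.ofReal_pow (abs_nonneg _), sq_abs]

/-- The Stein–Weiss inequality for the absolute values. -/
theorem lintegral_steinWeiss_kconv {n : ℕ} {b : ℝ} (hb : 0 < b) (hbn : b + b < (n : ℝ) / 2)
    {g : Euc n → ℝ≥0∞} (hg : Measurable g) :
    ∫⁻ x, ENNReal.ofReal (‖x‖ ^ (-(4 * b))) * kconv (rpowKernel n b) g x ^ 2
      ≤ ENNReal.ofReal (rieszComp n ((0 + (n : ℝ) / 2) / 2) b) ^ 2 * ∫⁻ y, g y ^ 2 := by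
  have h := lintegral_steinWeiss (n := n) le_rfl hb (by linarith) hg
  simp only [neg_zero, rpow_zero, ENNReal.ofReal_one, one_mul] at h
  refine le_trans (le_of_eq ?_) h
  refine lintegral_congr fun x => ?_
  rw [mul_pow, ← ENNReal.ofReal_pow (by positivity), ← rpow_natCast, ← rpow_mul (norm_nonneg _)]
  unfold kconv rpowKernel
  congr 4
  push_cast; ring

/-- What a power of `|x|` loses in time `t` under the heat semigroup. -/
noncomputable def lossInt (n : ℕ) (a t : ℝ) (x : Euc n) : ℝ≥0∞ :=
  ∫⁻ s in Set.Ioi (0 : ℝ), ENNReal.ofReal (s ^ (a - 1)) * ENNReal.ofReal (heatLoss n t s x)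

/-- What a power of `|x|` gains in time `t` under the heat semigroup. -/
noncomputable def gainInt (n : ℕ) (a t : ℝ) (x : Euc n) : ℝ≥0∞ :=
  ∫⁻ s in Set.Ioi (0 : ℝ), ENNReal.ofReal (s ^ (a - 1)) * ENNReal.ofReal (heatGain n t s x)

theorem measurable_lossInt (n : ℕ) (a : ℝ) : Measurable (Function.uncurry (lossInt n a)) := by
  unfold lossInt
  simp only [Function.uncurry_def]
  refine Measurable.lintegral_prod_right' (f := fun p : (ℝ × Euc n) × ℝ =>
    ENNReal.ofReal (p.2 ^ (a - 1)) * ENNReal.ofReal (heatLoss n p.1.1 p.2 p.1.2)) ?_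
  fun_prop

theorem measurable_gainInt (n : ℕ) (a : ℝ) : Measurable (Function.uncurry (gainInt n a)) := by
  unfold gainInt
  simp only [Function.uncurry_def]
  refine Measurable.lintegral_prod_right' (f := fun p : (ℝ × Euc n) × ℝ =>
    ENNReal.ofReal (p.2 ^ (a - 1)) * ENNReal.ofReal (heatGain n p.1.1 p.2 p.1.2)) ?_
  fun_prop

/-- The weight of the ground state substitution balances its gain and its loss. -/
theorem lintegral_kconv_add_loss {n : ℕ} (hn : 0 < n) {a t : ℝ} (han : a < (n : ℝ) / 2)
    (ht : 0 < t) {u w : Euc n → ℝ} (hum : Measurable u) (hw : w = rpowKernel n a) :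
    ENNReal.ofReal (heatMix n a) * (∫⁻ x, ENNReal.ofReal (u x ^ 2 / w x) *
        kconv (heat n t) (fun y => ENNReal.ofReal (w y)) x)
      + ∫⁻ x, ENNReal.ofReal (u x ^ 2 / w x) * lossInt n a t x
    = ENNReal.ofReal (heatMix n a) * (∫⁻ x, ENNReal.ofReal (u x ^ 2))
      + ∫⁻ x, ENNReal.ofReal (u x ^ 2 / w x) * gainInt n a t x := by
  have hη := heatMix_pos han
  have hwm : Measurable w := by rw [hw]; fun_prop
  have hLx : Measurable (lossInt n a t) := (measurable_lossInt n a).of_uncurry_left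
  have hGx : Measurable (gainInt n a t) := (measurable_gainInt n a).of_uncurry_left
  have hvm : Measurable (fun x => ENNReal.ofReal (u x ^ 2 / w x)) := by fun_prop
  have key : ∀ x ≠ 0, ENNReal.ofReal (heatMix n a) * (ENNReal.ofReal (u x ^ 2 / w x) *
        kconv (heat n t) (fun y => ENNReal.ofReal (w y)) x)
        + ENNReal.ofReal (u x ^ 2 / w x) * lossInt n a t x
      = ENNReal.ofReal (heatMix n a) * ENNReal.ofReal (u x ^ 2)
        + ENNReal.ofReal (u x ^ 2 / w x) * gainInt n a t x := by
    intro x hx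
    have h3 : ENNReal.ofReal (heatMix n a * ‖x‖ ^ (2 * a - n)) + gainInt n a t x
        = ENNReal.ofReal (heatMix n a) * kconv (heat n t) (fun y => ENNReal.ofReal (w y)) x
          + lossInt n a t x := by
      rw [← lintegral_rpow_mul_heat han hx, hw, ofReal_mul_kconv_heat_rpowKernel hn han ht]
      exact lintegral_heat_add_gain ht x
    have hwx : w x = ‖x‖ ^ (2 * a - n) := by rw [hw, rpowKernel]
    have h4 : ENNReal.ofReal (heatMix n a) * ENNReal.ofReal (u x ^ 2)
        = ENNReal.ofReal (u x ^ 2 / w x) * ENNReal.ofReal (heatMix n a * ‖x‖ ^ (2 * a - n)) := by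
      have hwp : 0 < w x := by rw [hwx]; positivity
      rw [← ENNReal.ofReal_mul hη.le, ← ENNReal.ofReal_mul (by positivity), ← hwx]
      congr 1
      field_simp
    rw [h4, mul_left_comm, ← mul_add, ← mul_add, h3]
  have e1 := lintegral_add_right (μ := volume) (fun x => ENNReal.ofReal (heatMix n a) *
    (ENNReal.ofReal (u x ^ 2 / w x) * kconv (heat n t) (fun y => ENNReal.ofReal (w y)) x))
    (hvm.mul hLx)
  have e2 := lintegral_add_right (μ := volume) (fun x => ENNReal.ofReal (heatMix n a) *
    ENNReal.ofReal (u x ^ 2)) (hvm.mul hGx)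
  rw [lintegral_const_mul' _ _ ENNReal.ofReal_ne_top] at e1 e2
  refine e1.symm.trans (Eq.trans (lintegral_congr_ae ?_) e2)
  filter_upwards [ae_ne hn 0] with x hx using key x hx

theorem rpowKernel_ae_ne_zero {n : ℕ} (hn : 0 < n) (a : ℝ) : ∀ᵐ x, rpowKernel n a x ≠ 0 := by
  filter_upwards [ae_ne hn 0] with x hx
  rw [rpowKernel]; positivity

/-- The ground state substitution at a fixed time, with the heat form eliminated. -/
theorem groundState_fixed_time {n : ℕ} (hn : 0 < n) {f : Euc n → ℝ} (hf : Measurable f)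
    (hf1 : ∫⁻ x, ‖f x‖ₑ ≠ ∞) (hf2 : ∫⁻ x, ENNReal.ofReal (f x ^ 2) ≠ ∞) {a b t : ℝ} (hb : 0 < b)
    (hbn : b + b < (n : ℝ) / 2) (han : a < (n : ℝ) / 2) (ht : 0 < t) {u w : Euc n → ℝ}
    (hu : u = rconv (rpowKernel n b) f) (hw : w = rpowKernel n a) :
    ENNReal.ofReal (heatMix n a) * (∫⁻ p : Euc n × Euc n, ENNReal.ofReal
        ((u p.1 / w p.1 - u p.2 / w p.2) ^ 2 * (w p.1 * w p.2) * heat n t (p.1 - p.2)))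
      + 2 * ∫⁻ x, ENNReal.ofReal (u x ^ 2 / w x) * lossInt n a t x
    ≤ 2 * (ENNReal.ofReal (heatMix n a * rieszSq n b) * ∫⁻ s in Set.Ioi (0 : ℝ),
        ENNReal.ofReal (s ^ (b + b - 1)) * ENNReal.ofReal (heatForm f s - heatForm f (s + t)))
      + 2 * ∫⁻ x, ENNReal.ofReal (u x ^ 2 / w x) * gainInt n a t x := by
  have hη := heatMix_pos han
  have hum : Measurable u := by rw [hu]; fun_prop
  obtain ⟨hi, hf0, -⟩ := heatForm_riesz hn hf hf1 hf2 hb hbn ht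
  have hsq := lintegral_sq_riesz_eq_add hn hf hf1 hf2 hb hbn ht
  rw [← hu] at hi hf0 hsq
  have h1 := lintegral_groundState_heat_le (w := w) ht hum (by rw [hw]; fun_prop)
    (fun x => by rw [hw]; exact rpowKernel_nonneg x) (by rw [hw]; exact rpowKernel_ae_ne_zero hn a)
    hi hf0
  have h2 := lintegral_kconv_add_loss hn han ht hum hw
  rw [hsq] at h2
  generalize (∫⁻ p : Euc n × Euc n, ENNReal.ofReal ((u p.1 / w p.1 - u p.2 / w p.2) ^ 2 *
    (w p.1 * w p.2) * heat n t (p.1 - p.2))) = Bt at h1 ⊢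
  generalize (∫⁻ x, ENNReal.ofReal (u x ^ 2 / w x) *
    kconv (heat n t) (fun y => ENNReal.ofReal (w y)) x) = Kt at h1 h2
  generalize (∫⁻ x, ENNReal.ofReal (u x ^ 2 / w x) * lossInt n a t x) = Lo at h2 ⊢
  generalize (∫⁻ x, ENNReal.ofReal (u x ^ 2 / w x) * gainInt n a t x) = Ga at h2 ⊢
  generalize (∫⁻ s in Set.Ioi (0 : ℝ), ENNReal.ofReal (s ^ (b + b - 1)) *
    ENNReal.ofReal (heatForm f s - heatForm f (s + t))) = Et at h2 ⊢
  have hIt : 2 * (ENNReal.ofReal (heatMix n a) * ENNReal.ofReal (heatForm u t)) ≠ ∞ := by finiteness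
  rw [← ENNReal.add_le_add_iff_right hIt, ENNReal.ofReal_mul hη.le]
  calc _ = ENNReal.ofReal (heatMix n a) * (Bt + 2 * ENNReal.ofReal (heatForm u t)) + 2 * Lo := by
        ring
    _ ≤ ENNReal.ofReal (heatMix n a) * (2 * Kt) + 2 * Lo := by gcongr
    _ = 2 * (ENNReal.ofReal (heatMix n a) * Kt + Lo) := by ring
    _ = _ := by rw [h2]; ring

set_option maxHeartbeats 1000000 in
/-- The inequality between the squared `L²` norm of `f` and the weighted Besov form of the ground
state quotient of its Riesz potential, up to the explicit constants of the heat kernel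
superpositions. -/
theorem groundState_inequality_real {n : ℕ} (hn : 0 < n) {f : Euc n → ℝ} (hf : Measurable f)
    (hf1 : ∫⁻ x, ‖f x‖ₑ ≠ ∞) (hf2 : ∫⁻ x, ENNReal.ofReal (f x ^ 2) ≠ ∞) {b : ℝ} (hb : 0 < b)
    (hb1 : b + b < 1) (hbn : b + b < (n : ℝ) / 2) {u w : Euc n → ℝ}
    (hu : u = rconv (rpowKernel n b) f) (hw : w = rpowKernel n ((n : ℝ) / 4 + b)) :
    ENNReal.ofReal (heatMix n ((n : ℝ) / 4 + b) * heatMix n (-(b + b))) *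
        (∫⁻ p : Euc n × Euc n, ENNReal.ofReal ((u p.1 / w p.1 - u p.2 / w p.2) ^ 2 *
          (w p.1 * w p.2) * ‖p.1 - p.2‖ ^ (-((n : ℝ) + 4 * b))))
      + 2 * (ENNReal.ofReal (fracConst (b + b) ((n : ℝ) / 4 - b) * heatMix n ((n : ℝ) / 4 - b)) *
          ∫⁻ x, ENNReal.ofReal (‖x‖ ^ (-(4 * b)) * u x ^ 2))
      ≤ 2 * (ENNReal.ofReal (heatMix n ((n : ℝ) / 4 + b) * rieszSq n b *
          (Gamma (1 - (b + b)) / (b + b) * Gamma (b + b))) *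
          ∫⁻ x, ENNReal.ofReal (f x ^ 2)) := by
  set a := (n : ℝ) / 4 + b with ha
  set γ := b + b with hγ
  have hγ0 : 0 < γ := add_pos hb hb
  have haγ : (n : ℝ) / 4 - b = a - γ := by rw [ha, hγ]; ring
  rw [haγ]
  have han : a < (n : ℝ) / 2 := by rw [ha]; linarith
  have haγ0 : γ < a := by rw [ha, hγ]; linarith
  have hη := heatMix_pos han
  have hη2 := heatMix_pos (show a - γ < (n : ℝ) / 2 by linarith)
  have hη3 := heatMix_pos (show -γ < (n : ℝ) / 2 by linarith)
  have hum : Measurable u := by rw [hu]; fun_prop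
  have hwm : Measurable w := by rw [hw]; fun_prop
  have hw0 : ∀ x, 0 ≤ w x := fun x => by rw [hw]; exact rpowKernel_nonneg x
  have hwp : ∀ᵐ x, w x ≠ 0 := by rw [hw]; exact rpowKernel_ae_ne_zero hn _
  have hM := measurable_heatForm hf
  -- the four quantities that depend on the time `t`
  set Bt : ℝ → ℝ≥0∞ := fun t => ∫⁻ p : Euc n × Euc n, ENNReal.ofReal
    ((u p.1 / w p.1 - u p.2 / w p.2) ^ 2 * (w p.1 * w p.2) * heat n t (p.1 - p.2)) with hBt
  set Et : ℝ → ℝ≥0∞ := fun t => ∫⁻ s in Set.Ioi (0 : ℝ), ENNReal.ofReal (s ^ (γ - 1)) *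
    ENNReal.ofReal (heatForm f s - heatForm f (s + t)) with hEt
  set Lo : ℝ → Euc n → ℝ≥0∞ := lossInt n a with hLo
  set Ga : ℝ → Euc n → ℝ≥0∞ := gainInt n a with hGa
  set P : Euc n → ℝ≥0∞ := fun x => ∫⁻ s in Set.Ioi (0 : ℝ), ENNReal.ofReal (s ^ (a - γ - 1)) *
    ENNReal.ofReal (heat n s x) with hP
  set v : Euc n → ℝ≥0∞ := fun x => ENNReal.ofReal (u x ^ 2 / w x) with hv
  have hvm : Measurable v := by fun_prop
  have hLom : Measurable (Function.uncurry Lo) := measurable_lossInt n a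
  have hGam : Measurable (Function.uncurry Ga) := measurable_gainInt n a
  set c0 := rieszSq n b with hc0
  have hc0p : 0 < c0 := rieszSq_pos hb (by linarith)
  have fixed : ∀ t, 0 < t → ENNReal.ofReal (heatMix n a) * Bt t + 2 * ∫⁻ x, v x * Lo t x
      ≤ 2 * (ENNReal.ofReal (heatMix n a * c0) * Et t) + 2 * ∫⁻ x, v x * Ga t x :=
    fun t ht => groundState_fixed_time hn hf hf1 hf2 hb hbn han ht hu hw
  -- integration in time
  set S := ∫⁻ x, v x * P x with hS
  have hSeq : S = ENNReal.ofReal (heatMix n (a - γ)) *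
      ∫⁻ x, ENNReal.ofReal (‖x‖ ^ (-(4 * b)) * u x ^ 2) := by
    rw [hS, ← lintegral_const_mul' _ _ ENNReal.ofReal_ne_top]
    refine lintegral_congr_ae ?_
    filter_upwards [ae_ne hn 0, hwp] with x hx hwx
    have hx' := norm_pos_iff.2 hx
    simp only [hP, hv]
    rw [lintegral_rpow_mul_heat (by linarith) hx, ← ENNReal.ofReal_mul hη2.le,
      ← ENNReal.ofReal_mul (by have := hw0 x; positivity)]
    congr 1
    have : ‖x‖ ^ (2 * (a - γ) - n) = ‖x‖ ^ (-(4 * b)) * w x := by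
      rw [hw, rpowKernel, ← rpow_add hx']
      congr 1
      rw [hγ]; ring
    rw [this]
    field_simp
  have hSt : S ≠ ∞ := by
    rw [hSeq]
    refine ENNReal.mul_ne_top ENNReal.ofReal_ne_top ?_
    refine ne_top_of_le_ne_top ?_ ((lintegral_mono fun x => ?_).trans
      (lintegral_steinWeiss_kconv hb hbn (g := fun y => ‖f y‖ₑ) (by fun_prop)))
    · simp only [ofReal_sq_eq_enorm] at hf2
      finiteness
    · dsimp only
      rw [ENNReal.ofReal_mul (by positivity), ofReal_sq_eq_enorm]
      gcongr
      rw [hu]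
      exact enorm_rconv_le rpowKernel_nonneg x
  have swap : ∀ X : ℝ → Euc n → ℝ≥0∞, Measurable (Function.uncurry X) →
      ∫⁻ t in Set.Ioi (0 : ℝ), ENNReal.ofReal (t ^ (-γ - 1)) * ∫⁻ x, v x * X t x
        = ∫⁻ x, v x * ∫⁻ t in Set.Ioi (0 : ℝ), ENNReal.ofReal (t ^ (-γ - 1)) * X t x := by
    intro X hX
    have hXt : ∀ x, Measurable (fun t => X t x) := fun x => hX.comp measurable_prodMk_right
    simp only [Function.uncurry_def] at hX
    calc _ = ∫⁻ t in Set.Ioi (0 : ℝ), ∫⁻ x, v x * (ENNReal.ofReal (t ^ (-γ - 1)) * X t x) := by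
          refine lintegral_congr fun t => ?_
          rw [← lintegral_const_mul' _ _ ENNReal.ofReal_ne_top]
          simp only [mul_left_comm]
      _ = ∫⁻ x, ∫⁻ t in Set.Ioi (0 : ℝ), v x * (ENNReal.ofReal (t ^ (-γ - 1)) * X t x) := by
          refine lintegral_lintegral_swap (Measurable.aemeasurable ?_)
          simp only [Function.uncurry_def]
          fun_prop
      _ = _ := by
          refine lintegral_congr fun x => ?_
          rw [lintegral_const_mul']
          exact ENNReal.ofReal_ne_top
  have hLoss : ∫⁻ t in Set.Ioi (0 : ℝ), ENNReal.ofReal (t ^ (-γ - 1)) * ∫⁻ x, v x * Lo t x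
      = ENNReal.ofReal (fracConst γ (n / 2)) * S := by
    rw [swap Lo hLom, hS, ← lintegral_const_mul' _ _ ENNReal.ofReal_ne_top]
    refine lintegral_congr fun x => ?_
    have := lintegral_heatLoss hn (a := a) hγ0 hb1 x
    calc _ = v x * (ENNReal.ofReal (fracConst γ (n / 2)) * P x) := by rw [← this]; rfl
      _ = _ := by ring
  have hGain : (∫⁻ t in Set.Ioi (0 : ℝ), ENNReal.ofReal (t ^ (-γ - 1)) * ∫⁻ x, v x * Ga t x)
      + ENNReal.ofReal (fracConst γ (a - γ)) * S = ENNReal.ofReal (fracConst γ (n / 2)) * S := by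
    rw [swap Ga hGam, hS, ← lintegral_const_mul' _ _ ENNReal.ofReal_ne_top,
      ← lintegral_const_mul' _ _ ENNReal.ofReal_ne_top,
      ← lintegral_add_right _ (by fun_prop)]
    refine lintegral_congr_ae ?_
    filter_upwards [ae_ne hn 0] with x hx
    have := lintegral_heatGain hn hγ0 hb1 haγ0 (by linarith) hx
    calc _ = v x * ((∫⁻ t in Set.Ioi (0 : ℝ), ENNReal.ofReal (t ^ (-γ - 1)) * Ga t x)
          + ENNReal.ofReal (fracConst γ (a - γ)) * P x) := by ring
      _ = v x * (ENNReal.ofReal (fracConst γ (n / 2)) * P x) := by rw [← this]; rfl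
      _ = _ := by ring
  have hBesov : ∫⁻ t in Set.Ioi (0 : ℝ), ENNReal.ofReal (t ^ (-γ - 1)) * Bt t
      = ENNReal.ofReal (heatMix n (-γ)) * ∫⁻ p : Euc n × Euc n,
        ENNReal.ofReal ((u p.1 / w p.1 - u p.2 / w p.2) ^ 2 *
          (w p.1 * w p.2) * ‖p.1 - p.2‖ ^ (-((n : ℝ) + 4 * b))) := by
    have hX0 : ∀ p : Euc n × Euc n, 0 ≤ (u p.1 / w p.1 - u p.2 / w p.2) ^ 2 * (w p.1 * w p.2) :=
      fun p => mul_nonneg (sq_nonneg _) (mul_nonneg (hw0 _) (hw0 _))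
    calc _ = ∫⁻ t in Set.Ioi (0 : ℝ), ∫⁻ p : Euc n × Euc n, ENNReal.ofReal
            ((u p.1 / w p.1 - u p.2 / w p.2) ^ 2 * (w p.1 * w p.2)) *
            (ENNReal.ofReal (t ^ (-γ - 1)) * ENNReal.ofReal (heat n t (p.1 - p.2))) := by
          refine setLIntegral_congr_fun measurableSet_Ioi fun t (ht : 0 < t) => ?_
          simp only [hBt]
          rw [← lintegral_const_mul' _ _ ENNReal.ofReal_ne_top]
          refine lintegral_congr fun p => ?_
          rw [ENNReal.ofReal_mul (hX0 p), mul_left_comm]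
      _ = ∫⁻ p : Euc n × Euc n, ∫⁻ t in Set.Ioi (0 : ℝ), ENNReal.ofReal
            ((u p.1 / w p.1 - u p.2 / w p.2) ^ 2 * (w p.1 * w p.2)) *
            (ENNReal.ofReal (t ^ (-γ - 1)) * ENNReal.ofReal (heat n t (p.1 - p.2))) := by
          refine lintegral_lintegral_swap (Measurable.aemeasurable ?_)
          simp only [Function.uncurry_def]
          fun_prop
      _ = _ := by
          rw [← lintegral_const_mul' _ _ ENNReal.ofReal_ne_top]
          refine lintegral_congr fun p => ?_
          rw [lintegral_const_mul' _ _ ENNReal.ofReal_ne_top]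
          by_cases hp : p.1 = p.2
          · simp [hp]
          · rw [lintegral_rpow_mul_heat (by linarith) (sub_ne_zero.2 hp), ENNReal.ofReal_mul (hX0 p),
              ENNReal.ofReal_mul hη3.le, show 2 * -γ - (n : ℝ) = -((n : ℝ) + 4 * b) by rw [hγ]; ring]
            ring
  have hEnergy := lintegral_heatForm_energy_le hf hf2 hγ0 hb1
  have hfinal : ENNReal.ofReal (heatMix n a) *
        (∫⁻ t in Set.Ioi (0 : ℝ), ENNReal.ofReal (t ^ (-γ - 1)) * Bt t)
      + 2 * ∫⁻ t in Set.Ioi (0 : ℝ), ENNReal.ofReal (t ^ (-γ - 1)) * ∫⁻ x, v x * Lo t x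
      ≤ 2 * (ENNReal.ofReal (heatMix n a * c0) *
        ∫⁻ t in Set.Ioi (0 : ℝ), ENNReal.ofReal (t ^ (-γ - 1)) * Et t)
      + 2 * ∫⁻ t in Set.Ioi (0 : ℝ), ENNReal.ofReal (t ^ (-γ - 1)) * ∫⁻ x, v x * Ga t x := by
    have hLi : Measurable (fun t => ∫⁻ x, v x * Lo t x) :=
      Measurable.lintegral_prod_right' (f := fun p : ℝ × Euc n => v p.2 * Lo p.1 p.2)
        ((hvm.comp measurable_snd).mul hLom)
    have hGi : Measurable (fun t => ∫⁻ x, v x * Ga t x) :=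
      Measurable.lintegral_prod_right' (f := fun p : ℝ × Euc n => v p.2 * Ga p.1 p.2)
        ((hvm.comp measurable_snd).mul hGam)
    rw [← lintegral_const_mul' _ _ ENNReal.ofReal_ne_top,
      ← lintegral_const_mul' 2 _ (by simp), ← lintegral_const_mul' _ _ ENNReal.ofReal_ne_top,
      ← lintegral_const_mul' 2 _ (by simp), ← lintegral_const_mul' 2 _ (by simp),
      ← lintegral_add_right _ (by fun_prop), ← lintegral_add_right _ (by fun_prop)]
    refine setLIntegral_mono' measurableSet_Ioi fun t (ht : 0 < t) => ?_
    calc _ = ENNReal.ofReal (t ^ (-γ - 1)) * (ENNReal.ofReal (heatMix n a) * Bt t +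
          2 * ∫⁻ x, v x * Lo t x) := by ring
      _ ≤ ENNReal.ofReal (t ^ (-γ - 1)) * (2 * (ENNReal.ofReal (heatMix n a * c0) * Et t) +
          2 * ∫⁻ x, v x * Ga t x) := mul_le_mul_right (fixed t ht) _
      _ = _ := by ring
  rw [hBesov, hLoss] at hfinal
  have hcancel : 2 * (ENNReal.ofReal (fracConst γ (n / 2)) * S) ≠ ∞ := by finiteness
  have hfc := fracConst_nonneg hγ0 hb1 (show 0 < a - γ by linarith)
  -- the loss term is finite, and cancels after the gain has been expressed by it
  rw [← ENNReal.add_le_add_iff_right hcancel]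
  calc _ = ENNReal.ofReal (heatMix n a) * (ENNReal.ofReal (heatMix n (-γ)) *
          ∫⁻ p : Euc n × Euc n, ENNReal.ofReal ((u p.1 / w p.1 - u p.2 / w p.2) ^ 2 *
          (w p.1 * w p.2) * ‖p.1 - p.2‖ ^ (-((n : ℝ) + 4 * b))))
        + 2 * (ENNReal.ofReal (fracConst γ (n / 2)) * S)
        + 2 * (ENNReal.ofReal (fracConst γ (a - γ)) * S) := by
        rw [hSeq, ENNReal.ofReal_mul hη.le, ENNReal.ofReal_mul hfc]
        ring
    _ ≤ _ := add_le_add_left hfinal _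
    _ = 2 * (ENNReal.ofReal (heatMix n a * c0) *
          ∫⁻ t in Set.Ioi (0 : ℝ), ENNReal.ofReal (t ^ (-γ - 1)) * Et t)
        + 2 * ((∫⁻ t in Set.Ioi (0 : ℝ), ENNReal.ofReal (t ^ (-γ - 1)) * ∫⁻ x, v x * Ga t x)
          + ENNReal.ofReal (fracConst γ (a - γ)) * S) := by ring
    _ ≤ _ := by
        rw [hGain, ENNReal.ofReal_mul (mul_pos hη hc0p).le, mul_assoc (ENNReal.ofReal _)]
        exact add_le_add_left (mul_le_mul_right (mul_le_mul_right hEnergy _) _) _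

/-! ### Riesz potentials of complex functions -/

theorem rieszKernel_eq {n : ℕ} (α : ℝ) : rieszKernel n α = rpowKernel n (α / 4) := by
  ext x
  rw [rieszKernel, rpowKernel]
  congr 1
  ring

theorem rieszConv_eq {n : ℕ} {α : ℝ} (f : Euc n → ℂ) (x : Euc n) :
    rieszConv n α f x = ∫ y, rpowKernel n (α / 4) (x - y) • f y := by
  rw [rieszConv, convolution_eq_swap, rieszKernel_eq]
  rfl

theorem rieszConvExistsAt_iff {n : ℕ} {α : ℝ} {f : Euc n → ℂ} {x : Euc n} :
    RieszConvExistsAt n α f x ↔ Integrable (fun y => rpowKernel n (α / 4) (x - y) • f y) := by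
  rw [RieszConvExistsAt, convolutionExistsAt_iff_integrable_swap, rieszKernel_eq]
  rfl

/-- The convolution of the Riesz kernel with `|f|`, which may be infinite. -/
noncomputable def rieszAbs (n : ℕ) (α : ℝ) (f : Euc n → ℂ) (x : Euc n) : ℝ≥0∞ :=
  kconv (rpowKernel n (α / 4)) (fun y => ‖f y‖ₑ) x

theorem lintegral_enorm_riesz {n : ℕ} {α : ℝ} (f : Euc n → ℂ) (x : Euc n) :
    ∫⁻ y, ‖rpowKernel n (α / 4) (x - y) • f y‖ₑ = rieszAbs n α f x := by
  refine lintegral_congr fun y => ?_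
  rw [enorm_smul, Real.enorm_eq_ofReal (rpowKernel_nonneg _)]

theorem rieszConvExistsAt_of_ne_top {n : ℕ} {α : ℝ} {f : Euc n → ℂ} (hf : Measurable f) {x : Euc n}
    (h : rieszAbs n α f x ≠ ∞) : RieszConvExistsAt n α f x := by
  rw [rieszConvExistsAt_iff]
  refine ⟨Measurable.aestronglyMeasurable (by fun_prop), ?_⟩
  rw [hasFiniteIntegral_iff_enorm, lintegral_enorm_riesz]
  exact lt_top_iff_ne_top.2 h

theorem enorm_rieszConv_le {n : ℕ} {α : ℝ} (f : Euc n → ℂ) (x : Euc n) :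
    ‖rieszConv n α f x‖ₑ ≤ rieszAbs n α f x := by
  rw [rieszConv_eq, ← lintegral_enorm_riesz]
  exact enorm_integral_le_lintegral_enorm _

theorem measurable_rieszConv {n : ℕ} {α : ℝ} {f : Euc n → ℂ} (hf : Measurable f) :
    Measurable (rieszConv n α f) := by
  have h : StronglyMeasurable (fun p : Euc n × Euc n => rpowKernel n (α / 4) (p.1 - p.2) • f p.2) :=
    Measurable.stronglyMeasurable (by fun_prop)
  have := (h.integral_prod_right' (ν := volume)).measurable
  convert! this using 1
  ext x
  exact rieszConv_eq f x

theorem ofReal_norm_sq {E : Type*} [SeminormedAddGroup E] (z : E) :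
    ENNReal.ofReal (‖z‖ ^ 2) = ‖z‖ₑ ^ 2 := by
  rw [ENNReal.ofReal_pow (norm_nonneg _), ofReal_norm]

theorem sqNormL2_eq {n : ℕ} (f : Euc n → ℂ) : sqNormL2 n f = ∫⁻ x, ‖f x‖ₑ ^ 2 :=
  lintegral_congr fun _ => ofReal_norm_sq _

theorem sqNormL2_ne_top {n : ℕ} {f : Euc n → ℂ} (hf : MemLp f 2 volume) : sqNormL2 n f ≠ ∞ := by
  have h := hf.eLpNorm_lt_top
  rw [eLpNorm_lt_top_iff_lintegral_rpow_enorm_lt_top (by norm_num) (by norm_num)] at h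
  rw [sqNormL2_eq]
  simpa using h.ne

theorem steinWeissForm_eq {n : ℕ} {α : ℝ} (f : Euc n → ℂ) : steinWeissForm n α f
    = ∫⁻ x, ENNReal.ofReal (‖x‖ ^ (-α)) * ‖rieszConv n α f x‖ₑ ^ 2 := by
  refine lintegral_congr fun x => ?_
  rw [ENNReal.ofReal_mul (by positivity), ofReal_norm_sq]

/-- The Stein–Weiss inequality for `|f|`. -/
theorem lintegral_rieszAbs_le {n : ℕ} {α : ℝ} (hα : 0 < α) (hαn : α < n) {f : Euc n → ℂ}
    (hf : Measurable f) :
    ∫⁻ x, ENNReal.ofReal (‖x‖ ^ (-α)) * rieszAbs n α f x ^ 2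
      ≤ ENNReal.ofReal (pittC n α / rieszD n α) * sqNormL2 n f := by
  have h := lintegral_steinWeiss_kconv (n := n) (b := α / 4) (by linarith) (by linarith)
    (g := fun y => ‖f y‖ₑ) (by fun_prop)
  rw [show 4 * (α / 4) = α by ring, ← ENNReal.ofReal_pow, ← pittC_div_rieszD hα hαn,
    ← sqNormL2_eq] at h
  · exact h
  · exact rieszComp_nonneg (by linarith) (by linarith) (by linarith)

theorem steinWeissForm_le {n : ℕ} {α : ℝ} (hα : 0 < α) (hαn : α < n) {f : Euc n → ℂ}
    (hf : Measurable f) :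
    steinWeissForm n α f ≤ ENNReal.ofReal (pittC n α / rieszD n α) * sqNormL2 n f := by
  refine le_trans ?_ (lintegral_rieszAbs_le hα hαn hf)
  rw [steinWeissForm_eq]
  gcongr
  exact enorm_rieszConv_le f x

theorem ae_rieszAbs_ne_top {n : ℕ} {α : ℝ} (hα : 0 < α) (hαn : α < n) {f : Euc n → ℂ}
    (hf : Measurable f) (hf2 : MemLp f 2 volume) : ∀ᵐ x, rieszAbs n α f x ≠ ∞ := by
  have hn : 0 < n := by
    have : (0 : ℝ) < n := hα.trans hαn
    exact_mod_cast this
  have hm : Measurable (rieszAbs n α f) := by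
    unfold rieszAbs kconv
    refine Measurable.lintegral_prod_right' (f := fun p : Euc n × Euc n =>
      ENNReal.ofReal (rpowKernel n (α / 4) (p.1 - p.2)) * ‖f p.2‖ₑ) ?_
    fun_prop
  have h := ae_lt_top (f := fun x => ENNReal.ofReal (‖x‖ ^ (-α)) * rieszAbs n α f x ^ 2)
    (by fun_prop) (ne_top_of_le_ne_top (ENNReal.mul_ne_top ENNReal.ofReal_ne_top
      (sqNormL2_ne_top hf2)) (lintegral_rieszAbs_le hα hαn hf))
  filter_upwards [h, ae_ne hn 0] with x hx hx0 htop
  have : ENNReal.ofReal (‖x‖ ^ (-α)) ≠ 0 := by simp; positivity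
  rw [htop] at hx
  simp [ENNReal.mul_top this] at hx

theorem ae_rieszConvExistsAt {n : ℕ} {α : ℝ} (hα : 0 < α) (hαn : α < n) {f : Euc n → ℂ}
    (hf : Measurable f) (hf2 : MemLp f 2 volume) : ∀ᵐ x, RieszConvExistsAt n α f x := by
  filter_upwards [ae_rieszAbs_ne_top hα hαn hf hf2] with x hx
  exact rieszConvExistsAt_of_ne_top hf hx

/-! ### Comparison of the Stein–Weiss forms of two orders -/

/-- The Riesz potential of order `α` is, up to a constant, a Riesz potential of the one of
order `β`. -/
theorem rieszComp_mul_enorm_rieszConv_le {n : ℕ} {α β : ℝ} (hβ : 0 < β) (hβα : β < α) (hαn : α < n)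
    {f : Euc n → ℂ} (hf : Measurable f) (hf2 : MemLp f 2 volume) : ∀ᵐ x,
      ENNReal.ofReal (rieszComp n (β / 4) ((α - β) / 4)) * ‖rieszConv n α f x‖ₑ
        ≤ ∫⁻ y, ENNReal.ofReal (‖x - y‖ ^ (2 * ((α - β) / 4) - n)) * ‖rieszConv n β f y‖ₑ := by
  have hn : 0 < n := by
    have : (0 : ℝ) < n := (hβ.trans hβα).trans hαn
    exact_mod_cast this
  have hc := rieszComp_nonneg (n := n) (a := β / 4) (b := (α - β) / 4) (by linarith) (by linarith)
    (by linarith)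
  filter_upwards [ae_rieszAbs_ne_top (hβ.trans hβα) hαn hf hf2] with x hx
  obtain ⟨-, he⟩ := integral_kernel_swap_smul (μ := (volume : Measure (Euc n)))
    (ν := (volume : Measure (Euc n)))
    (G := fun y z => rpowKernel n ((α - β) / 4) (x - y) * rpowKernel n (β / 4) (y - z))
    (F := f) (Q := fun z => ENNReal.ofReal (rieszComp n (β / 4) ((α - β) / 4) *
      rpowKernel n (α / 4) (x - z)))
    (by simp only [Function.uncurry_def]; fun_prop)
    (Filter.Eventually.of_forall fun z => Filter.Eventually.of_forall fun y =>
      mul_nonneg (rpowKernel_nonneg _) (rpowKernel_nonneg _))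
    hf.stronglyMeasurable (by
      filter_upwards [ae_ne hn x] with z hz
      have h := lintegral_riesz_mul_riesz (n := n) (a := β / 4) (b := (α - β) / 4) (by linarith)
        (by linarith) (by linarith) (sub_ne_zero.2 hz.symm)
      rw [show β / 4 + (α - β) / 4 = α / 4 by ring] at h
      rw [rpowKernel, ← h, ← lintegral_sub_right_eq_self (fun y => ENNReal.ofReal
        (‖x - z - y‖ ^ (2 * ((α - β) / 4) - n)) * ENNReal.ofReal (‖y‖ ^ (2 * (β / 4) - n))) z]
      refine lintegral_congr fun y => ?_
      rw [ENNReal.ofReal_mul (rpowKernel_nonneg _), rpowKernel, rpowKernel, sub_sub_sub_cancel_right])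
    (by
      have : ∫⁻ z, ENNReal.ofReal (rieszComp n (β / 4) ((α - β) / 4) * rpowKernel n (α / 4) (x - z)) *
          ‖f z‖ₑ = ENNReal.ofReal (rieszComp n (β / 4) ((α - β) / 4)) * rieszAbs n α f x := by
        rw [rieszAbs, kconv, ← lintegral_const_mul' _ _ ENNReal.ofReal_ne_top]
        refine lintegral_congr fun z => ?_
        rw [ENNReal.ofReal_mul hc, mul_assoc]
      rw [this]
      exact ENNReal.mul_ne_top ENNReal.ofReal_ne_top hx)
  have h1 : ∫ z, (ENNReal.ofReal (rieszComp n (β / 4) ((α - β) / 4) *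
      rpowKernel n (α / 4) (x - z))).toReal • f z
      = rieszComp n (β / 4) ((α - β) / 4) • rieszConv n α f x := by
    rw [rieszConv_eq, ← integral_smul]
    refine integral_congr_ae (Filter.Eventually.of_forall fun z => ?_)
    dsimp only
    rw [ENNReal.toReal_ofReal (mul_nonneg hc (rpowKernel_nonneg _)), mul_smul]
  have h2 : ∀ y, ∫ z, (rpowKernel n ((α - β) / 4) (x - y) * rpowKernel n (β / 4) (y - z)) • f z
      = rpowKernel n ((α - β) / 4) (x - y) • rieszConv n β f y := by
    intro y
    rw [rieszConv_eq, ← integral_smul]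
    simp only [mul_smul]
  rw [h1] at he
  simp only [h2] at he
  have h3 : ENNReal.ofReal (rieszComp n (β / 4) ((α - β) / 4)) * ‖rieszConv n α f x‖ₑ
      = ‖rieszComp n (β / 4) ((α - β) / 4) • rieszConv n α f x‖ₑ := by
    rw [enorm_smul, Real.enorm_eq_ofReal hc]
  rw [h3, ← he]
  refine (enorm_integral_le_lintegral_enorm _).trans (le_of_eq ?_)
  refine lintegral_congr fun y => ?_
  rw [enorm_smul, Real.enorm_eq_ofReal (rpowKernel_nonneg _), rpowKernel]

/-- The normalized Stein–Weiss form decreases with the order. -/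
theorem steinWeissForm_anti {n : ℕ} {α β : ℝ} (hβ : 0 < β) (hβα : β ≤ α) (hαn : α < n)
    {f : Euc n → ℂ} (hf : Measurable f) (hf2 : MemLp f 2 volume) :
    ENNReal.ofReal (rieszD n α / pittC n α) * steinWeissForm n α f
      ≤ ENNReal.ofReal (rieszD n β / pittC n β) * steinWeissForm n β f := by
  rcases hβα.eq_or_lt with rfl | hlt
  · exact le_rfl
  have hc := rieszComp_pos (n := n) (a := β / 4) (b := (α - β) / 4) (by linarith) (by linarith)
    (by linarith)
  have hdα := rieszD_pos (hβ.trans hlt) hαn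
  have hcα := pittC_pos (hβ.trans hlt) hαn
  have hdβ := rieszD_pos hβ (hlt.trans hαn)
  have hcβ := pittC_pos hβ (hlt.trans hαn)
  have hum := measurable_rieszConv (n := n) (α := β) hf
  have h := lintegral_steinWeiss (n := n) (e := β / 2) (b := (α - β) / 4) (by linarith) (by linarith)
    (by linarith) (g := fun y => ‖rieszConv n β f y‖ₑ) (by fun_prop)
  have h1 : ENNReal.ofReal (rieszComp n (β / 4) ((α - β) / 4) ^ 2) * steinWeissForm n α f
      ≤ ENNReal.ofReal (rieszComp n ((β / 2 + (n : ℝ) / 2) / 2) ((α - β) / 4) ^ 2) *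
        steinWeissForm n β f := by
    rw [ENNReal.ofReal_pow hc.le, ENNReal.ofReal_pow (rieszComp_nonneg (by linarith) (by linarith)
      (by linarith)), steinWeissForm_eq, steinWeissForm_eq,
      ← lintegral_const_mul' _ _ (by finiteness)]
    refine le_trans ?_ (h.trans (le_of_eq ?_))
    · refine lintegral_mono_ae ?_
      filter_upwards [rieszComp_mul_enorm_rieszConv_le hβ hlt hαn hf hf2] with x hx
      calc _ = (ENNReal.ofReal (‖x‖ ^ (-(β / 2 + 2 * ((α - β) / 4)))) *
            (ENNReal.ofReal (rieszComp n (β / 4) ((α - β) / 4)) * ‖rieszConv n α f x‖ₑ)) ^ 2 := by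
            have : ENNReal.ofReal (‖x‖ ^ (-α))
                = ENNReal.ofReal (‖x‖ ^ (-(β / 2 + 2 * ((α - β) / 4)))) ^ 2 := by
              rw [← ENNReal.ofReal_pow (by positivity), ← rpow_natCast, ← rpow_mul (norm_nonneg _)]
              congr 2
              push_cast; ring
            rw [this]
            ring
        _ ≤ _ := by gcongr
    · congr 1
      refine lintegral_congr fun y => ?_
      rw [mul_pow, ← ENNReal.ofReal_pow (by positivity), ← rpow_natCast, ← rpow_mul (norm_nonneg _)]
      congr 3
      push_cast; ring
  have hR := rieszComp_sq_mul hβ hlt hαn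
  set R := rieszComp n (β / 4) ((α - β) / 4) ^ 2 with hRdef
  have hR0 : 0 < R := by positivity
  have e1 : rieszD n α / pittC n α = (rieszD n α / pittC n α / R) * R := by field_simp
  have e2 : (rieszD n α / pittC n α / R) * rieszComp n ((β / 2 + (n : ℝ) / 2) / 2) ((α - β) / 4) ^ 2
      = rieszD n β / pittC n β := by
    field_simp at hR ⊢
    linarith
  rw [e1, ← e2, ENNReal.ofReal_mul (by positivity), ENNReal.ofReal_mul (by positivity), mul_assoc,
    mul_assoc]
  exact mul_le_mul_right h1 _

/-! ### The error estimate for the order `β` -/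

/-- The ratio of the constants at the Stein–Weiss form and at `‖f‖²` in
`groundState_inequality_real` is `d_β / C_β`. -/
theorem heatMix_fracConst_eq {n : ℕ} {β : ℝ} (hβ : 0 < β) (hβn : β < n) :
    fracConst (β / 2) ((n : ℝ) / 4 - β / 4) * heatMix n ((n : ℝ) / 4 - β / 4)
      = heatMix n ((n : ℝ) / 4 + β / 4) * rieszSq n (β / 4) *
          (Gamma (1 - β / 2) / (β / 2) * Gamma (β / 2)) * (rieszD n β / pittC n β) := by
  unfold fracConst heatMix rieszSq rieszD pittC heatMix
  rw [show (n : ℝ) / 4 - β / 4 + β / 2 = (n + β) / 4 by ring,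
    show (n : ℝ) / 4 - β / 4 = (n - β) / 4 by ring,
    show (n : ℝ) / 4 + β / 4 = (n + β) / 4 by ring,
    show (n : ℝ) / 2 - (n - β) / 4 = (n + β) / 4 by ring,
    show (n : ℝ) / 2 - (n + β) / 4 = (n - β) / 4 by ring,
    show (n : ℝ) / 2 - β / 4 = (2 * n - β) / 4 by ring,
    show β / 4 + β / 4 = β / 2 by ring]
  have h2 : 0 < Gamma ((2 * (n : ℝ) - β) / 4) := Gamma_pos_of_pos (by linarith)
  have h3 : 0 < Gamma (β / 4) := Gamma_pos_of_pos (by linarith)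
  have h5 : 0 < Gamma (β / 2) := Gamma_pos_of_pos (by linarith)
  have p1 : π ^ (-((n : ℝ) - β)) = (π ^ (-(n : ℝ) / 2)) ^ 2 * π ^ β := by
    rw [← rpow_natCast, ← rpow_mul pi_pos.le, ← rpow_add pi_pos]; congr 1; push_cast; ring
  have p2 : (4 : ℝ) ^ (-((n - β) / 4)) = 4 ^ (-((n + β) / 4)) * (4 ^ (β / 4)) ^ 2 := by
    rw [← rpow_natCast, ← rpow_mul (by norm_num), ← rpow_add (by norm_num)]; congr 1; push_cast; ring
  have p3 : (4 : ℝ) ^ (-(β / 4)) = (4 ^ (β / 4))⁻¹ := rpow_neg (by norm_num) _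
  rw [p1, p2, p3]
  have q4 : 0 < π ^ β := by positivity
  generalize Gamma (((n : ℝ) + β) / 4) = x1 at *
  generalize Gamma ((2 * (n : ℝ) - β) / 4) = x2 at *
  generalize Gamma (β / 4) = x3 at *
  generalize Gamma (((n : ℝ) - β) / 4) = x4 at *
  generalize Gamma (β / 2) = x5 at *
  generalize Gamma (1 - β / 2) = x6 at *
  generalize (4 : ℝ) ^ (β / 4) = y1 at *
  generalize (4 : ℝ) ^ (-((n + β) / 4)) = y2 at *
  generalize π ^ (-(n : ℝ) / 2) = y3 at *
  generalize π ^ β = y4 at *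
  field_simp

/-- The ratio of the constants at the Besov form and at `‖f‖²` in
`groundState_inequality_real` is `d_β / D_β`. -/
theorem heatMix_mul_heatMix_eq {n : ℕ} {β : ℝ} (hβ : 0 < β) (hβ2 : β < 2) (hβn : β < n) :
    heatMix n ((n : ℝ) / 4 + β / 4) * heatMix n (-(β / 2))
      = 2 * (heatMix n ((n : ℝ) / 4 + β / 4) * rieszSq n (β / 4) *
          (Gamma (1 - β / 2) / (β / 2) * Gamma (β / 2))) * (rieszD n β / besovD n β) := by
  unfold rieszSq rieszD besovD
  generalize heatMix n ((n : ℝ) / 4 + β / 4) = H at *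
  unfold heatMix
  rw [show (n : ℝ) / 2 - -(β / 2) = (n + β) / 2 by ring,
    show (n : ℝ) / 2 - β / 4 = (2 * n - β) / 4 by ring,
    show β / 4 + β / 4 = β / 2 by ring]
  have h2 : 0 < Gamma ((2 * (n : ℝ) - β) / 4) := Gamma_pos_of_pos (by linarith)
  have h3 : 0 < Gamma (β / 4) := Gamma_pos_of_pos (by linarith)
  have h5 : 0 < Gamma (β / 2) := Gamma_pos_of_pos (by linarith)
  have h6 : 0 < Gamma (1 - β / 2) := Gamma_pos_of_pos (by linarith)
  have p1 : π ^ (-((n : ℝ) - β)) = (π ^ (-(n : ℝ) / 2)) ^ 2 * π ^ β := by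
    rw [← rpow_natCast, ← rpow_mul pi_pos.le, ← rpow_add pi_pos]; congr 1; push_cast; ring
  have p2 : π ^ ((n : ℝ) / 2 + β) = (π ^ (-(n : ℝ) / 2))⁻¹ * π ^ β := by
    rw [← rpow_neg pi_pos.le, ← rpow_add pi_pos]; congr 1; ring
  have p3 : (4 : ℝ) ^ (- -(β / 2)) = (4 ^ (β / 4)) ^ 2 := by
    rw [← rpow_natCast, ← rpow_mul (by norm_num)]; congr 1; push_cast; ring
  have p4 : (4 : ℝ) ^ (-(β / 4)) = (4 ^ (β / 4))⁻¹ := rpow_neg (by norm_num) _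
  rw [p1, p2, p3, p4]
  have q4 : 0 < π ^ β := by positivity
  generalize Gamma (((n : ℝ) + β) / 2) = x1 at *
  generalize Gamma ((2 * (n : ℝ) - β) / 4) = x2 at *
  generalize Gamma (β / 4) = x3 at *
  generalize Gamma (β / 2) = x5 at *
  generalize Gamma (1 - β / 2) = x6 at *
  generalize (4 : ℝ) ^ (β / 4) = y1 at *
  generalize π ^ (-(n : ℝ) / 2) = y3 at *
  generalize π ^ β = y4 at *
  field_simp
  norm_num

/-- The error estimate for a real function in `L¹ ∩ L²`, with the sharp constants. -/
theorem error_estimate_real {n : ℕ} {β : ℝ} (hβ : 0 < β) (hβ2 : β < 2) (hβn : β < n)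
    {f : Euc n → ℝ} (hf : Measurable f)
    (hf1 : ∫⁻ x, ‖f x‖ₑ ≠ ∞) (hf2 : ∫⁻ x, ENNReal.ofReal (f x ^ 2) ≠ ∞) {u w : Euc n → ℝ}
    (hu : u = rconv (rpowKernel n (β / 4)) f) (hw : w = rpowKernel n ((n : ℝ) / 4 + β / 4)) :
    ENNReal.ofReal (rieszD n β / pittC n β) * (∫⁻ x, ENNReal.ofReal (‖x‖ ^ (-β) * u x ^ 2))
      + ENNReal.ofReal (rieszD n β / besovD n β) *
        (∫⁻ p : Euc n × Euc n, ENNReal.ofReal ((u p.1 / w p.1 - u p.2 / w p.2) ^ 2 *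
          (w p.1 * w p.2) * ‖p.1 - p.2‖ ^ (-((n : ℝ) + β))))
      ≤ ∫⁻ x, ENNReal.ofReal (f x ^ 2) := by
  have hn : 0 < n := by
    have : (0 : ℝ) < n := hβ.trans hβn
    exact_mod_cast this
  have h := groundState_inequality_real hn hf hf1 hf2 (b := β / 4) (by linarith) (by linarith)
    (by linarith) hu hw
  rw [show β / 4 + β / 4 = β / 2 by ring, show 4 * (β / 4) = β by ring,
    heatMix_fracConst_eq hβ hβn, heatMix_mul_heatMix_eq hβ hβ2 hβn] at h
  have hE : 0 < heatMix n ((n : ℝ) / 4 + β / 4) * rieszSq n (β / 4) *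
          (Gamma (1 - β / 2) / (β / 2) * Gamma (β / 2)) := by
    have h1 := heatMix_pos (n := n) (b := (n : ℝ) / 4 + β / 4) (by linarith)
    have h2 := rieszSq_pos (n := n) (b := β / 4) (by linarith) (by linarith)
    have h6 : 0 < Gamma (1 - β / 2) := Gamma_pos_of_pos (by linarith)
    positivity
  set E := heatMix n ((n : ℝ) / 4 + β / 4) * rieszSq n (β / 4) *
          (Gamma (1 - β / 2) / (β / 2) * Gamma (β / 2)) with hEdef
  have hE0 : 2 * ENNReal.ofReal E ≠ 0 := by simpa using hE
  have hEt : 2 * ENNReal.ofReal E ≠ ∞ := by finiteness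
  rw [← ENNReal.mul_le_mul_iff_right hE0 hEt]
  refine le_trans (le_of_eq ?_) (h.trans (le_of_eq (by ring)))
  rw [ENNReal.ofReal_mul (p := 2 * E) (by positivity), ENNReal.ofReal_mul (p := 2) (by norm_num),
    ENNReal.ofReal_mul (p := E) hE.le, ENNReal.ofReal_ofNat]
  ring

theorem rieszConv_re {n : ℕ} {α : ℝ} {f : Euc n → ℂ} {x : Euc n} (h : RieszConvExistsAt n α f x) :
    (rieszConv n α f x).re = rconv (rpowKernel n (α / 4)) (fun y => (f y).re) x := by
  rw [rieszConvExistsAt_iff] at h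
  rw [rieszConv_eq, ← Complex.reCLM_apply, ← Complex.reCLM.integral_comp_comm h, rconv]
  simp

theorem rieszConv_im {n : ℕ} {α : ℝ} {f : Euc n → ℂ} {x : Euc n} (h : RieszConvExistsAt n α f x) :
    (rieszConv n α f x).im = rconv (rpowKernel n (α / 4)) (fun y => (f y).im) x := by
  rw [rieszConvExistsAt_iff] at h
  rw [rieszConv_eq, ← Complex.imCLM_apply, ← Complex.imCLM.integral_comp_comm h, rconv]
  simp

theorem norm_sq_eq_re_add_im (z : ℂ) : ‖z‖ ^ 2 = z.re ^ 2 + z.im ^ 2 := by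
  rw [Complex.sq_norm, Complex.normSq_apply]; ring

/-- The error estimate for a complex function in `L¹ ∩ L²`. -/
theorem error_estimate_of_integrable {n : ℕ} {β : ℝ} (hβ : 0 < β) (hβ2 : β < 2) (hβn : β < n)
    {f : Euc n → ℂ} (hf : Measurable f) (hf1 : ∫⁻ x, ‖f x‖ₑ ≠ ∞) (hf2 : MemLp f 2 volume) :
    ENNReal.ofReal (rieszD n β / pittC n β) * steinWeissForm n β f
      + ENNReal.ofReal (rieszD n β / besovD n β) *
          weightedBesovForm n β (groundStateQuotient n β f)
      ≤ sqNormL2 n f := by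
  have hn : 0 < n := by
    have : (0 : ℝ) < n := hβ.trans hβn
    exact_mod_cast this
  have hN := sqNormL2_ne_top hf2
  have hsum : sqNormL2 n f = (∫⁻ x, ENNReal.ofReal ((f x).re ^ 2))
      + ∫⁻ x, ENNReal.ofReal ((f x).im ^ 2) := by
    rw [← lintegral_add_left (by fun_prop), sqNormL2]
    refine lintegral_congr fun x => ?_
    rw [norm_sq_eq_re_add_im, ENNReal.ofReal_add (sq_nonneg _) (sq_nonneg _)]
  rw [hsum] at hN
  obtain ⟨hN1, hN2⟩ := ENNReal.add_ne_top.1 hN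
  have hre1 : ∫⁻ x, ‖(f x).re‖ₑ ≠ ∞ := by
    refine ne_top_of_le_ne_top hf1 (lintegral_mono fun x => ?_)
    rw [← ofReal_norm, ← ofReal_norm (f x)]
    exact ENNReal.ofReal_le_ofReal (Complex.abs_re_le_norm _)
  have him1 : ∫⁻ x, ‖(f x).im‖ₑ ≠ ∞ := by
    refine ne_top_of_le_ne_top hf1 (lintegral_mono fun x => ?_)
    rw [← ofReal_norm, ← ofReal_norm (f x)]
    exact ENNReal.ofReal_le_ofReal (Complex.abs_im_le_norm _)
  set w := rpowKernel n ((n : ℝ) / 4 + β / 4) with hw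
  set u := rconv (rpowKernel n (β / 4)) (fun y => (f y).re) with hu
  set v := rconv (rpowKernel n (β / 4)) (fun y => (f y).im) with hv
  have hfr : Measurable fun y => (f y).re := by fun_prop
  have hfi : Measurable fun y => (f y).im := by fun_prop
  have hw0 : ∀ x, 0 ≤ w x := fun x => rpowKernel_nonneg x
  have hr := error_estimate_real hβ hβ2 hβn hfr hre1 hN1 hu hw
  have hi := error_estimate_real hβ hβ2 hβn hfi him1 hN2 hv hw
  have hex := ae_rieszConvExistsAt hβ hβn hf hf2
  have hSW : steinWeissForm n β f = (∫⁻ x, ENNReal.ofReal (‖x‖ ^ (-β) * u x ^ 2))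
      + ∫⁻ x, ENNReal.ofReal (‖x‖ ^ (-β) * v x ^ 2) := by
    rw [← lintegral_add_left (by fun_prop), steinWeissForm]
    refine lintegral_congr_ae ?_
    filter_upwards [hex] with x hx
    rw [norm_sq_eq_re_add_im, rieszConv_re hx, rieszConv_im hx, mul_add,
      ENNReal.ofReal_add (by positivity) (by positivity)]
  have hquot : ∀ x, RieszConvExistsAt n β f x → x ≠ 0 →
      (groundStateQuotient n β f x).re = u x / w x ∧
      (groundStateQuotient n β f x).im = v x / w x := by
    intro x hx hx0
    have hx' := norm_pos_iff.2 hx0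
    have hwx : ‖x‖ ^ (((n : ℝ) - β) / 2) = (w x)⁻¹ := by
      rw [hw, rpowKernel, ← rpow_neg hx'.le]; congr 1; ring
    rw [groundStateQuotient, Complex.re_ofReal_mul, Complex.im_ofReal_mul, rieszConv_re hx,
      rieszConv_im hx, hwx]
    constructor <;> rw [mul_comm, ← div_eq_mul_inv]
  have hB : weightedBesovForm n β (groundStateQuotient n β f)
      = (∫⁻ p : Euc n × Euc n, ENNReal.ofReal ((u p.1 / w p.1 - u p.2 / w p.2) ^ 2 *
          (w p.1 * w p.2) * ‖p.1 - p.2‖ ^ (-((n : ℝ) + β))))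
        + ∫⁻ p : Euc n × Euc n, ENNReal.ofReal ((v p.1 / w p.1 - v p.2 / w p.2) ^ 2 *
          (w p.1 * w p.2) * ‖p.1 - p.2‖ ^ (-((n : ℝ) + β))) := by
    rw [← lintegral_add_left (by fun_prop), weightedBesovForm]
    refine lintegral_congr_ae ?_
    filter_upwards [Measure.quasiMeasurePreserving_fst.ae (hex.and (ae_ne hn 0)),
      Measure.quasiMeasurePreserving_snd.ae (hex.and (ae_ne hn 0))] with p h1 h2
    obtain ⟨a1, b1⟩ := hquot p.1 h1.1 h1.2
    obtain ⟨a2, b2⟩ := hquot p.2 h2.1 h2.2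
    have hp1 := hw0 p.1
    have hp2 := hw0 p.2
    rw [norm_sq_eq_re_add_im, Complex.sub_re, Complex.sub_im, a1, a2, b1, b2,
      ← ENNReal.ofReal_add (by positivity) (by positivity)]
    congr 1
    have e : ∀ x : Euc n, ‖x‖ ^ (-((n : ℝ) - β) / 2) = w x := by
      intro x; rw [hw, rpowKernel]; congr 1; ring
    rw [e, e, rpow_neg (norm_nonneg _)]
    ring
  rw [hSW, hB, hsum]
  refine le_trans (le_of_eq ?_) (add_le_add hr hi)
  ring

/-! ### Extension to `L²` -/

/-- Two applications of Fatou's lemma to a sum of integrals. -/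
theorem lintegral_add_lintegral_le_of_tendsto {X Y : Type*} [MeasurableSpace X] [MeasurableSpace Y]
    {μ : Measure X} {ν : Measure Y} {F : ℕ → X → ℝ≥0∞} {G : ℕ → Y → ℝ≥0∞} {F' : X → ℝ≥0∞}
    {G' : Y → ℝ≥0∞} (hF : ∀ k, Measurable (F k)) (hG : ∀ k, Measurable (G k))
    (hF' : ∀ᵐ x ∂μ, Filter.Tendsto (fun k => F k x) Filter.atTop (nhds (F' x)))
    (hG' : ∀ᵐ y ∂ν, Filter.Tendsto (fun k => G k y) Filter.atTop (nhds (G' y)))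
    {a b N : ℝ≥0∞} (h : ∀ k, a * (∫⁻ x, F k x ∂μ) + b * (∫⁻ y, G k y ∂ν) ≤ N) :
    a * (∫⁻ x, F' x ∂μ) + b * (∫⁻ y, G' y ∂ν) ≤ N := by
  have e1 : ∫⁻ x, F' x ∂μ ≤ ⨆ m : ℕ, ⨅ i ≥ m, ∫⁻ x, F i x ∂μ := by
    rw [← Filter.liminf_eq_iSup_iInf_of_nat]
    refine le_trans (le_of_eq (lintegral_congr_ae ?_)) (lintegral_liminf_le hF)
    filter_upwards [hF'] with x hx using hx.liminf_eq.symm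
  have e2 : ∫⁻ y, G' y ∂ν ≤ ⨆ m : ℕ, ⨅ i ≥ m, ∫⁻ y, G i y ∂ν := by
    rw [← Filter.liminf_eq_iSup_iInf_of_nat]
    refine le_trans (le_of_eq (lintegral_congr_ae ?_)) (lintegral_liminf_le hG)
    filter_upwards [hG'] with x hx using hx.liminf_eq.symm
  refine (add_le_add (mul_le_mul_right e1 a) (mul_le_mul_right e2 b)).trans ?_
  rw [ENNReal.mul_iSup, ENNReal.mul_iSup, ENNReal.iSup_add_iSup_of_monotone]
  · refine iSup_le fun m => le_trans ?_ (h m)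
    gcongr
    · exact iInf₂_le m le_rfl
    · exact iInf₂_le m le_rfl
  · intro i j hij
    exact mul_le_mul_right (le_iInf₂ fun k hk => iInf₂_le k (hij.trans hk)) _
  · intro i j hij
    exact mul_le_mul_right (le_iInf₂ fun k hk => iInf₂_le k (hij.trans hk)) _

theorem measurable_groundStateQuotient {n : ℕ} {β : ℝ} {f : Euc n → ℂ} (hf : Measurable f) :
    Measurable (groundStateQuotient n β f) := by
  have := measurable_rieszConv (n := n) (α := β) hf
  unfold groundStateQuotient
  fun_prop

theorem eventually_indicator_closedBall_eq {n : ℕ} (f : Euc n → ℂ) (x : Euc n) :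
    ∀ᶠ k : ℕ in Filter.atTop, (Metric.closedBall 0 (k : ℝ)).indicator f x = f x := by
  filter_upwards [Filter.eventually_ge_atTop ⌈‖x‖⌉₊] with k hk
  refine Set.indicator_of_mem ?_ f
  rw [mem_closedBall_zero_iff]
  exact (Nat.le_ceil _).trans (by exact_mod_cast hk)

theorem tendsto_rieszConv_indicator_closedBall {n : ℕ} {α : ℝ} {f : Euc n → ℂ} (hf : Measurable f)
    {x : Euc n} (hx : RieszConvExistsAt n α f x) : Filter.Tendsto
      (fun k : ℕ => rieszConv n α ((Metric.closedBall 0 (k : ℝ)).indicator f) x)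
      Filter.atTop (nhds (rieszConv n α f x)) := by
  rw [rieszConvExistsAt_iff] at hx
  simp only [rieszConv_eq]
  refine tendsto_integral_of_dominated_convergence _ (fun k => ?_) hx.norm (fun k => ?_) ?_
  · have := hf.indicator (measurableSet_closedBall (x := (0 : Euc n)) (ε := (k : ℝ)))
    exact Measurable.aestronglyMeasurable (by fun_prop)
  · refine Filter.Eventually.of_forall fun y => ?_
    rw [norm_smul, norm_smul]
    exact mul_le_mul_of_nonneg_left (norm_indicator_le_norm_self f y) (norm_nonneg _)
  · refine Filter.Eventually.of_forall fun y => ?_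
    refine tendsto_const_nhds.congr' ?_
    filter_upwards [eventually_indicator_closedBall_eq f y] with k hk
    rw [hk]

theorem lintegral_enorm_indicator_closedBall_ne_top {n : ℕ} {f : Euc n → ℂ}
    (hf2 : MemLp f 2 volume) (r : ℝ) :
    ∫⁻ x, ‖(Metric.closedBall 0 r).indicator f x‖ₑ ≠ ∞ := by
  have : IsFiniteMeasure ((volume : Measure (Euc n)).restrict (Metric.closedBall 0 r)) :=
    ⟨by rw [Measure.restrict_apply_univ]; exact measure_closedBall_lt_top⟩
  have h := (hf2.restrict (Metric.closedBall 0 r)).integrable one_le_two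
  simp only [enorm_indicator_eq_indicator_enorm]
  rw [lintegral_indicator measurableSet_closedBall]
  exact h.2.ne

theorem sqNormL2_indicator_le {n : ℕ} (f : Euc n → ℂ) (s : Set (Euc n)) :
    sqNormL2 n (s.indicator f) ≤ sqNormL2 n f := by
  refine lintegral_mono fun x => ENNReal.ofReal_le_ofReal ?_
  have := norm_indicator_le_norm_self f (s := s) x
  gcongr

theorem measurable_steinWeiss_integrand {n : ℕ} {α : ℝ} {u : Euc n → ℂ} (hu : Measurable u) :
    Measurable (fun x => ENNReal.ofReal (‖x‖ ^ (-α) * ‖u x‖ ^ 2)) := by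
  fun_prop

theorem measurable_weightedBesov_integrand {n : ℕ} {β : ℝ} {h : Euc n → ℂ} (hh : Measurable h) :
    Measurable (fun p : Euc n × Euc n =>
      ENNReal.ofReal (‖h p.1 - h p.2‖ ^ 2 / ‖p.1 - p.2‖ ^ ((n : ℝ) + β)
        * ‖p.1‖ ^ (-((n : ℝ) - β) / 2) * ‖p.2‖ ^ (-((n : ℝ) - β) / 2))) := by
  fun_prop

/-- The error estimate for the order `β` and every function in `L²`, by truncation to balls. -/
theorem error_estimate {n : ℕ} {β : ℝ} (hβ : 0 < β) (hβ2 : β < 2) (hβn : β < n)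
    {f : Euc n → ℂ} (hf : Measurable f) (hf2 : MemLp f 2 volume) :
    ENNReal.ofReal (rieszD n β / pittC n β) * steinWeissForm n β f
      + ENNReal.ofReal (rieszD n β / besovD n β) *
          weightedBesovForm n β (groundStateQuotient n β f)
      ≤ sqNormL2 n f := by
  have hmain : ∀ k : ℕ, _ := fun k =>
    (error_estimate_of_integrable hβ hβ2 hβn
      (hf.indicator (measurableSet_closedBall (x := (0 : Euc n)) (ε := (k : ℝ))))
      (lintegral_enorm_indicator_closedBall_ne_top hf2 k)
      (hf2.indicator measurableSet_closedBall)).trans (sqNormL2_indicator_le f _)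
  have hex := ae_rieszConvExistsAt hβ hβn hf hf2
  have hm : ∀ k : ℕ, Measurable (rieszConv n β ((Metric.closedBall 0 (k : ℝ)).indicator f)) :=
    fun k => measurable_rieszConv (hf.indicator measurableSet_closedBall)
  have hq : ∀ k : ℕ, Measurable
      (groundStateQuotient n β ((Metric.closedBall 0 (k : ℝ)).indicator f)) :=
    fun k => measurable_groundStateQuotient (hf.indicator measurableSet_closedBall)
  have hlim : ∀ x, RieszConvExistsAt n β f x → Filter.Tendsto
      (fun k : ℕ => rieszConv n β ((Metric.closedBall 0 (k : ℝ)).indicator f) x)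
      Filter.atTop (nhds (rieszConv n β f x)) :=
    fun x hx => tendsto_rieszConv_indicator_closedBall hf hx
  have hquot : ∀ x, RieszConvExistsAt n β f x → Filter.Tendsto
      (fun k : ℕ => groundStateQuotient n β ((Metric.closedBall 0 (k : ℝ)).indicator f) x)
      Filter.atTop (nhds (groundStateQuotient n β f x)) :=
    fun x hx => (hlim x hx).const_mul (((‖x‖ ^ (((n : ℝ) - β) / 2) : ℝ) : ℂ))
  exact lintegral_add_lintegral_le_of_tendsto
    (fun k => measurable_steinWeiss_integrand (hm k))
    (fun k => measurable_weightedBesov_integrand (hq k))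
    (by
      filter_upwards [hex] with x hx
      exact ENNReal.tendsto_ofReal (((hlim x hx).norm.pow 2).const_mul _))
    (by
      filter_upwards [Measure.quasiMeasurePreserving_fst.ae hex,
        Measure.quasiMeasurePreserving_snd.ae hex] with p h1 h2
      exact ENNReal.tendsto_ofReal ((((((hquot _ h1).sub (hquot _ h2)).norm.pow 2).div_const
        _).mul_const _).mul_const _))
    hmain

/-- The error estimate with the Stein–Weiss form of a larger order. -/
theorem error_estimate_of_le {n : ℕ} {α β : ℝ} (hβ : 0 < β) (hβ2 : β < 2) (hβα : β ≤ α)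
    (hαn : α < n) {f : Euc n → ℂ} (hf : Measurable f) (hf2 : MemLp f 2 volume) :
    ENNReal.ofReal (rieszD n α / pittC n α) * steinWeissForm n α f
      + ENNReal.ofReal (rieszD n β / besovD n β) *
          weightedBesovForm n β (groundStateQuotient n β f)
      ≤ sqNormL2 n f :=
  le_trans (add_le_add_left (steinWeissForm_anti hβ hβα hαn hf hf2) _)
    (error_estimate hβ hβ2 (hβα.trans_lt hαn) hf hf2)

/-! ### The Stein–Weiss constant is not attained -/

/-- `|x|^(-n)` is not integrable. -/
theorem lintegral_rpow_neg_dim {n : ℕ} (hn : 0 < n) :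
    ∫⁻ x : Euc n, ENNReal.ofReal (‖x‖ ^ (-(n : ℝ))) = ∞ := by
  have : Nonempty (Fin n) := ⟨⟨0, hn⟩⟩
  by_contra h
  have hint : Integrable (fun x : Euc n => ‖x‖ ^ (-(n : ℝ))) :=
    (lintegral_ofReal_ne_top_iff_integrable (Measurable.aestronglyMeasurable (by fun_prop))
      (Filter.Eventually.of_forall fun x => by positivity)).1 h
  rw [integrable_fun_norm_addHaar volume (f := fun r : ℝ => r ^ (-(n : ℝ))),
    finrank_euclideanSpace_fin] at hint
  have h2 : IntegrableOn (fun r : ℝ => r ^ (-1 : ℝ)) (Set.Ioi 0) := by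
    refine hint.congr_fun (fun r (hr : 0 < r) => ?_) measurableSet_Ioi
    dsimp only
    rw [smul_eq_mul, ← rpow_natCast, ← rpow_add hr, Nat.cast_sub hn]
    congr 1
    push_cast; ring
  exact not_integrableOn_Ioi_rpow (-1) h2

/-- A function with vanishing weighted Besov form is constant almost everywhere. -/
theorem ae_const_of_weightedBesovForm_eq_zero {n : ℕ} (hn : 0 < n) {β : ℝ} {h : Euc n → ℂ}
    (hh : Measurable h) (h0 : weightedBesovForm n β h = 0) : ∃ c, ∀ᵐ x, h x = c := by
  rw [weightedBesovForm, lintegral_eq_zero_iff (by fun_prop), Measure.volume_eq_prod] at h0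
  have h1 := Measure.ae_ae_of_ae_prod h0
  have h2 := h1.and (ae_ne hn 0)
  obtain ⟨x, hx, hx0⟩ := h2.exists
  refine ⟨h x, ?_⟩
  filter_upwards [hx, ae_ne hn 0, ae_ne hn x] with y hy hy0 hyx
  simp only [Pi.zero_apply, ENNReal.ofReal_eq_zero] at hy
  by_contra hne
  have p1 : 0 < ‖h x - h y‖ := norm_pos_iff.2 (sub_ne_zero.2 (Ne.symm hne))
  have p2 : 0 < ‖x - y‖ := norm_pos_iff.2 (sub_ne_zero.2 hyx.symm)
  exact absurd hy (not_le.2 (by positivity))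

/-- Equality in the Stein–Weiss inequality forces the Besov form to vanish, so that the Riesz
potential is a multiple of `|x|^(-(n-β)/2)`; only the multiple `0` has a finite form. -/
theorem steinWeissForm_lt {n : ℕ} {α : ℝ} (hα : 0 < α) (hαn : α < n) {f : Euc n → ℂ}
    (hf : Measurable f) (hf2 : MemLp f 2 volume) (hne : sqNormL2 n f ≠ 0) :
    steinWeissForm n α f < ENNReal.ofReal (pittC n α / rieszD n α) * sqNormL2 n f := by
  have hn : 0 < n := by
    have : (0 : ℝ) < n := hα.trans hαn
    exact_mod_cast this
  have hd := rieszD_pos hα hαn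
  have hC := pittC_pos hα hαn
  have hN := sqNormL2_ne_top hf2
  refine lt_of_le_of_ne (steinWeissForm_le hα hαn hf) fun heq => hne ?_
  -- an order at most `α` for which the error estimate is available
  set β := min α 1 with hβdef
  have hβ : 0 < β := lt_min hα one_pos
  have hβ2 : β < 2 := (min_le_right _ _).trans_lt one_lt_two
  have hβα : β ≤ α := min_le_left _ _
  have hβn := hβα.trans_lt hαn
  have hdβ := rieszD_pos hβ hβn
  have hmain := error_estimate_of_le hβ hβ2 hβα hαn hf hf2
  have hsw : ENNReal.ofReal (rieszD n α / pittC n α) * steinWeissForm n α f = sqNormL2 n f := by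
    rw [heq, ← mul_assoc, ← ENNReal.ofReal_mul (by positivity), div_mul_div_cancel₀ hC.ne',
      div_self hd.ne', ENNReal.ofReal_one, one_mul]
  rw [hsw] at hmain
  have hB0 : weightedBesovForm n β (groundStateQuotient n β f) = 0 := by
    have h1 : ENNReal.ofReal (rieszD n β / besovD n β) *
        weightedBesovForm n β (groundStateQuotient n β f) = 0 := by
      have : sqNormL2 n f + ENNReal.ofReal (rieszD n β / besovD n β) *
        weightedBesovForm n β (groundStateQuotient n β f) ≤ sqNormL2 n f + 0 := by simpa using hmain
      exact le_antisymm ((ENNReal.add_le_add_iff_left hN).1 this) bot_le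
    have hpos := div_pos hdβ (besovD_pos (n := n) hβ hβ2)
    rcases mul_eq_zero.1 h1 with h | h
    · rw [ENNReal.ofReal_eq_zero] at h; exact absurd h (not_le.2 hpos)
    · exact h
  obtain ⟨c, hc⟩ := ae_const_of_weightedBesovForm_eq_zero hn (measurable_groundStateQuotient hf) hB0
  have hform : steinWeissForm n β f = ENNReal.ofReal (‖c‖ ^ 2) *
      ∫⁻ x : Euc n, ENNReal.ofReal (‖x‖ ^ (-(n : ℝ))) := by
    rw [← lintegral_const_mul' _ _ ENNReal.ofReal_ne_top, steinWeissForm]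
    refine lintegral_congr_ae ?_
    filter_upwards [hc, ae_ne hn 0] with x hx hx0
    have hx' := norm_pos_iff.2 hx0
    have hw : (‖x‖ ^ (((n : ℝ) - β) / 2)) ^ 2 * ‖x‖ ^ (-(n : ℝ)) = ‖x‖ ^ (-β) := by
      rw [← rpow_natCast, ← rpow_mul hx'.le, ← rpow_add hx']
      congr 1
      push_cast; ring
    rw [← ENNReal.ofReal_mul (by positivity), ← hx, groundStateQuotient, norm_mul,
      Complex.norm_real, norm_of_nonneg (by positivity), ← hw]
    congr 1
    ring
  have hfin : steinWeissForm n β f ≠ ∞ :=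
    ne_top_of_le_ne_top (by finiteness) (steinWeissForm_le hβ hβn hf)
  have hc0 : ENNReal.ofReal (‖c‖ ^ 2) = 0 := by
    by_contra hc0
    rw [hform, lintegral_rpow_neg_dim hn, ENNReal.mul_top hc0] at hfin
    exact hfin rfl
  have hβ0 : steinWeissForm n β f = 0 := by rw [hform, hc0, zero_mul]
  have := steinWeissForm_anti hβ hβα hαn hf hf2
  rw [hsw, hβ0, mul_zero] at this
  exact le_antisymm this bot_le

/-! ### Sharpness of the Stein–Weiss constant -/

/-- Polar coordinates: `∫_{|x|<ρ} |x|^(s-n) dx` is a constant multiple of `ρ^s / s`. -/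
theorem setLIntegral_rpow_ball {n : ℕ} (hn : 0 < n) : ∃ c : ℝ, 0 < c ∧ ∀ s ρ : ℝ, 0 < s → 0 < ρ →
    ∫⁻ x in Metric.ball (0 : Euc n) ρ, ENNReal.ofReal (‖x‖ ^ (s - n))
      = ENNReal.ofReal (c * (ρ ^ s / s)) := by
  have : Nonempty (Fin n) := ⟨⟨0, hn⟩⟩
  refine ⟨n * (volume : Measure (Euc n)).real (Metric.ball 0 1), ?_, fun s ρ hs hρ => ?_⟩
  · have : 0 < (volume : Measure (Euc n)).real (Metric.ball 0 1) :=
      ENNReal.toReal_pos (Metric.measure_ball_pos _ _ one_pos).ne' measure_ball_lt_top.ne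
    positivity
  have hpow : ∀ r : ℝ, 0 < r → r ^ (n - 1) • r ^ (s - n) = r ^ (s - 1) := by
    intro r hr
    rw [smul_eq_mul, ← rpow_natCast, ← rpow_add hr, Nat.cast_sub hn]
    congr 1
    push_cast; ring
  have hint : IntegrableOn (fun x : Euc n => ‖x‖ ^ (s - n)) (Metric.ball 0 ρ) := by
    rw [integrableOn_fun_norm_addHaar volume (f := fun r : ℝ => r ^ (s - n)),
      finrank_euclideanSpace_fin]
    have h1 : IntegrableOn (fun r : ℝ => r ^ (s - 1)) (Set.Ioo 0 ρ) :=
      (intervalIntegral.integrableOn_Ioo_rpow_iff hρ).2 (by linarith)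
    exact h1.congr_fun (fun r hr => (hpow r hr.1).symm) measurableSet_Ioo
  rw [← ofReal_integral_eq_lintegral_ofReal hint
    (Filter.Eventually.of_forall fun x => by positivity)]
  congr 1
  have h2 := integral_fun_norm_addHaar (volume : Measure (Euc n))
    ((Set.Iio ρ).indicator fun r : ℝ => r ^ (s - n))
  have h3 : ∀ x : Euc n, (Set.Iio ρ).indicator (fun r : ℝ => r ^ (s - n)) ‖x‖
      = (Metric.ball (0 : Euc n) ρ).indicator (fun x => ‖x‖ ^ (s - n)) x := by
    intro x
    by_cases hx : ‖x‖ < ρ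
    · rw [Set.indicator_of_mem (by exact hx), Set.indicator_of_mem (by simpa using hx)]
    · rw [Set.indicator_of_notMem (by exact hx), Set.indicator_of_notMem (by simpa using hx)]
  simp only [h3] at h2
  rw [integral_indicator measurableSet_ball] at h2
  rw [h2, finrank_euclideanSpace_fin, nsmul_eq_mul, smul_eq_mul, mul_assoc]
  congr 2
  have h4 : ∫ y in Set.Ioi (0 : ℝ), y ^ (n - 1) • (Set.Iio ρ).indicator (fun r => r ^ (s - n)) y
      = ∫ y in Set.Ioi (0 : ℝ), (Set.Iio ρ).indicator (fun r => r ^ (s - 1)) y := by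
    refine setIntegral_congr_fun measurableSet_Ioi fun r (hr : 0 < r) => ?_
    by_cases h : r ∈ Set.Iio ρ
    · rw [Set.indicator_of_mem h, Set.indicator_of_mem h, hpow r hr]
    · rw [Set.indicator_of_notMem h, Set.indicator_of_notMem h, smul_zero]
  rw [h4, setIntegral_indicator measurableSet_Iio, Set.Ioi_inter_Iio, ← integral_Ioc_eq_integral_Ioo,
    ← intervalIntegral.integral_of_le hρ.le, integral_rpow (Or.inl (by linarith)), sub_add_cancel,
    zero_rpow hs.ne', sub_zero]

theorem memLp_two_of_sqNormL2_ne_top {n : ℕ} {f : Euc n → ℂ} (hf : Measurable f)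
    (h : sqNormL2 n f ≠ ∞) : MemLp f 2 volume := by
  refine ⟨hf.aestronglyMeasurable, ?_⟩
  rw [eLpNorm_lt_top_iff_lintegral_rpow_enorm_lt_top (by norm_num) (by norm_num)]
  rw [sqNormL2_eq] at h
  simpa using lt_top_iff_ne_top.2 h

/-- For a nonnegative function the Riesz potential is the Lebesgue integral, where that is finite. -/
theorem enorm_rieszConv_of_nonneg {n : ℕ} {α : ℝ} {g : Euc n → ℝ} (hg : Measurable g)
    (hg0 : ∀ y, 0 ≤ g y) {x : Euc n} (hx : rieszAbs n α (fun y => (g y : ℂ)) x ≠ ∞) :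
    ‖rieszConv n α (fun y => (g y : ℂ)) x‖ₑ = rieszAbs n α (fun y => (g y : ℂ)) x := by
  have h0 : ∀ y, 0 ≤ rpowKernel n (α / 4) (x - y) * g y := fun y =>
    mul_nonneg (rpowKernel_nonneg _) (hg0 y)
  have h1 : ∫⁻ y, ENNReal.ofReal (rpowKernel n (α / 4) (x - y) * g y)
      = rieszAbs n α (fun y => (g y : ℂ)) x := by
    refine lintegral_congr fun y => ?_
    dsimp only
    rw [ENNReal.ofReal_mul (rpowKernel_nonneg _), ← ofReal_norm (g y : ℂ), Complex.norm_real,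
      norm_of_nonneg (hg0 y)]
  have hint : Integrable fun y => rpowKernel n (α / 4) (x - y) * g y := by
    refine (lintegral_ofReal_ne_top_iff_integrable (Measurable.aestronglyMeasurable (by fun_prop))
      (Filter.Eventually.of_forall h0)).1 ?_
    rwa [h1]
  rw [rieszConv_eq, ← h1, ← ofReal_integral_eq_lintegral_ofReal hint (Filter.Eventually.of_forall h0)]
  have h2 : ∀ y, rpowKernel n (α / 4) (x - y) • (g y : ℂ)
      = ((rpowKernel n (α / 4) (x - y) * g y : ℝ) : ℂ) := fun y => by simp
  simp only [h2]
  rw [integral_complex_ofReal, ← ofReal_norm, Complex.norm_real,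
    norm_of_nonneg (integral_nonneg h0)]

theorem continuousAt_rieszComp {n : ℕ} {a b : ℝ} (ha : 0 < a) (hb : 0 < b)
    (hab : a + b < (n : ℝ) / 2) : ContinuousAt (fun a => rieszComp n a b) a := by
  have hΓ : ∀ x : ℝ, 0 < x → ContinuousAt Gamma x := fun x hx =>
    (differentiableAt_Gamma fun m => by
      linarith).continuousAt
  have hm : ∀ c : ℝ, c < (n : ℝ) / 2 → ContinuousAt (heatMix n) c := by
    intro c hc
    unfold heatMix
    have h1 : ContinuousAt (fun b => Gamma ((n : ℝ) / 2 - b)) c :=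
      ContinuousAt.comp (f := fun b => (n : ℝ) / 2 - b) (hΓ _ (by linarith)) (by fun_prop)
    have h2 : ContinuousAt (fun b : ℝ => (4 : ℝ) ^ (-b)) c :=
      (continuous_const.rpow continuous_neg (by norm_num)).continuousAt
    exact (continuousAt_const.mul h2).mul h1
  have h1 : ContinuousAt (fun a => heatMix n (a + b)) a :=
    ContinuousAt.comp (f := fun a => a + b) (hm _ hab) (by fun_prop)
  have h2 : ContinuousAt (fun a => Gamma (a + b)) a :=
    ContinuousAt.comp (f := fun a => a + b) (hΓ _ (by linarith)) (by fun_prop)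
  have h3 : heatMix n a * heatMix n b ≠ 0 :=
    (mul_pos (heatMix_pos (by linarith)) (heatMix_pos (by linarith))).ne'
  have h4 : Gamma (a + b) ≠ 0 := (Gamma_pos_of_pos (by linarith)).ne'
  unfold rieszComp
  exact (h1.div ((hm a (by linarith)).mul continuousAt_const) h3).mul
    (((hΓ a ha).mul continuousAt_const).div h2 h4)

/-- The part of the composition integral away from the origin is bounded near the origin. -/
theorem exists_lintegral_tail_le {n : ℕ} {α : ℝ} (hα : 0 < α) (hαn : α < n) : ∃ T : ℝ, 0 ≤ T ∧
    ∀ δ : ℝ, δ ≤ (n - α) / 4 → ∀ x : Euc n, ‖x‖ ≤ 1 / 2 →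
      ∫⁻ y in (Metric.ball (0 : Euc n) 1)ᶜ, ENNReal.ofReal (rpowKernel n (α / 4) (x - y)) *
        ENNReal.ofReal (‖y‖ ^ (δ - (n : ℝ) / 2)) ≤ ENNReal.ofReal T := by
  -- the integrand decays like the power `-n - (n - α) / 4` or faster
  set r : ℝ := n + (n - α) / 4 with hr
  have hint : Integrable (fun y : Euc n => (1 + ‖y‖) ^ (-r)) :=
    integrable_one_add_norm (by rw [finrank_euclideanSpace_fin]; linarith)
  refine ⟨4 ^ r * ∫ y : Euc n, (1 + ‖y‖) ^ (-r), ?_, fun δ hδ x hx => ?_⟩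
  · have : 0 ≤ ∫ y : Euc n, (1 + ‖y‖) ^ (-r) := integral_nonneg fun y => by positivity
    positivity
  rw [← integral_const_mul, ofReal_integral_eq_lintegral_ofReal (hint.const_mul _)
    (Filter.Eventually.of_forall fun y => by positivity)]
  refine le_trans (setLIntegral_mono' measurableSet_ball.compl fun y hy => ?_)
    (setLIntegral_le_lintegral _ _)
  have hy1 : 1 ≤ ‖y‖ := by simpa using hy
  rw [← ENNReal.ofReal_mul (rpowKernel_nonneg _), rpowKernel]
  refine ENNReal.ofReal_le_ofReal ?_
  have hq : 0 < (1 + ‖y‖) / 4 := by positivity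
  have h1 : (1 + ‖y‖) / 4 ≤ ‖x - y‖ := by
    have := norm_sub_norm_le y x
    rw [norm_sub_rev] at this
    linarith
  have e1 : ‖x - y‖ ^ (2 * (α / 4) - n) ≤ ((1 + ‖y‖) / 4) ^ (2 * (α / 4) - n) :=
    rpow_le_rpow_of_nonpos hq h1 (by linarith)
  have e2 : ‖y‖ ^ (δ - (n : ℝ) / 2) ≤ ((1 + ‖y‖) / 4) ^ ((n - α) / 4 - (n : ℝ) / 2) :=
    (rpow_le_rpow_of_exponent_le hy1 (by linarith)).trans
      (rpow_le_rpow_of_nonpos hq (by linarith) (by linarith))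
  calc _ ≤ ((1 + ‖y‖) / 4) ^ (2 * (α / 4) - n) * ((1 + ‖y‖) / 4) ^ ((n - α) / 4 - (n : ℝ) / 2) := by
        gcongr
    _ = ((1 + ‖y‖) / 4) ^ (-r) := by
        rw [← rpow_add hq]; congr 1; rw [hr]; ring
    _ = 4 ^ r * (1 + ‖y‖) ^ (-r) := by
        rw [div_rpow (by positivity) (by norm_num), rpow_neg (x := 4) (by norm_num), div_inv_eq_mul,
          mul_comm]

/-- The Riesz potential of `|y|^(δ-n/2)` cut off to the unit ball, near the origin. -/
theorem le_rieszAbs_truncated {n : ℕ} {α δ T ρ : ℝ} (hα : 0 < α) (hδ : 0 < δ)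
    (hδ' : δ ≤ (n - α) / 4) (hT0 : 0 ≤ T)
    (hT : ∀ x : Euc n, ‖x‖ ≤ 1 / 2 →
      ∫⁻ y in (Metric.ball (0 : Euc n) 1)ᶜ, ENNReal.ofReal (rpowKernel n (α / 4) (x - y)) *
        ENNReal.ofReal (‖y‖ ^ (δ - (n : ℝ) / 2)) ≤ ENNReal.ofReal T)
    (hρ : ρ ≤ 1 / 2) {x : Euc n} (hx0 : x ≠ 0) (hx : ‖x‖ < ρ) {g : Euc n → ℝ}
    (hg : g = (Metric.ball 0 1).indicator fun y => ‖y‖ ^ (δ - (n : ℝ) / 2)) :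
    ENNReal.ofReal ((rieszComp n ((n : ℝ) / 4 + δ / 2) (α / 4) - T * ρ ^ ((n - α) / 4)) *
        ‖x‖ ^ (α / 2 - (n : ℝ) / 2 + δ))
      ≤ rieszAbs n α (fun y => (g y : ℂ)) x := by
  have hx' := norm_pos_iff.2 hx0
  have hρ0 := hx'.trans hx
  have h := lintegral_riesz_mul_riesz (n := n) (a := (n : ℝ) / 4 + δ / 2) (b := α / 4)
    (by linarith) (by linarith) (by linarith) hx0
  rw [← lintegral_add_compl _ (measurableSet_ball (x := (0 : Euc n)) (ε := 1))] at h
  have e1 : ∫⁻ y in Metric.ball (0 : Euc n) 1, ENNReal.ofReal (‖x - y‖ ^ (2 * (α / 4) - n)) *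
      ENNReal.ofReal (‖y‖ ^ (2 * ((n : ℝ) / 4 + δ / 2) - n))
      = rieszAbs n α (fun y => (g y : ℂ)) x := by
    rw [rieszAbs, kconv, ← lintegral_indicator measurableSet_ball]
    refine lintegral_congr fun y => ?_
    by_cases hy : y ∈ Metric.ball (0 : Euc n) 1
    · rw [Set.indicator_of_mem hy, hg, Set.indicator_of_mem hy, ← ofReal_norm (_ : ℂ),
        Complex.norm_real, norm_of_nonneg (by positivity), rpowKernel]
      congr 3
      ring
    · rw [Set.indicator_of_notMem hy, hg, Set.indicator_of_notMem hy]
      simp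
  have e2 : ∫⁻ y in (Metric.ball (0 : Euc n) 1)ᶜ, ENNReal.ofReal (‖x - y‖ ^ (2 * (α / 4) - n)) *
      ENNReal.ofReal (‖y‖ ^ (2 * ((n : ℝ) / 4 + δ / 2) - n)) ≤ ENNReal.ofReal T := by
    refine le_trans (le_of_eq ?_) (hT x (hx.le.trans hρ))
    refine lintegral_congr fun y => ?_
    rw [rpowKernel]
    congr 3
    ring
  rw [sub_mul, ENNReal.ofReal_sub _ (by positivity), tsub_le_iff_right]
  rw [e1, show 2 * ((n : ℝ) / 4 + δ / 2 + α / 4) - n = α / 2 - (n : ℝ) / 2 + δ by ring] at h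
  rw [← h]
  gcongr
  refine e2.trans (ENNReal.ofReal_le_ofReal ?_)
  -- `1 ≤ (|x|/ρ)^(α/2-n/2+δ)`, with an exponent at most `-(n-α)/4`
  have h1 : 1 ≤ ρ ^ ((n - α) / 4) * ‖x‖ ^ (α / 2 - (n : ℝ) / 2 + δ) := by
    calc (1 : ℝ) = ρ ^ ((n - α) / 4) * ρ ^ (-((n - α) / 4)) := by
          rw [← rpow_add hρ0, add_neg_cancel, rpow_zero]
      _ ≤ ρ ^ ((n - α) / 4) * ρ ^ (α / 2 - (n : ℝ) / 2 + δ) := by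
          gcongr ?_ * ?_
          exact rpow_le_rpow_of_exponent_ge hρ0 (by linarith) (by linarith)
      _ ≤ _ := by
          gcongr ?_ * ?_
          exact rpow_le_rpow_of_nonpos hx' hx.le (by linarith)
  nlinarith

/-- Testing the Stein–Weiss inequality on `|x|^(δ-n/2)` cut off to the unit ball. -/
theorem le_of_steinWeissForm_le {n : ℕ} {α δ T ρ K : ℝ} (hα : 0 < α) (hαn : α < n) (hδ : 0 < δ)
    (hδ' : δ ≤ (n - α) / 4) (hT0 : 0 ≤ T)
    (hT : ∀ x : Euc n, ‖x‖ ≤ 1 / 2 →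
      ∫⁻ y in (Metric.ball (0 : Euc n) 1)ᶜ, ENNReal.ofReal (rpowKernel n (α / 4) (x - y)) *
        ENNReal.ofReal (‖y‖ ^ (δ - (n : ℝ) / 2)) ≤ ENNReal.ofReal T)
    (hρ0 : 0 < ρ) (hρ : ρ ≤ 1 / 2)
    (hM : 0 < rieszComp n ((n : ℝ) / 4 + δ / 2) (α / 4) - T * ρ ^ ((n - α) / 4))
    (hK : ∀ f : Euc n → ℂ, MemLp f 2 volume →
      steinWeissForm n α f ≤ ENNReal.ofReal K * sqNormL2 n f) :
    (rieszComp n ((n : ℝ) / 4 + δ / 2) (α / 4) - T * ρ ^ ((n - α) / 4)) ^ 2 * ρ ^ (2 * δ) ≤ K := by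
  have hn : 0 < n := by
    have : (0 : ℝ) < n := hα.trans hαn
    exact_mod_cast this
  obtain ⟨c, hc, hball⟩ := setLIntegral_rpow_ball hn
  set g : Euc n → ℝ := (Metric.ball 0 1).indicator fun y => ‖y‖ ^ (δ - (n : ℝ) / 2) with hg
  have hgm : Measurable g := Measurable.indicator (by fun_prop) measurableSet_ball
  have hg0 : ∀ y, 0 ≤ g y := fun y => Set.indicator_nonneg (fun _ _ => by positivity) y
  set f : Euc n → ℂ := fun y => (g y : ℂ) with hf
  have hfm : Measurable f := by fun_prop
  have hN : sqNormL2 n f = ENNReal.ofReal (c * (1 / (2 * δ))) := by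
    have h1 := hball (2 * δ) 1 (by linarith) one_pos
    rw [one_rpow] at h1
    rw [← h1, ← lintegral_indicator measurableSet_ball, sqNormL2]
    refine lintegral_congr_ae ?_
    filter_upwards [ae_ne hn 0] with y hy0
    have hy' := norm_pos_iff.2 hy0
    rw [hf]
    dsimp only
    rw [Complex.norm_real, norm_of_nonneg (hg0 y), hg]
    by_cases hy : y ∈ Metric.ball (0 : Euc n) 1
    · rw [Set.indicator_of_mem hy, Set.indicator_of_mem hy, ← rpow_natCast, ← rpow_mul hy'.le]
      congr 2
      push_cast; ring
    · rw [Set.indicator_of_notMem hy, Set.indicator_of_notMem hy]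
      simp
  have hf2 : MemLp f 2 volume := memLp_two_of_sqNormL2_ne_top hfm (by rw [hN]; finiteness)
  set M := rieszComp n ((n : ℝ) / 4 + δ / 2) (α / 4) - T * ρ ^ ((n - α) / 4) with hMdef
  have hlow : ENNReal.ofReal (M ^ 2 * (c * (ρ ^ (2 * δ) / (2 * δ)))) ≤ steinWeissForm n α f := by
    rw [ENNReal.ofReal_mul (by positivity), ← hball (2 * δ) ρ (by linarith) hρ0,
      ← lintegral_const_mul' _ _ ENNReal.ofReal_ne_top, steinWeissForm_eq]
    refine le_trans (lintegral_mono_ae (μ := volume.restrict (Metric.ball 0 ρ))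
      (g := fun x => ENNReal.ofReal (‖x‖ ^ (-α)) * ‖rieszConv n α f x‖ₑ ^ 2) ?_)
      (setLIntegral_le_lintegral _ _)
    rw [ae_restrict_iff' measurableSet_ball]
    filter_upwards [ae_ne hn 0, ae_rieszAbs_ne_top hα hαn hfm hf2] with x hx0 hxt hxρ
    have hx' := norm_pos_iff.2 hx0
    rw [enorm_rieszConv_of_nonneg hgm hg0 hxt]
    have h1 := le_rieszAbs_truncated hα hδ hδ' hT0 hT hρ hx0 (by simpa using hxρ) hg
    calc _ = ENNReal.ofReal (‖x‖ ^ (-α)) *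
          ENNReal.ofReal (M * ‖x‖ ^ (α / 2 - (n : ℝ) / 2 + δ)) ^ 2 := by
          rw [← ENNReal.ofReal_pow (by positivity), ← ENNReal.ofReal_mul (by positivity),
            ← ENNReal.ofReal_mul (by positivity)]
          have e : ‖x‖ ^ (2 * δ - n) = ‖x‖ ^ (-α) * (‖x‖ ^ (α / 2 - (n : ℝ) / 2 + δ)) ^ 2 := by
            rw [← rpow_natCast, ← rpow_mul hx'.le, ← rpow_add hx']
            congr 1
            push_cast; ring
          rw [e]
          congr 1
          ring
      _ ≤ _ := by gcongr
  have h := hlow.trans (hK f hf2)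
  rw [hN, ← ENNReal.ofReal_mul' (by positivity)] at h
  rcases (ENNReal.ofReal_le_ofReal_iff' ).1 h with h | h
  · have hcδ : 0 < c * (1 / (2 * δ)) := by positivity
    refine le_of_mul_le_mul_right (le_trans (le_of_eq ?_) h) hcδ
    ring
  · exact absurd h (not_le.2 (by positivity))

/-- No constant smaller than `C_α / d_α` is admissible in the Stein–Weiss inequality. -/
theorem pittC_div_rieszD_le {n : ℕ} {α K : ℝ} (hα : 0 < α) (hαn : α < n)
    (hK : ∀ f : Euc n → ℂ, MemLp f 2 volume →
      steinWeissForm n α f ≤ ENNReal.ofReal K * sqNormL2 n f) :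
    pittC n α / rieszD n α ≤ K := by
  obtain ⟨T, hT0, hT⟩ := exists_lintegral_tail_le hα hαn
  rw [pittC_div_rieszD hα hαn, show (0 + (n : ℝ) / 2) / 2 = (n : ℝ) / 4 by ring]
  set R := rieszComp n ((n : ℝ) / 4) (α / 4) with hR
  have hR0 : 0 < R := rieszComp_pos (by linarith) (by linarith) (by linarith)
  have hlimρ : Filter.Tendsto (fun ρ : ℝ => R - T * ρ ^ ((n - α) / 4)) (nhdsWithin 0 (Set.Ioi 0))
      (nhds R) := by
    have h1 : ContinuousAt (fun ρ : ℝ => R - T * ρ ^ ((n - α) / 4)) 0 :=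
      continuousAt_const.sub (continuousAt_const.mul
        (continuousAt_rpow_const _ _ (Or.inr (by linarith))))
    have h2 := h1.tendsto
    rw [zero_rpow (by linarith), mul_zero, sub_zero] at h2
    exact h2.mono_left nhdsWithin_le_nhds
  -- let `δ → 0` for a fixed radius `ρ`, and then `ρ → 0`
  refine le_of_tendsto (hlimρ.pow 2) ?_
  filter_upwards [hlimρ.eventually (lt_mem_nhds hR0), self_mem_nhdsWithin,
    mem_nhdsWithin_of_mem_nhds (Iic_mem_nhds (show (0 : ℝ) < 1 / 2 by norm_num))]
    with ρ hM (hρ0 : 0 < ρ) (hρ : ρ ≤ 1 / 2)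
  have hlimδ : Filter.Tendsto (fun δ : ℝ => rieszComp n ((n : ℝ) / 4 + δ / 2) (α / 4)
      - T * ρ ^ ((n - α) / 4)) (nhdsWithin 0 (Set.Ioi 0)) (nhds (R - T * ρ ^ ((n - α) / 4))) := by
    have h0 : ContinuousAt (fun δ : ℝ => rieszComp n ((n : ℝ) / 4 + δ / 2) (α / 4)) 0 := by
      refine ContinuousAt.comp (g := fun a => rieszComp n a (α / 4))
        (f := fun δ : ℝ => (n : ℝ) / 4 + δ / 2) ?_ (by fun_prop)
      exact continuousAt_rieszComp (by linarith) (by linarith) (by linarith)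
    have h2 := h0.tendsto
    rw [zero_div, add_zero] at h2
    exact (h2.mono_left nhdsWithin_le_nhds).sub_const _
  have hlimp : Filter.Tendsto (fun δ : ℝ => ρ ^ (2 * δ)) (nhdsWithin 0 (Set.Ioi 0)) (nhds 1) := by
    have h1 : Continuous (fun δ : ℝ => ρ ^ (2 * δ)) :=
      continuous_const.rpow (by fun_prop) fun _ => Or.inl hρ0.ne'
    have h2 := h1.tendsto 0
    rw [mul_zero, rpow_zero] at h2
    exact h2.mono_left nhdsWithin_le_nhds
  have hlim := (hlimδ.pow 2).mul hlimp
  rw [mul_one] at hlim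
  refine le_of_tendsto hlim ?_
  filter_upwards [hlimδ.eventually (lt_mem_nhds hM), self_mem_nhdsWithin,
    mem_nhdsWithin_of_mem_nhds (Iic_mem_nhds (show (0 : ℝ) < (n - α) / 4 by linarith))]
    with δ hMδ (hδ : 0 < δ) (hδ' : δ ≤ (n - α) / 4)
  exact le_of_steinWeissForm_le hα hαn hδ hδ' hT0 (hT δ hδ') hρ0 hρ hMδ hK

/-! ### Passage to measurable representatives -/

theorem rieszConv_congr {n : ℕ} {α : ℝ} {f g : Euc n → ℂ} (h : f =ᵐ[volume] g) :
    rieszConv n α f = rieszConv n α g := by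
  ext x
  rw [rieszConv_eq, rieszConv_eq]
  refine integral_congr_ae ?_
  filter_upwards [h] with y hy
  rw [hy]

theorem rieszConvExistsAt_congr {n : ℕ} {α : ℝ} {f g : Euc n → ℂ} (h : f =ᵐ[volume] g)
    (x : Euc n) : RieszConvExistsAt n α f x ↔ RieszConvExistsAt n α g x := by
  rw [rieszConvExistsAt_iff, rieszConvExistsAt_iff]
  refine integrable_congr ?_
  filter_upwards [h] with y hy
  rw [hy]

theorem sqNormL2_congr {n : ℕ} {f g : Euc n → ℂ} (h : f =ᵐ[volume] g) :
    sqNormL2 n f = sqNormL2 n g := by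
  refine lintegral_congr_ae ?_
  filter_upwards [h] with y hy
  rw [hy]

theorem steinWeissForm_congr {n : ℕ} {α : ℝ} {f g : Euc n → ℂ} (h : f =ᵐ[volume] g) :
    steinWeissForm n α f = steinWeissForm n α g := by
  rw [steinWeissForm, steinWeissForm, rieszConv_congr h]

theorem groundStateQuotient_congr {n : ℕ} {β : ℝ} {f g : Euc n → ℂ} (h : f =ᵐ[volume] g) :
    groundStateQuotient n β f = groundStateQuotient n β g := by
  ext x
  rw [groundStateQuotient, groundStateQuotient, rieszConv_congr h]

theorem ae_eq_zero_of_sqNormL2_eq_zero {n : ℕ} {f : Euc n → ℂ} (hf : Measurable f)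
    (h : sqNormL2 n f = 0) : f =ᵐ[volume] 0 := by
  rw [sqNormL2_eq, lintegral_eq_zero_iff (by fun_prop)] at h
  filter_upwards [h] with x hx
  simpa using hx

theorem theorem2 (n : ℕ) (α β : ℝ) (hβ0 : 0 < β) (hβ2 : β < 2) (hβα : β ≤ α)
    (hαn : α < (n : ℝ)) :
    -- the error estimate, with both convolutions convergent almost everywhere
    (∀ f : EuclideanSpace ℝ (Fin n) → ℂ, MemLp f 2 volume →
      (∀ᵐ x, RieszConvExistsAt n α f x) ∧
      (∀ᵐ x, RieszConvExistsAt n β f x) ∧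
      ENNReal.ofReal (rieszD n α / pittC n α) * steinWeissForm n α f
        + ENNReal.ofReal (rieszD n β / besovD n β)
            * weightedBesovForm n β (groundStateQuotient n β f)
        ≤ sqNormL2 n f) ∧
    -- the sharp constant in the Stein–Weiss inequality is `C_α / d_α`
    IsLeast {K : ℝ | ∀ f : EuclideanSpace ℝ (Fin n) → ℂ, MemLp f 2 volume →
        steinWeissForm n α f ≤ ENNReal.ofReal K * sqNormL2 n f}
      (pittC n α / rieszD n α) ∧
    -- and it is not attained
    (∀ f : EuclideanSpace ℝ (Fin n) → ℂ, MemLp f 2 volume → ¬ (f =ᵐ[volume] 0) →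
      steinWeissForm n α f < ENNReal.ofReal (pittC n α / rieszD n α) * sqNormL2 n f) := by
  have hα := hβ0.trans_le hβα
  refine ⟨fun f hf => ?_, ⟨fun f hf => ?_, fun K hK => pittC_div_rieszD_le hα hαn hK⟩,
    fun f hf hne => ?_⟩ <;>
  obtain ⟨g, hg, hfg⟩ := hf.1 <;>
  have hgm := hg.measurable <;>
  have hg2 : MemLp g 2 volume := hf.ae_eq hfg
  · rw [steinWeissForm_congr hfg, groundStateQuotient_congr hfg, sqNormL2_congr hfg]
    simp only [rieszConvExistsAt_congr hfg]
    exact ⟨ae_rieszConvExistsAt hα hαn hgm hg2,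
      ae_rieszConvExistsAt hβ0 (hβα.trans_lt hαn) hgm hg2,
      error_estimate_of_le hβ0 hβ2 hβα hαn hgm hg2⟩
  · rw [steinWeissForm_congr hfg, sqNormL2_congr hfg]
    exact steinWeissForm_le hα hαn hgm
  · rw [steinWeissForm_congr hfg, sqNormL2_congr hfg]
    exact steinWeissForm_lt hα hαn hgm hg2 fun h0 =>
      hne (hfg.trans (ae_eq_zero_of_sqNormL2_eq_zero hgm h0))
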